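/- For a partition $\lambda=(\lambda_1\ge\lambda_2\ge\cdots)$ and $\mu\subset\lambda$ let $s_{\lambda/\mu}=\det(h_{\lambda_i-\mu_j-i+j})_{i,j=1}^{l(\lambda)}$ be the skew Schur function ($h_r$ the complete homogeneous symmetric functions, $h_r=0$ for $r<0$), $s_\lambda=s_{\lambda/\emptyset}$, and $\tau_\lambda=\sum s_{\lambda/\mu}$, where the sum is over all $\mu\subset\lambda$ whose transpose $\mu'$ has only even parts. Let $T=\{t_1,\dots,t_d\}$ be a set of $d$ distinct integers, let $n$ be an integer with $n>d$ and $n>d-t_k$ for every $k$, and let $X=(x_1,\dots,x_n)$, $Y=(y_1,\dots,y_n)$ with $x_i,y_i\in(0,1)$ be such that $Z(X;Y)=\sum_\lambda s_\lambda(X)\tau_\lambda(Y)$ converges absolutely. Let $\mathbb P(\lambda)=s_\lambda(X)\tau_\lambda(Y)/Z(X;Y)$ be the Pfaffian Schur measure, and let $$\rho_{psm}(T)=\mathbb P\big(\text{for every }k\in[1,d]\text{ there is an }i\in[1,n]\text{ with }\lambda_i-i=t_k\big).$$ Let $\mathfrak C_1,\dots,\mathfrak C_6$ be closed piecewise continuously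 differentiable curves in $\mathbb C$. A point is called inside (outside) such a curve if it does not lie on the curve and the curve has winding number $1$ ($0$) around it. Assume: * $|z|>1$ on each of $\mathfrak C_1,\mathfrak C_2,\mathfrak C_3$; all the points $x_i^{-1}$ are inside, and $0$ is outside, each of these three curves; * all the points $x_i^{-1}$ and $y_i^{-1}$ are inside $\mathfrak C_4$, $0$ is outside $\mathfrak C_4$, and $|zw|>1$ for all $z\in\mathfrak C_3$, $w\in\mathfrak C_4$; * $|z|<1$ on $\mathfrak C_5$ and on $\mathfrak C_6$, and $0$ is inside both. For $k,l\in[1,d]$ put $$\mathcal K_{11}(k,l)=\frac1{(2\pi i)^2}\oint_{\mathfrak C_1}\oint_{\mathfrak C_2}\frac{z-w}{(z^2-1)(w^2-1)(zw-1)}\prod_{i=1}^n\frac{(1-z^{-1}x_i)(1-w^{-1}x_i)(1-z^{-1}y_i)(1-w^{-1}y_i)}{(1-zx_i)(1-wx_i)}\,\frac{dz\,dw}{z^{t_k}w^{t_l}},$$ $$\mathcal K_{12}(k,l)=\frac1{(2\pi i)^2}\oint_{\mathfrak C_3}\oint_{\mathfrak C_4}\frac{z-w}{w(z^2-1)(zw-1)}\prod_{i=1}^n\frac{(1-w^{-1}x_i)(1-z^{-1}x_i)(1-z^{-1}y_i)}{(1-zx_i)(1-wx_i)(1-wy_i)}\,\frac{dz\,dw}{z^{t_k}w^{t_l}},$$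 $$\mathcal K_{21}(k,l)=-\mathcal K_{12}(l,k),$$ $$\mathcal K_{22}(k,l)=\frac1{(2\pi i)^2}\oint_{\mathfrak C_5}\oint_{\mathfrak C_6}\frac{z-w}{zw(zw-1)}\prod_{i=1}^n\frac{(1-z^{-1}x_i)(1-w^{-1}x_i)}{(1-zx_i)(1-wx_i)(1-zy_i)(1-wy_i)}\,\frac{dz\,dw}{z^{t_k}w^{t_l}},$$ where $z$ runs over the first and $w$ over the second of the two contours. Let $\mathcal K$ be the $2d\times2d$ matrix whose $2\times2$ block in position $(k,l)$ is $\begin{pmatrix}\mathcal K_{11}(k,l)&\mathcal K_{12}(k,l)\\ \mathcal K_{21}(k,l)&\mathcal K_{22}(k,l)\end{pmatrix}$. Then $\mathcal K$ is skew-symmetric and $$\rho_{psm}(T)=\mathrm{Pf}(\mathcal K),\qquad \mathrm{Pf}(A)=\frac1{2^dd!}\sum_{\sigma\in\mathfrak S(2d)}\operatorname{sgn}(\sigma)\prod_{i=1}^dA_{\sigma(2i-1),\sigma(2i)}.$$ -/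

import Mathlib

open scoped BigOperators

namespace PfaffianSchur

noncomputable section

/-! ### Schur functions at a finite specialization -/

/-- The complete homogeneous symmetric polynomial `h_k(x_1, …, x_n)`, for an integer index `k`
(it is `0` for `k < 0`). -/
def hComplete {n : ℕ} (x : Fin n → ℝ) (k : ℤ) : ℝ :=
  if 0 ≤ k then MvPolynomial.eval x (MvPolynomial.hsymm (Fin n) ℝ k.toNat) else 0

/-- The skew Schur function `s_{lam/mu}(x) = det (h_{lam_i - mu_j - i + j}(x))`, where `i, j` run
over `1, …, l(lam)`, for partitions `mu ⊆ lam`.  (`lam.rowLen i` is the part `lam_{i+1}` and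
`lam.colLen 0` is the length `l(lam)`.) -/
def skewSchur {n : ℕ} (lam mu : YoungDiagram) (x : Fin n → ℝ) : ℝ :=
  Matrix.det (Matrix.of fun i j : Fin (lam.colLen 0) =>
    hComplete x ((lam.rowLen i : ℤ) - (mu.rowLen j : ℤ) - (i : ℤ) + (j : ℤ)))

/-- The Schur function `s_lam(x) = s_{lam/∅}(x)`. -/
def schur {n : ℕ} (lam : YoungDiagram) (x : Fin n → ℝ) : ℝ :=
  skewSchur lam ⊥ x

/-- A partition is even if all its parts are even. -/
def IsEven (mu : YoungDiagram) : Prop := ∀ i : ℕ, Even (mu.rowLen i)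

theorem finite_evenTransposeBelow (lam : YoungDiagram) :
    {mu : YoungDiagram | mu ≤ lam ∧ IsEven mu.transpose}.Finite := by
  refine Set.Finite.of_finite_image (f := YoungDiagram.cells) ?_ ?_
  · refine (Finset.finite_toSet lam.cells.powerset).subset ?_
    rintro _ ⟨mu, hmu, rfl⟩
    simpa using YoungDiagram.cells_subset_iff.2 hmu.1
  · intro a _ b _ hab
    exact YoungDiagram.ext hab

/-- `tau_lam = ∑_{mu' even} s_{lam/mu}`, the sum over the partitions `mu ⊆ lam` whose transpose
is even. -/
def tau {n : ℕ} (lam : YoungDiagram) (y : Fin n → ℝ) : ℝ :=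
  ∑ mu ∈ (finite_evenTransposeBelow lam).toFinset, skewSchur lam mu y

/-! ### The Pfaffian Schur measure on a single partition -/

/-- The unnormalised weight `s_lam(X) tau_lam(Y)`. -/
def psmWeight {n : ℕ} (x y : Fin n → ℝ) (lam : YoungDiagram) : ℝ :=
  schur lam x * tau lam y

/-- The partition function `Z(X; Y) = ∑_lam s_lam(X) tau_lam(Y)`. -/
def partitionFunction {n : ℕ} (x y : Fin n → ℝ) : ℝ :=
  ∑' lam : YoungDiagram, psmWeight x y lam

/-- The mass that the Pfaffian Schur measure gives to a partition. -/
def psm {n : ℕ} (x y : Fin n → ℝ) (lam : YoungDiagram) : ℝ :=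
  psmWeight x y lam / partitionFunction x y

/-- The probability of a set of partitions under the Pfaffian Schur measure. -/
def psmProb {n : ℕ} (x y : Fin n → ℝ) (A : Set YoungDiagram) : ℝ :=
  ∑' lam : YoungDiagram, A.indicator (psm x y) lam

/-- The correlation function: the probability that for every `k` there is an index
`i ∈ {1, …, n}` with `lam_i - i = t_k`. -/
def correlation {n d : ℕ} (x y : Fin n → ℝ) (t : Fin d → ℤ) : ℝ :=
  psmProb x y {lam | ∀ k : Fin d, ∃ i : Fin n, (lam.rowLen i : ℤ) - ((i : ℤ) + 1) = t k}

/-! ### Pfaffians -/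

/-- The Pfaffian `(1 / (2^d d!)) ∑_σ sgn(σ) ∏_i A_{σ(2i-1), σ(2i)}` of a `2d × 2d` matrix made
of `d²` blocks of size `2 × 2`.  The row (or column) number `2k - 1`, resp. `2k`, is written as
`(k, 0)`, resp. `(k, 1)`. -/
def pfaffian {d : ℕ} (A : Matrix (Fin d × Fin 2) (Fin d × Fin 2) ℂ) : ℂ :=
  (1 / (2 ^ d * (d.factorial : ℂ))) *
    ∑ σ : Equiv.Perm (Fin d × Fin 2),
      ((Equiv.Perm.sign σ : ℤ) : ℂ) * ∏ i : Fin d, A (σ (i, 0)) (σ (i, 1))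

/-! ### Closed contours -/

/-- A closed, piecewise continuously differentiable curve in the complex plane, parametrised by
`[0, 1]`: continuous, and off finitely many parameters it has a continuous derivative, which is
bounded. -/
structure ClosedContour where
  toFun : ℝ → ℂ
  continuousOn : ContinuousOn toFun (Set.Icc 0 1)
  closed : toFun 0 = toFun 1
  piecewise : ∃ (S : Finset ℝ) (B : ℝ), ∀ u ∈ Set.Ioo (0 : ℝ) 1, u ∉ S →
    DifferentiableAt ℝ toFun u ∧ ContinuousAt (deriv toFun) u ∧ ‖deriv toFun u‖ ≤ B

/-- The set of points on the contour. -/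
def ClosedContour.image (C : ClosedContour) : Set ℂ := C.toFun '' Set.Icc 0 1

/-- The contour integral `∮_C f(z) dz`. -/
def ClosedContour.integral (C : ClosedContour) (f : ℂ → ℂ) : ℂ :=
  ∫ u in (0 : ℝ)..1, f (C.toFun u) * deriv C.toFun u

/-- The winding number of the contour around a point. -/
def ClosedContour.winding (C : ClosedContour) (a : ℂ) : ℂ :=
  (1 / (2 * (Real.pi : ℂ) * Complex.I)) * C.integral fun z => (z - a)⁻¹

/-- The point `a` lies inside the contour, which goes round it once anticlockwise. -/
def ClosedContour.Encloses (C : ClosedContour) (a : ℂ) : Prop :=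
  a ∉ C.image ∧ C.winding a = 1

/-- The point `a` lies outside the contour. -/
def ClosedContour.Excludes (C : ClosedContour) (a : ℂ) : Prop :=
  a ∉ C.image ∧ C.winding a = 0

/-- `(1 / (2πi)²) ∮_C ∮_D F(z, w) dz dw` with `z ∈ C` and `w ∈ D`. -/
def doubleIntegral (C D : ClosedContour) (F : ℂ → ℂ → ℂ) : ℂ :=
  (1 / (2 * (Real.pi : ℂ) * Complex.I) ^ 2) *
    C.integral fun z => D.integral fun w => F z w

/-! ### The kernel -/

/-- The `(1,1)` entries of the blocks. -/
def kernel11 {n d : ℕ} (x y : Fin n → ℝ) (t : Fin d → ℤ) (C₁ C₂ : ClosedContour)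
    (k l : Fin d) : ℂ :=
  doubleIntegral C₁ C₂ fun z w =>
    (z - w) / ((z ^ 2 - 1) * (w ^ 2 - 1) * (z * w - 1)) *
      (∏ i : Fin n,
        ((1 - z⁻¹ * (x i : ℂ)) * (1 - w⁻¹ * (x i : ℂ)) *
            (1 - z⁻¹ * (y i : ℂ)) * (1 - w⁻¹ * (y i : ℂ))) /
          ((1 - z * (x i : ℂ)) * (1 - w * (x i : ℂ)))) *
      (1 / (z ^ t k * w ^ t l))

/-- The `(1,2)` entries of the blocks. -/
def kernel12 {n d : ℕ} (x y : Fin n → ℝ) (t : Fin d → ℤ) (C₃ C₄ : ClosedContour)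
    (k l : Fin d) : ℂ :=
  doubleIntegral C₃ C₄ fun z w =>
    (z - w) / (w * (z ^ 2 - 1) * (z * w - 1)) *
      (∏ i : Fin n,
        ((1 - w⁻¹ * (x i : ℂ)) * (1 - z⁻¹ * (x i : ℂ)) * (1 - z⁻¹ * (y i : ℂ))) /
          ((1 - z * (x i : ℂ)) * (1 - w * (x i : ℂ)) * (1 - w * (y i : ℂ)))) *
      (1 / (z ^ t k * w ^ t l))

/-- The `(2,2)` entries of the blocks. -/
def kernel22 {n d : ℕ} (x y : Fin n → ℝ) (t : Fin d → ℤ) (C₅ C₆ : ClosedContour)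
    (k l : Fin d) : ℂ :=
  doubleIntegral C₅ C₆ fun z w =>
    (z - w) / (z * w * (z * w - 1)) *
      (∏ i : Fin n,
        ((1 - z⁻¹ * (x i : ℂ)) * (1 - w⁻¹ * (x i : ℂ))) /
          ((1 - z * (x i : ℂ)) * (1 - w * (x i : ℂ)) *
            (1 - z * (y i : ℂ)) * (1 - w * (y i : ℂ)))) *
      (1 / (z ^ t k * w ^ t l))

/-- The `2d × 2d` matrix whose `(k, l)` block is
`!![K₁₁(k,l), K₁₂(k,l); K₂₁(k,l), K₂₂(k,l)]` with `K₂₁(k,l) = -K₁₂(l,k)`. -/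
def kernel {n d : ℕ} (x y : Fin n → ℝ) (t : Fin d → ℤ) (C₁ C₂ C₃ C₄ C₅ C₆ : ClosedContour) :
    Matrix (Fin d × Fin 2) (Fin d × Fin 2) ℂ :=
  Matrix.of fun p q =>
    !![kernel11 x y t C₁ C₂ p.1 q.1, kernel12 x y t C₃ C₄ p.1 q.1;
       -kernel12 x y t C₃ C₄ q.1 p.1, kernel22 x y t C₅ C₆ p.1 q.1] p.2 q.2

end

end PfaffianSchur

/-!
The proof rests on a multiple generating function.  Write `ratio a b = (a - b) / (1 - a b)` and let
`weightGF y v` be the product of all `ratio (v i) (v j)`, `i < j`, and all `1 / (1 - v i * y j)`.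

*Generating function.*  Schur's Pfaffian identity (`sum_sign_blockProd`) writes `∏ ratio (v i) (v j)`
as the Pfaffian of the matrix of the `ratio (v i) (v j)`.  Expanding its entries into geometric
series and the `1 / (1 - v i * y j)` into complete homogeneous symmetric functions produces
`weightGF y v = ∑ W(l) v ^ l` (`exists_isWeight`), where `W` is antisymmetric in `l` and
`W(lam_i - i + n) = tau_lam(y)`: the geometric series run over the sequences `k + 1, k`, that is, over
the partitions with even transpose, and the other series build up the Jacobi–Trudi determinants.  By
the bialternant formula (`alternant_shiftedParts`) the sum of `W(l) x ^ l` over those `l` which take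
all the values `t_k + n` is the Vandermonde determinant of `x` times the unnormalised correlation
function (`tsum_weight`).

*The kernel.*  For pairwise distinct `x_i` the residue theorem turns the first three contours into
sums over the points `1 / x_i`, and the other three into a small circle around `0`
(`kernel_eq_nodeIntegral`); the fourth contour encloses all poles except `0`, and the integrand
decays like `w ^ (-2)` at infinity because `t_k + 2 n ≥ 1`.  Hence all entries are double integrals of
`-ratio z w` against fixed weights.  By de Bruijn's formula and, once more, Schur's identity
(`pfaffian_integral_ratio`), the Pfaffian of such a matrix is one integral over `2 d` variables of the
product of all their cross ratios.

*Comparison.*  Let the outer variables be the points `1 / x_{I k}` and the inner ones points `u_k` of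
the circle.  Since `ratio (1 / a) u = -1 / ratio u a`, multiplication of `weightGF y x` by the integrand
amounts to the substitution of `u_k` for `x_{I k}`, up to the factor `(x_{I k} / u_k) ^ (t_k + n)`
(`weightGF_mul_integrand`).  The integral over the circle therefore selects the terms with
`l (I k) = t_k + n` (`hasSum_extraction`), and the sum over the injective `I` selects the sequences
which take all the values `t_k + n`.

*Conclusion.*  This gives the unnormalised correlation function as `productFormula x y` times the
Pfaffian, first for distinct `x_i` and then, as both sides are continuous, for all `x_i`
(`kernel_of_admissible`).  The case of no positions at all, `d = 0`, identifies the partition function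
with `productFormula x y`.
-/

open scoped Topology
open MeasureTheory Filter

namespace PfaffianSchur

/-! ### Integrals along closed contours -/

namespace ClosedContour

variable (C D : ClosedContour)

lemma mem_image {u : ℝ} (hu : u ∈ Set.Icc (0 : ℝ) 1) : C.toFun u ∈ C.image := ⟨u, hu, rfl⟩

lemma isCompact_image : IsCompact C.image := isCompact_Icc.image_of_continuousOn C.continuousOn

lemma exists_deriv_bound :
    ∃ B : ℝ, 0 ≤ B ∧ ∀ᵐ u ∂(volume.restrict (Set.Ioc (0 : ℝ) 1)), ‖deriv C.toFun u‖ ≤ B := by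
  obtain ⟨S, B, h⟩ := C.piecewise
  refine ⟨max B 0, le_max_right _ _, ?_⟩
  have hS : (volume : Measure ℝ) ((S : Set ℝ) ∪ {1}) = 0 :=
    ((S.finite_toSet.union (Set.finite_singleton 1)).countable).measure_zero _
  rw [ae_restrict_iff' measurableSet_Ioc]
  filter_upwards [compl_mem_ae_iff.2 hS] with u hu hu'
  simp only [Set.mem_compl_iff, Set.mem_union, Set.mem_singleton_iff, not_or] at hu
  exact (h u ⟨hu'.1, lt_of_le_of_ne hu'.2 hu.2⟩ (by simpa using hu.1)).2.2.trans (le_max_left _ _)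

lemma integrableOn_deriv : IntegrableOn (deriv C.toFun) (Set.Ioc (0 : ℝ) 1) := by
  obtain ⟨B, -, hB⟩ := C.exists_deriv_bound
  exact Measure.integrableOn_of_bounded (by simp) (measurable_deriv _).aestronglyMeasurable hB

lemma continuousOn_comp {f : ℂ → ℂ} (hf : ContinuousOn f C.image) :
    ContinuousOn (fun u => f (C.toFun u)) (Set.Icc 0 1) :=
  hf.comp C.continuousOn fun _ hu => C.mem_image hu

lemma intervalIntegrable_mul {f : ℂ → ℂ} (hf : ContinuousOn f C.image) :
    IntervalIntegrable (fun u => f (C.toFun u) * deriv C.toFun u) volume 0 1 := by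
  have h1 : IntervalIntegrable (deriv C.toFun) volume 0 1 := by
    rw [intervalIntegrable_iff_integrableOn_Ioc_of_le zero_le_one]
    exact C.integrableOn_deriv
  refine h1.continuousOn_mul ?_
  rw [Set.uIcc_of_le zero_le_one]
  exact C.continuousOn_comp hf

lemma integral_congr {f g : ℂ → ℂ} (h : Set.EqOn f g C.image) : C.integral f = C.integral g := by
  refine intervalIntegral.integral_congr fun u hu => ?_
  rw [Set.uIcc_of_le zero_le_one] at hu
  simp only [h (C.mem_image hu)]

lemma integral_const_mul (c : ℂ) (f : ℂ → ℂ) :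
    C.integral (fun z => c * f z) = c * C.integral f := by
  simp only [integral, mul_assoc, intervalIntegral.integral_const_mul]

lemma integral_add {f g : ℂ → ℂ} (hf : ContinuousOn f C.image) (hg : ContinuousOn g C.image) :
    C.integral (fun z => f z + g z) = C.integral f + C.integral g := by
  simp only [integral, add_mul]
  exact intervalIntegral.integral_add (C.intervalIntegrable_mul hf) (C.intervalIntegrable_mul hg)

lemma integral_sub {f g : ℂ → ℂ} (hf : ContinuousOn f C.image) (hg : ContinuousOn g C.image) :
    C.integral (fun z => f z - g z) = C.integral f - C.integral g := by
  simp only [integral, sub_mul]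
  exact intervalIntegral.integral_sub (C.intervalIntegrable_mul hf) (C.intervalIntegrable_mul hg)

lemma integral_finsetSum {ι : Type*} (s : Finset ι) {f : ι → ℂ → ℂ}
    (hf : ∀ i ∈ s, ContinuousOn (f i) C.image) :
    C.integral (fun z => ∑ i ∈ s, f i z) = ∑ i ∈ s, C.integral (f i) := by
  simp only [integral, Finset.sum_mul]
  exact intervalIntegral.integral_finsetSum fun i hi => C.intervalIntegrable_mul (hf i hi)

/-- The standard estimate of a contour integral, with a constant depending only on the contour. -/
lemma norm_integral_le : ∃ B : ℝ, 0 ≤ B ∧ ∀ (f : ℂ → ℂ) (M : ℝ), (∀ z ∈ C.image, ‖f z‖ ≤ M) →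
    ‖C.integral f‖ ≤ M * B := by
  obtain ⟨B, hB0, hB⟩ := C.exists_deriv_bound
  refine ⟨B, hB0, fun f M hM => ?_⟩
  have h : ‖∫ u in (0 : ℝ)..1, f (C.toFun u) * deriv C.toFun u‖ ≤ |∫ _ in (0 : ℝ)..1, M * B| := by
    refine intervalIntegral.norm_integral_le_abs_of_norm_le ?_ (by simp)
    rw [Set.uIoc_of_le zero_le_one]
    rw [ae_restrict_iff' measurableSet_Ioc] at hB ⊢
    filter_upwards [hB] with u hu hu'
    rw [norm_mul]
    have h1 := hM _ (C.mem_image (Set.Ioc_subset_Icc_self hu'))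
    exact mul_le_mul h1 (hu hu') (norm_nonneg _) ((norm_nonneg _).trans h1)
  have hM0 : 0 ≤ M := (norm_nonneg _).trans (hM _ (C.mem_image (Set.left_mem_Icc.2 zero_le_one)))
  simpa [integral, abs_of_nonneg (mul_nonneg hM0 hB0)] using h

/-- The integral of a derivative along a closed contour vanishes. -/
lemma integral_eq_zero_of_hasDerivAt {F f : ℂ → ℂ} (hF : ∀ z ∈ C.image, HasDerivAt F (f z) z)
    (hf : ContinuousOn f C.image) : C.integral f = 0 := by
  obtain ⟨S, B, h⟩ := C.piecewise
  have := integral_eq_of_hasDerivAt_off_countable_of_le (fun u => F (C.toFun u))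
    (fun u => f (C.toFun u) * deriv C.toFun u) (zero_le_one (α := ℝ)) S.countable_toSet
    (C.continuousOn_comp fun z hz => (hF z hz).continuousAt.continuousWithinAt)
    (fun u hu => (hF _ (C.mem_image (Set.Ioo_subset_Icc_self hu.1))).comp u
      (h u hu.1 hu.2).1.hasDerivAt) (C.intervalIntegrable_mul hf)
  rw [integral, this, C.closed, sub_self]

lemma continuousOn_sub_zpow {a : ℂ} (ha : a ∉ C.image) (k : ℤ) :
    ContinuousOn (fun z => (z - a) ^ k) C.image := fun z hz =>
  ((continuousAt_id.sub continuousAt_const).zpow₀ k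
    (Or.inl (sub_ne_zero.2 fun h : z = a => ha (h ▸ hz)))).continuousWithinAt

lemma integral_sub_zpow {a : ℂ} (ha : a ∉ C.image) {k : ℤ} (hk : k ≠ -1) :
    C.integral (fun z => (z - a) ^ k) = 0 := by
  have hk' : ((k : ℂ) + 1) ≠ 0 := by
    intro h
    apply hk
    have : ((k + 1 : ℤ) : ℂ) = 0 := by push_cast; exact h
    have := Int.cast_eq_zero.1 this
    omega
  refine C.integral_eq_zero_of_hasDerivAt (F := fun z => (z - a) ^ (k + 1) / ((k : ℂ) + 1)) ?_
    (C.continuousOn_sub_zpow ha k)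
  intro z hz
  have hza : z - a ≠ 0 := sub_ne_zero.2 fun h => ha (h ▸ hz)
  have h1 := ((hasDerivAt_zpow (k + 1) (z - a) (Or.inl hza)).comp z
    ((hasDerivAt_id z).sub_const a)).div_const ((k : ℂ) + 1)
  convert! h1 using 1
  push_cast
  field_simp
  simp

lemma integral_inv_sub (a : ℂ) :
    C.integral (fun z => (z - a)⁻¹) = 2 * Real.pi * Complex.I * C.winding a := by
  rw [winding]
  field_simp [Complex.two_pi_I_ne_zero, Real.pi_ne_zero, Complex.I_ne_zero]

lemma integral_sub_zpow_eq {a : ℂ} (ha : a ∉ C.image) (k : ℤ) :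
    C.integral (fun z => (z - a) ^ k) =
      if k = -1 then 2 * Real.pi * Complex.I * C.winding a else 0 := by
  split_ifs with h
  · subst h
    simpa using C.integral_inv_sub a
  · exact C.integral_sub_zpow ha h

/-- The winding number does not change along a segment which does not meet the contour: there
`log ((z - a) / (z - b))` is a primitive of `1 / (z - a) - 1 / (z - b)`. -/
lemma winding_eq_of_segment {a b : ℂ} (h : ∀ z ∈ C.image, z ∉ segment ℝ a b) :
    C.winding a = C.winding b := by
  have ha : a ∉ C.image := fun hz => h a hz (left_mem_segment ℝ a b)
  have hb : b ∉ C.image := fun hz => h b hz (right_mem_segment ℝ a b)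
  have hca := C.continuousOn_sub_zpow ha (-1)
  have hcb := C.continuousOn_sub_zpow hb (-1)
  simp only [zpow_neg_one] at hca hcb
  have key : C.integral (fun z => (z - a)⁻¹ - (z - b)⁻¹) = 0 := by
    refine C.integral_eq_zero_of_hasDerivAt
      (F := fun z => Complex.log ((z - a) / (z - b))) ?_ (hca.sub hcb)
    intro z hz
    have hza : z - a ≠ 0 := sub_ne_zero.2 fun h => ha (h ▸ hz)
    have hzb : z - b ≠ 0 := sub_ne_zero.2 fun h => hb (h ▸ hz)
    have hslit : (z - a) / (z - b) ∈ Complex.slitPlane := by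
      rw [Complex.mem_slitPlane_iff_not_le_zero]
      intro hle
      obtain ⟨hre, him⟩ := Complex.le_def.1 hle
      obtain ⟨q, hq⟩ : ∃ q : ℝ, (z - a) / (z - b) = q :=
        ⟨((z - a) / (z - b)).re, Complex.ext (by simp) (by simpa using him)⟩
      have hq0 : q ≤ 0 := by simpa [hq] using hre
      apply h z hz
      rw [div_eq_iff hzb] at hq
      refine ⟨1 / (1 - q), -q / (1 - q), by apply div_nonneg <;> linarith,
        by apply div_nonneg <;> linarith, ?_, ?_⟩
      · rw [← add_div]
        have : 1 - q ≠ 0 := by linarith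
        rw [← sub_eq_add_neg, div_self this]
      · have : (1 - q : ℂ) ≠ 0 := by
          have : (1 - q) ≠ 0 := by linarith
          exact_mod_cast this
        simp only [Complex.real_smul]
        push_cast
        field_simp
        linear_combination (-1 : ℂ) * hq
    have h1 := (((hasDerivAt_id z).sub_const a).div ((hasDerivAt_id z).sub_const b) hzb).clog hslit
    convert! h1 using 1
    simp only [id, Pi.div_apply]
    field_simp
  rw [C.integral_sub hca hcb] at key
  rw [winding, winding, sub_eq_zero.1 key]

/-- A contour in `r < ‖z‖` with winding number `0` around the origin has winding number `0` around
every point of the disc `‖a‖ ≤ r`. -/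
lemma winding_eq_zero_of_norm_le {r : ℝ} (hC : ∀ z ∈ C.image, r < ‖z‖) (h0 : C.winding 0 = 0)
    {a : ℂ} (ha : ‖a‖ ≤ r) : C.winding a = 0 := by
  rw [← h0]
  refine C.winding_eq_of_segment fun z hz hseg => ?_
  have : z ∈ Metric.closedBall (0 : ℂ) r :=
    (convex_closedBall (0 : ℂ) r).segment_subset (by simpa using ha)
      (by simpa using (norm_nonneg a).trans ha) hseg
  exact absurd (by simpa using this) (not_le.2 (hC z hz))

lemma winding_eq_zero_of_lt_norm {a : ℂ} (hC : ∀ z ∈ C.image, ‖z‖ < ‖a‖) : C.winding a = 0 := by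
  have ha : a ∉ C.image := fun h => lt_irrefl _ (hC a h)
  have hc := C.continuousOn_sub_zpow ha (-1)
  simp only [zpow_neg_one] at hc
  have key : C.integral (fun z => (z - a)⁻¹) = 0 := by
    refine C.integral_eq_zero_of_hasDerivAt (F := fun z => Complex.log (1 - z / a)) ?_ hc
    intro z hz
    have hlt := hC z hz
    have ha0 : a ≠ 0 := fun h => by
      rw [h, norm_zero] at hlt
      exact absurd hlt (not_lt.2 (norm_nonneg z))
    have hza : z - a ≠ 0 := sub_ne_zero.2 fun h => ha (h ▸ hz)
    have hslit : 1 - z / a ∈ Complex.slitPlane := by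
      refine Or.inl ?_
      have h1 : ‖z / a‖ < 1 := by
        rw [norm_div]
        exact (div_lt_one (norm_pos_iff.2 ha0)).2 hlt
      have h2 := (Complex.abs_re_le_norm (z / a)).trans_lt h1
      have := (abs_lt.1 h2).2
      simp only [Complex.sub_re, Complex.one_re]
      linarith
    have h1 := (((hasDerivAt_id z).div_const a).const_sub 1).clog hslit
    convert! h1 using 1
    have : a - z ≠ 0 := by rw [← neg_sub]; exact neg_ne_zero.2 hza
    simp only [id]
    field_simp
    ring
  rw [winding, key, mul_zero]

/-- Points close to an enclosed point are enclosed. -/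
lemma Encloses.eventually {C : ClosedContour} {a : ℂ} (h : C.Encloses a) :
    ∀ᶠ b in 𝓝 a, C.Encloses b := by
  obtain ⟨ε, hε, hball⟩ := Metric.mem_nhds_iff.1
    (C.isCompact_image.isClosed.isOpen_compl.mem_nhds h.1)
  filter_upwards [Metric.ball_mem_nhds a hε] with b hb
  refine ⟨hball hb, ?_⟩
  rw [← h.2]
  exact C.winding_eq_of_segment fun z hz hseg =>
    hball ((convex_ball a ε).segment_subset hb (Metric.mem_ball_self hε) hseg) hz

/-! ### Integrals depending on a parameter -/

/-- Contour integrals depend continuously on parameters.  Joint continuity is needed only at the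
points over the given parameter, because the contour is compact. -/
lemma continuousWithinAt_integral {X : Type*} [TopologicalSpace X] {f : X → ℂ → ℂ} {s : Set X}
    {x₀ : X} (hx₀ : x₀ ∈ s) (hc : ∀ x ∈ s, ContinuousOn (f x) C.image)
    (h : ∀ z ∈ C.image, ContinuousWithinAt (fun p : X × ℂ => f p.1 p.2) (s ×ˢ C.image) (x₀, z)) :
    ContinuousWithinAt (fun x => C.integral (f x)) s x₀ := by
  obtain ⟨B, hB0, hB⟩ := C.norm_integral_le
  rw [ContinuousWithinAt, Metric.tendsto_nhds]
  intro ε hε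
  set η := ε / (2 * (B + 1)) with hη
  have hη0 : 0 < η := by positivity
  have hunif : ∀ᶠ x in 𝓝[s] x₀, ∀ z ∈ C.image, ‖f x z - f x₀ z‖ ≤ η := by
    have hl : ∀ z ∈ C.image, ∀ᶠ p : X × ℂ in 𝓝[s] x₀ ×ˢ 𝓝[C.image] z,
        ‖f p.1 p.2 - f x₀ p.2‖ ≤ η := by
      intro z hz
      have h1 := h z hz
      rw [ContinuousWithinAt, nhdsWithin_prod_eq] at h1
      have h2 : Tendsto (fun p : X × ℂ => f x₀ p.2) (𝓝[s] x₀ ×ˢ 𝓝[C.image] z) (𝓝 (f x₀ z)) :=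
        (hc x₀ hx₀ z hz).tendsto.comp tendsto_snd
      have h3 := (h1.sub h2).norm
      simp only [sub_self, norm_zero] at h3
      exact (h3.eventually (gt_mem_nhds hη0)).mono fun p hp => hp.le
    have := C.isCompact_image
    obtain ⟨t, ht, hcov⟩ : ∃ t ∈ 𝓝[s] x₀, ∀ x ∈ t, ∀ z ∈ C.image, ‖f x z - f x₀ z‖ ≤ η := by
      refine this.induction_on (p := fun K => ∃ t ∈ 𝓝[s] x₀, ∀ x ∈ t, ∀ z ∈ K,
        ‖f x z - f x₀ z‖ ≤ η) ⟨Set.univ, univ_mem, by simp⟩ ?_ ?_ ?_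
      · rintro K L hKL ⟨t, ht, h⟩
        exact ⟨t, ht, fun x hx z hz => h x hx z (hKL hz)⟩
      · rintro K L ⟨t, ht, h⟩ ⟨t', ht', h'⟩
        refine ⟨t ∩ t', inter_mem ht ht', fun x hx z hz => ?_⟩
        rcases hz with hz | hz
        exacts [h x hx.1 z hz, h' x hx.2 z hz]
      · intro z hz
        obtain ⟨t, ht, K, hK, h⟩ := eventually_prod_iff.1 (hl z hz)
        exact ⟨{z | K z}, hK, _, ht, fun x hx z hz => h hx hz⟩
    exact mem_of_superset ht hcov
  filter_upwards [hunif, self_mem_nhdsWithin] with x hx hxs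
  rw [dist_eq_norm, ← C.integral_sub (hc x hxs) (hc x₀ hx₀)]
  refine (hB _ η hx).trans_lt ?_
  rw [hη, div_mul_eq_mul_div, div_lt_iff₀ (by positivity)]
  nlinarith

end ClosedContour

/-- Fubini's theorem for a double contour integral. -/
lemma doubleIntegral_swap {C D : ClosedContour} {F : ℂ → ℂ → ℂ}
    (hF : ContinuousOn (fun p : ℂ × ℂ => F p.1 p.2) (C.image ×ˢ D.image)) :
    doubleIntegral C D F = doubleIntegral D C fun w z => F z w := by
  unfold doubleIntegral
  congr 1
  simp only [ClosedContour.integral, ← intervalIntegral.integral_mul_const]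
  rw [intervalIntegral_intervalIntegral_swap]
  · refine intervalIntegral.integral_congr fun v _ => intervalIntegral.integral_congr fun u _ => ?_
    ring
  rw [Set.uIoc_of_le zero_le_one]
  have hcont : ContinuousOn (fun q : ℝ × ℝ => F (C.toFun q.1) (D.toFun q.2))
      (Set.Icc 0 1 ×ˢ Set.Icc 0 1) :=
    hF.comp ((C.continuousOn.comp continuousOn_fst fun q hq => hq.1).prodMk
      (D.continuousOn.comp continuousOn_snd fun q hq => hq.2))
      fun q hq => ⟨C.mem_image hq.1, D.mem_image hq.2⟩
  have hint : Integrable (fun q : ℝ × ℝ => deriv D.toFun q.2 * deriv C.toFun q.1)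
      ((volume.restrict (Set.Ioc 0 1)).prod (volume.restrict (Set.Ioc 0 1))) := by
    simpa only [mul_comm] using C.integrableOn_deriv.mul_prod D.integrableOn_deriv
  rw [Measure.prod_restrict] at hint
  rw [IntegrableOn, Measure.volume_eq_prod]
  have h2 : AEStronglyMeasurable (fun q : ℝ × ℝ => F (C.toFun q.1) (D.toFun q.2))
      (((volume : Measure ℝ).prod volume).restrict (Set.Ioc 0 1 ×ˢ Set.Ioc 0 1)) :=
    (hcont.mono (Set.prod_mono Set.Ioc_subset_Icc_self
      Set.Ioc_subset_Icc_self)).aestronglyMeasurable (measurableSet_Ioc.prod measurableSet_Ioc)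
  obtain ⟨M, hM⟩ := (isCompact_Icc.prod isCompact_Icc).exists_bound_of_continuousOn hcont
  have h3 := hint.bdd_mul h2 (c := M) (by
    rw [ae_restrict_iff' (measurableSet_Ioc.prod measurableSet_Ioc)]
    exact Eventually.of_forall fun q hq =>
      hM q ⟨Set.Ioc_subset_Icc_self hq.1, Set.Ioc_subset_Icc_self hq.2⟩)
  refine h3.congr (Eventually.of_forall fun q => ?_)
  simp only [Function.uncurry]
  ring


/-! ### Rational functions and residues -/

/-- The span of the functions `(z - a) ^ k`, with `a ∈ S` and `k ∈ ℤ`. -/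
def ratSpan (S : Set ℂ) : Submodule ℂ (ℂ → ℂ) :=
  Submodule.span ℂ {f | ∃ a ∈ S, ∃ k : ℤ, f = fun z => (z - a) ^ k}

/-- `f` is, off the set `S`, a linear combination of functions `(z - a) ^ k` with `a ∈ S` and
`k ∈ ℤ`.  By partial fractions these are the rational functions whose poles lie in `S`
(for `S` nonempty).  The values of `f` on `S` are irrelevant. -/
def IsRat (S : Set ℂ) (f : ℂ → ℂ) : Prop := ∃ g ∈ ratSpan S, Set.EqOn f g Sᶜ

namespace IsRat

variable {S : Set ℂ} {f g : ℂ → ℂ}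

lemma congr (hf : IsRat S f) (h : ∀ z ∉ S, g z = f z) : IsRat S g := by
  obtain ⟨f', hf', hff'⟩ := hf
  exact ⟨f', hf', fun z hz => (h z hz).trans (hff' hz)⟩

lemma add (hf : IsRat S f) (hg : IsRat S g) : IsRat S fun z => f z + g z := by
  obtain ⟨f', hf', hff'⟩ := hf
  obtain ⟨g', hg', hgg'⟩ := hg
  exact ⟨f' + g', add_mem hf' hg', fun z hz => by simp [hff' hz, hgg' hz]⟩

lemma const_mul (c : ℂ) (hf : IsRat S f) : IsRat S fun z => c * f z := by
  obtain ⟨f', hf', hff'⟩ := hf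
  exact ⟨c • f', Submodule.smul_mem _ c hf', fun z hz => by simp [hff' hz]⟩

lemma sub (hf : IsRat S f) (hg : IsRat S g) : IsRat S fun z => f z - g z :=
  (hf.add (hg.const_mul (-1))).congr fun z _ => by ring

lemma sub_zpow {a : ℂ} (ha : a ∈ S) (k : ℤ) : IsRat S fun z => (z - a) ^ k :=
  ⟨_, Submodule.subset_span ⟨a, ha, k, rfl⟩, fun _ _ => rfl⟩

lemma const (h0 : (0 : ℂ) ∈ S) (c : ℂ) : IsRat S fun _ => c :=
  ((sub_zpow h0 0).const_mul c).congr fun z _ => by simp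

/-- To prove a linear property of rational functions it suffices to check it on the powers
`(z - a) ^ k`. -/
lemma induction {P : (ℂ → ℂ) → Prop} (hf : IsRat S f)
    (hpow : ∀ a ∈ S, ∀ k : ℤ, P fun z => (z - a) ^ k)
    (hcongr : ∀ f g, IsRat S f → (∀ z ∉ S, g z = f z) → P f → P g)
    (hadd : ∀ f g, IsRat S f → IsRat S g → P f → P g → P fun z => f z + g z)
    (hmul : ∀ (c : ℂ) (f), IsRat S f → P f → P fun z => c * f z) (h0 : P fun _ => 0) : P f := by
  obtain ⟨f', hf', hff'⟩ := hf
  refine hcongr f' f ⟨f', hf', fun _ _ => rfl⟩ (fun z hz => hff' hz) ?_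
  refine Submodule.span_induction (p := fun g _ => P g) ?_ h0 ?_ ?_ hf'
  · rintro _ ⟨a, ha, k, rfl⟩
    exact hpow a ha k
  · intro g h hg hh pg ph
    exact hadd g h ⟨g, hg, fun _ _ => rfl⟩ ⟨h, hh, fun _ _ => rfl⟩ pg ph
  · intro c g hg pg
    exact hmul c g ⟨g, hg, fun _ _ => rfl⟩ pg

lemma zero : IsRat S fun _ => 0 := ⟨0, zero_mem _, fun _ _ => rfl⟩

lemma mul_sub (c : ℂ) (hf : IsRat S f) : IsRat S fun z => f z * (z - c) := by
  refine hf.induction (P := fun f => IsRat S fun z => f z * (z - c)) ?_ ?_ ?_ ?_ ?_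
  · intro a ha k
    refine ((sub_zpow ha (k + 1)).add ((sub_zpow ha k).const_mul (a - c))).congr fun z hz => ?_
    have : z - a ≠ 0 := sub_ne_zero.2 fun h : z = a => hz (h ▸ ha)
    rw [zpow_add_one₀ this]
    ring
  · exact fun f g _ h hf => hf.congr fun z hz => by rw [h z hz]
  · exact fun f g _ _ hf hg => (hf.add hg).congr fun z _ => by ring
  · exact fun c f _ hf => (hf.const_mul c).congr fun z _ => by ring
  · exact zero.congr fun z _ => by simp

lemma mul_inv_sub {a : ℂ} (ha : a ∈ S) (hf : IsRat S f) : IsRat S fun z => f z * (z - a)⁻¹ := by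
  refine hf.induction (P := fun f => IsRat S fun z => f z * (z - a)⁻¹) ?_ ?_ ?_ ?_ ?_
  · intro b hb k
    beta_reduce
    have hza : ∀ z ∉ S, z - a ≠ 0 := fun z hz => sub_ne_zero.2 fun h : z = a => hz (h ▸ ha)
    have hzb : ∀ z ∉ S, z - b ≠ 0 := fun z hz => sub_ne_zero.2 fun h : z = b => hz (h ▸ hb)
    by_cases hab : a = b
    · subst hab
      refine (sub_zpow ha (k - 1)).congr fun z hz => ?_
      rw [zpow_sub_one₀ (hza z hz)]
    have hab' : a - b ≠ 0 := sub_ne_zero.2 hab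
    induction k using Int.induction_on with
    | zero => exact (sub_zpow ha (-1)).congr fun z _ => by simp
    | succ i ih =>
      refine ((sub_zpow hb i).add (ih.const_mul (a - b))).congr fun z hz => ?_
      rw [zpow_add_one₀ (hzb z hz)]
      field_simp [hza z hz]
      ring
    | pred i ih =>
      refine ((ih.sub (sub_zpow hb (-i - 1))).const_mul (a - b)⁻¹).congr fun z hz => ?_
      rw [zpow_sub_one₀ (hzb z hz)]
      field_simp [hza z hz, hzb z hz]
      ring
  · exact fun f g _ h hf => hf.congr fun z hz => by rw [h z hz]
  · exact fun f g _ _ hf hg => (hf.add hg).congr fun z _ => by ring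
  · exact fun c f _ hf => (hf.const_mul c).congr fun z _ => by ring
  · exact zero.congr fun z _ => by simp

lemma mul (hf : IsRat S f) (hg : IsRat S g) : IsRat S fun z => f z * g z := by
  refine hg.induction (P := fun g => IsRat S fun z => f z * g z) ?_ ?_ ?_ ?_ ?_
  · intro a ha k
    beta_reduce
    induction k using Int.induction_on with
    | zero => exact hf.congr fun z _ => by simp
    | succ i ih =>
      refine (ih.mul_sub a).congr fun z hz => ?_
      rw [zpow_add_one₀ (sub_ne_zero.2 fun h : z = a => hz (h ▸ ha)), mul_assoc]
    | pred i ih =>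
      refine (ih.mul_inv_sub ha).congr fun z hz => ?_
      rw [zpow_sub_one₀ (sub_ne_zero.2 fun h : z = a => hz (h ▸ ha)), mul_assoc]
  · exact fun f g _ h hf => hf.congr fun z hz => by rw [h z hz]
  · exact fun f g _ _ hf hg => (hf.add hg).congr fun z _ => by ring
  · exact fun c f _ hf => (hf.const_mul c).congr fun z _ => by ring
  · exact zero.congr fun z _ => by simp

lemma prod {ι : Type*} (s : Finset ι) {f : ι → ℂ → ℂ} (h0 : (0 : ℂ) ∈ S)
    (hf : ∀ i ∈ s, IsRat S (f i)) : IsRat S fun z => ∏ i ∈ s, f i z := by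
  classical
  induction s using Finset.induction_on with
  | empty => simpa using const h0 1
  | insert a s ha ih =>
    simp only [Finset.prod_insert ha]
    exact (hf a (Finset.mem_insert_self a s)).mul
      (ih fun i hi => hf i (Finset.mem_insert_of_mem hi))

lemma zpow (h0 : (0 : ℂ) ∈ S) (k : ℤ) : IsRat S fun z => z ^ k :=
  (sub_zpow h0 k).congr fun z _ => by simp

lemma id (h0 : (0 : ℂ) ∈ S) : IsRat S fun z => z := (zpow h0 1).congr fun z _ => by simp

lemma inv (h0 : (0 : ℂ) ∈ S) : IsRat S fun z => z⁻¹ := (zpow h0 (-1)).congr fun z _ => by simp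

lemma inv_sub {a : ℂ} (ha : a ∈ S) : IsRat S fun z => (z - a)⁻¹ :=
  (sub_zpow ha (-1)).congr fun z _ => by simp

/-- `1 / (1 - z a)` has its only pole at `1 / a`. -/
lemma inv_one_sub_mul {a : ℂ} (ha : a ≠ 0) (h : a⁻¹ ∈ S) : IsRat S fun z => (1 - z * a)⁻¹ :=
  ((inv_sub h).const_mul (-a⁻¹)).congr fun z _ => by
    rw [show 1 - z * a = -a * (z - a⁻¹) by field_simp; ring, mul_inv, inv_neg]

lemma continuousOn (hf : IsRat S f) {T : Set ℂ} (hT : ∀ z ∈ T, z ∉ S) : ContinuousOn f T := by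
  refine hf.induction (P := fun f => ContinuousOn f T) ?_ ?_ ?_ ?_ ?_
  · exact fun a ha k z hz => ((continuousAt_id.sub continuousAt_const).zpow₀ k
      (Or.inl (sub_ne_zero.2 fun h : z = a => hT z hz (h ▸ ha)))).continuousWithinAt
  · exact fun f g _ h hf => hf.congr fun z hz => h z (hT z hz)
  · exact fun f g _ _ hf hg => hf.add hg
  · exact fun c f _ hf => continuousOn_const.mul hf
  · exact continuousOn_const

/-- A linear relation between the winding numbers of some contours around the poles of a rational
function gives the same relation between its integrals. -/
lemma sum_integral_eq_zero {ι : Type*} (s : Finset ι) (C : ι → ClosedContour) (m : ι → ℂ)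
    (hf : IsRat S f) (hC : ∀ i ∈ s, ∀ a ∈ S, a ∉ (C i).image)
    (hw : ∀ a ∈ S, ∑ i ∈ s, m i * (C i).winding a = 0) :
    ∑ i ∈ s, m i * (C i).integral f = 0 := by
  have hT : ∀ i ∈ s, ∀ z ∈ (C i).image, z ∉ S := fun i hi z hz hzS => hC i hi z hzS hz
  refine hf.induction (P := fun f => ∑ i ∈ s, m i * (C i).integral f = 0) ?_ ?_ ?_ ?_ ?_
  · intro a ha k
    rw [Finset.sum_congr rfl fun i hi => by
      rw [(C i).integral_sub_zpow_eq (hC i hi a ha) k]]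
    by_cases hk : k = -1
    · simp only [hk, if_true]
      rw [← mul_zero (2 * (Real.pi : ℂ) * Complex.I), ← hw a ha, Finset.mul_sum]
      exact Finset.sum_congr rfl fun i _ => by ring
    · simp [hk]
  · intro f g _ h hf
    rw [← hf]
    exact Finset.sum_congr rfl fun i hi => by
      rw [(C i).integral_congr fun z hz => h z (hT i hi z hz)]
  · intro f g hf hg h1 h2
    rw [Finset.sum_congr rfl fun i hi => by
      rw [(C i).integral_add (hf.continuousOn (hT i hi)) (hg.continuousOn (hT i hi)), mul_add],
      Finset.sum_add_distrib, h1, h2, add_zero]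
  · intro c f _ hf
    rw [← mul_zero c, ← hf, Finset.mul_sum]
    exact Finset.sum_congr rfl fun i _ => by rw [(C i).integral_const_mul]; ring
  · simp [ClosedContour.integral]

lemma integral_eq {C D : ClosedContour} (hf : IsRat S f) (hC : ∀ a ∈ S, a ∉ C.image)
    (hD : ∀ a ∈ S, a ∉ D.image) (hw : ∀ a ∈ S, C.winding a = D.winding a) :
    C.integral f = D.integral f := by
  have := hf.sum_integral_eq_zero Finset.univ ![C, D] ![1, -1]
    (by simpa [Fin.forall_fin_two] using ⟨hC, hD⟩)
    (by simpa [Fin.sum_univ_two, ← sub_eq_add_neg, sub_eq_zero] using hw)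
  simpa [Fin.sum_univ_two, ← sub_eq_add_neg, sub_eq_zero] using this

/-- Cauchy's integral formula for a rational function without poles inside the contour. -/
lemma integral_mul_inv_sub {C : ClosedContour} (hf : IsRat S f) (hC : ∀ a ∈ S, a ∉ C.image)
    (hw : ∀ a ∈ S, C.winding a = 0) {a : ℂ} (haS : a ∉ S) (ha : a ∉ C.image) :
    C.integral (fun z => f z * (z - a)⁻¹) = 2 * Real.pi * Complex.I * C.winding a * f a := by
  have hT : ∀ z ∈ C.image, z ∉ S := fun z hz hzS => hC z hzS hz
  have hca : ContinuousOn (fun z => (z - a)⁻¹) C.image := by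
    simpa using C.continuousOn_sub_zpow ha (-1)
  have hza : ∀ z ∈ C.image, z - a ≠ 0 := fun z hz => sub_ne_zero.2 fun h : z = a => ha (h ▸ hz)
  refine hf.induction (P := fun f => C.integral (fun z => f z * (z - a)⁻¹) =
    2 * Real.pi * Complex.I * C.winding a * f a) ?_ ?_ ?_ ?_ ?_
  · intro b hb k
    beta_reduce
    have hzb : ∀ z ∈ C.image, z - b ≠ 0 :=
      fun z hz => sub_ne_zero.2 fun h : z = b => hT z hz (h ▸ hb)
    have hab : a - b ≠ 0 := sub_ne_zero.2 fun h : a = b => haS (h ▸ hb)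
    have hcb := fun m => C.continuousOn_sub_zpow (hC b hb) m
    have hib : ∀ m : ℤ, C.integral (fun z => (z - b) ^ m) = 0 := fun m => by
      rw [C.integral_sub_zpow_eq (hC b hb), hw b hb]
      simp
    induction k using Int.induction_on with
    | zero => simpa using C.integral_inv_sub a
    | succ i ih =>
      rw [zpow_add_one₀ hab, ← mul_assoc, ← ih, ← mul_comm (a - b), ← C.integral_const_mul,
        ← zero_add (C.integral fun z => (a - b) * _), ← hib i, ← C.integral_add (g := fun z => (a - b) * ((z - b) ^ (i : ℤ) * (z - a)⁻¹)) (hcb i)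
          (continuousOn_const.mul ((hcb i).mul hca))]
      refine C.integral_congr fun z hz => ?_
      rw [zpow_add_one₀ (hzb z hz)]
      field_simp [hza z hz]
      ring
    | pred i ih =>
      rw [zpow_sub_one₀ hab, ← mul_assoc, ← ih, ← mul_comm (a - b)⁻¹,
        ← sub_zero (C.integral fun z => (z - b) ^ (-(i : ℤ)) * _), ← hib (-i - 1),
        ← C.integral_sub (f := fun z => (z - b) ^ (-(i : ℤ)) * (z - a)⁻¹) ((hcb _).mul hca)
          (hcb _), ← C.integral_const_mul]
      refine C.integral_congr fun z hz => ?_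
      rw [zpow_sub_one₀ (hzb z hz)]
      field_simp [hza z hz, hzb z hz]
      ring
  · intro f g _ h hf
    rw [h a haS, ← hf]
    exact C.integral_congr fun z hz => by simp only [h z (hT z hz)]
  · intro f g hf hg h1 h2
    simp only [add_mul]
    rw [C.integral_add (f := fun z => f z * (z - a)⁻¹) (g := fun z => g z * (z - a)⁻¹)
      ((hf.continuousOn hT).mul hca) ((hg.continuousOn hT).mul hca), h1, h2]
    ring
  · intro c f _ hf
    simp only [mul_assoc c]
    rw [C.integral_const_mul, hf]
    ring
  · simp [ClosedContour.integral]

/-- The residue theorem for a rational function which has, inside the contour, only simple poles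
at the distinct points `b i`. -/
lemma integral_mul_prod_inv_sub {n : ℕ} {C : ClosedContour} (hf : IsRat S f)
    (hC : ∀ a ∈ S, a ∉ C.image) (hw : ∀ a ∈ S, C.winding a = 0) {b : Fin n → ℂ} (hn : 0 < n)
    (hb : Function.Injective b) (hbS : ∀ i, b i ∉ S) (hbC : ∀ i, C.Encloses (b i)) :
    C.integral (fun z => f z * ∏ i, (z - b i)⁻¹) =
      2 * Real.pi * Complex.I *
        ∑ i, f (b i) * ∏ j ∈ Finset.univ.erase i, (b i - b j)⁻¹ := by
  have hT : ∀ z ∈ C.image, z ∉ S := fun z hz hzS => hC z hzS hz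
  have hne : (Finset.univ : Finset (Fin n)).Nonempty := ⟨⟨0, hn⟩, Finset.mem_univ _⟩
  have key : Set.EqOn (fun z => f z * ∏ i, (z - b i)⁻¹)
      (fun z => ∑ i, (∏ j ∈ Finset.univ.erase i, (b i - b j)⁻¹) * (f z * (z - b i)⁻¹)) C.image := by
    intro z hz
    have hzb : ∀ i ∈ Finset.univ, z ≠ b i := fun i _ h => (hbC i).1 (h ▸ hz)
    have h1 := (Lagrange.eval_interpolate_not_at_node (s := Finset.univ) (v := b) 1 hzb).symm
    rw [Lagrange.interpolate_one hb.injOn hne, Polynomial.eval_one, Lagrange.eval_nodal,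
      mul_comm] at h1
    have h2 := eq_inv_of_mul_eq_one_left h1
    simp only [Finset.prod_inv_distrib]
    rw [← h2, Finset.mul_sum]
    refine Finset.sum_congr rfl fun i _ => ?_
    simp only [Lagrange.nodalWeight, Pi.one_apply, mul_one, Finset.prod_inv_distrib]
    ring
  have hc : ∀ i, ContinuousOn (fun z => f z * (z - b i)⁻¹) C.image := fun i =>
    (hf.continuousOn hT).mul (by simpa using C.continuousOn_sub_zpow (hbC i).1 (-1))
  have hc' : ∀ i ∈ Finset.univ, ContinuousOn (fun z =>
      (∏ j ∈ Finset.univ.erase i, (b i - b j)⁻¹) * (f z * (z - b i)⁻¹)) C.image :=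
    fun i _ => continuousOn_const.mul (hc i)
  rw [C.integral_congr key, C.integral_finsetSum _ hc', Finset.mul_sum]
  refine Finset.sum_congr rfl fun i _ => ?_
  rw [C.integral_const_mul, hf.integral_mul_inv_sub hC hw (hbS i) (hbC i).1, (hbC i).2]
  ring

end IsRat

/-! ### Circles around the origin -/

open Complex in
/-- The circle of radius `r` around the origin, run through once anticlockwise. -/
noncomputable def circleContour (r : ℝ) : ClosedContour where
  toFun u := r * exp (2 * Real.pi * I * u)
  continuousOn := by fun_prop
  closed := by simp [Complex.exp_two_pi_mul_I]
  piecewise := by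
    have hd : ∀ u : ℝ, HasDerivAt (fun u : ℝ => (r : ℂ) * exp (2 * Real.pi * I * u))
        (r * (exp (2 * Real.pi * I * u) * (2 * Real.pi * I))) u := fun u => by
      have h := ((((hasDerivAt_id (u : ℂ)).const_mul (2 * (Real.pi : ℂ) * I)).cexp).const_mul
        (r : ℂ)).comp_ofReal
      simpa using h
    have hd' : deriv (fun u : ℝ => (r : ℂ) * exp (2 * Real.pi * I * u)) =
        fun u : ℝ => (r * (exp (2 * Real.pi * I * u) * (2 * Real.pi * I)) : ℂ) :=
      funext fun u => (hd u).deriv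
    refine ⟨∅, |r| * (2 * Real.pi), fun u _ _ => ⟨(hd u).differentiableAt, ?_, ?_⟩⟩
    · rw [hd']
      fun_prop
    · rw [hd']
      have : ‖exp (2 * Real.pi * I * u)‖ = 1 := by
        rw [show (2 * Real.pi * I * u : ℂ) = ((2 * Real.pi * u : ℝ) : ℂ) * I by push_cast; ring]
        exact Complex.norm_exp_ofReal_mul_I _
      simp [this, abs_of_pos Real.pi_pos]

open Complex in
lemma circleContour_deriv (r u : ℝ) :
    deriv (circleContour r).toFun u = 2 * Real.pi * I * (circleContour r).toFun u := by
  have h := ((((hasDerivAt_id (u : ℂ)).const_mul (2 * (Real.pi : ℂ) * I)).cexp).const_mul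
    (r : ℂ)).comp_ofReal
  have h' : HasDerivAt (circleContour r).toFun
    ((r : ℂ) * (exp (2 * Real.pi * I * u) * (2 * Real.pi * I))) u := by
    simpa [circleContour] using h
  rw [h'.deriv, circleContour]
  ring

open Complex in
lemma norm_circleContour {r : ℝ} (hr : 0 ≤ r) (u : ℝ) : ‖(circleContour r).toFun u‖ = r := by
  have : ‖exp (2 * Real.pi * I * u)‖ = 1 := by
    rw [show (2 * Real.pi * I * u : ℂ) = ((2 * Real.pi * u : ℝ) : ℂ) * I by push_cast; ring]
    exact Complex.norm_exp_ofReal_mul_I _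
  simp [circleContour, this, abs_of_nonneg hr]

lemma norm_of_mem_circleContour {r : ℝ} (hr : 0 ≤ r) {z : ℂ} (hz : z ∈ (circleContour r).image) :
    ‖z‖ = r := by
  obtain ⟨u, -, rfl⟩ := hz
  exact norm_circleContour hr u

lemma circleContour_integral (r : ℝ) (f : ℂ → ℂ) :
    (circleContour r).integral f = 2 * Real.pi * Complex.I *
      ∫ u in (0 : ℝ)..1, f ((circleContour r).toFun u) * (circleContour r).toFun u := by
  rw [ClosedContour.integral, ← intervalIntegral.integral_const_mul]
  refine intervalIntegral.integral_congr fun u _ => ?_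
  simp only [circleContour_deriv]
  ring

lemma circleContour_winding_zero {r : ℝ} (hr : 0 < r) : (circleContour r).winding 0 = 1 := by
  have h : ∀ u, (circleContour r).toFun u ≠ 0 := fun u h => by
    have := norm_circleContour hr.le u
    rw [h, norm_zero] at this
    exact hr.ne this
  rw [ClosedContour.winding, circleContour_integral]
  simp only [sub_zero, inv_mul_cancel₀ (h _)]
  have := Complex.two_pi_I_ne_zero
  field_simp
  simp

lemma circleContour_winding_of_lt {r : ℝ} (hr : 0 < r) {a : ℂ} (ha : ‖a‖ < r) :
    (circleContour r).winding a = 1 := by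
  rw [← circleContour_winding_zero hr]
  refine ClosedContour.winding_eq_of_segment _ fun z hz hseg => ?_
  have : z ∈ Metric.ball (0 : ℂ) r :=
    (convex_ball (0 : ℂ) r).segment_subset (by simpa using ha) (by simpa using hr) hseg
  rw [mem_ball_zero_iff, norm_of_mem_circleContour hr.le hz] at this
  exact lt_irrefl _ this

lemma circleContour_winding_of_gt {r : ℝ} (hr : 0 ≤ r) {a : ℂ} (ha : r < ‖a‖) :
    (circleContour r).winding a = 0 :=
  ClosedContour.winding_eq_zero_of_lt_norm _ fun z hz => by rwa [norm_of_mem_circleContour hr hz]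

lemma notMem_circleContour {r : ℝ} (hr : 0 ≤ r) {a : ℂ} (ha : ‖a‖ ≠ r) :
    a ∉ (circleContour r).image := fun h => ha (norm_of_mem_circleContour hr h)

/-- Integrals over large circles of functions of order `z ^ (-2)` tend to zero. -/
lemma tendsto_circleContour_integral {f : ℂ → ℂ} {M R₀ : ℝ}
    (hf : ∀ z, R₀ ≤ ‖z‖ → ‖f z‖ * ‖z‖ ^ 2 ≤ M) :
    Tendsto (fun R => (circleContour R).integral f) atTop (𝓝 0) := by
  rw [tendsto_zero_iff_norm_tendsto_zero]
  have hlim : Tendsto (fun R : ℝ => 2 * Real.pi * M * R⁻¹) atTop (𝓝 0) := by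
    simpa using tendsto_inv_atTop_zero.const_mul (2 * Real.pi * M)
  refine squeeze_zero' (Eventually.of_forall fun _ => norm_nonneg _) ?_ hlim
  filter_upwards [eventually_ge_atTop R₀, eventually_gt_atTop 0] with R hR hR0
  rw [circleContour_integral, norm_mul]
  have h1 : ‖∫ u in (0 : ℝ)..1, f ((circleContour R).toFun u) * (circleContour R).toFun u‖ ≤
      M * R⁻¹ * |1 - 0| := by
    refine intervalIntegral.norm_integral_le_of_norm_le_const fun u _ => ?_
    have h2 := hf ((circleContour R).toFun u) (by rwa [norm_circleContour hR0.le])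
    rw [norm_circleContour hR0.le] at h2
    rw [norm_mul, norm_circleContour hR0.le, ← div_eq_mul_inv, le_div_iff₀ hR0]
    nlinarith
  have h3 : ‖(2 * Real.pi * Complex.I : ℂ)‖ = 2 * Real.pi := by
    simp [abs_of_pos Real.pi_pos]
  rw [h3]
  have := Real.pi_pos
  calc _ ≤ 2 * Real.pi * (M * R⁻¹ * |1 - 0|) := by gcongr
    _ = _ := by simp; ring


/-! ### Schur's Pfaffian -/

/-- The cross ratio `(a - b) / (1 - a b)`, the entry of Schur's Pfaffian. -/
noncomputable def ratio (a b : ℂ) : ℂ := (a - b) / (1 - a * b)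

lemma ratio_antisymm (a b : ℂ) : ratio a b = -ratio b a := by
  rw [ratio, ratio, mul_comm b a, ← neg_div, neg_sub]

/-- The product of `ratio (q i) (q j)` over `i < j`. -/
noncomputable def ratioProd {N : ℕ} (q : Fin N → ℂ) : ℂ :=
  ∏ i, ∏ j ∈ Finset.Ioi i, ratio (q i) (q j)

lemma ratioProd_perm {N : ℕ} (q : Fin N → ℂ) (σ : Equiv.Perm (Fin N)) :
    ratioProd (fun i => q (σ i)) = (Equiv.Perm.sign σ : ℤ) * ratioProd q :=
  σ.prod_Ioi_comp_eq_sign_mul_prod (f := fun i j => ratio (q i) (q j))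
    fun _ _ => ratio_antisymm _ _

lemma ratioProd_succ {N : ℕ} (q : Fin (N + 1) → ℂ) :
    ratioProd q = (∏ i : Fin N, ratio (q 0) (q i.succ)) * ratioProd fun i => q i.succ := by
  simp only [ratioProd, Fin.prod_univ_succ, Fin.prod_Ioi_zero, Fin.prod_Ioi_succ]

open Polynomial in
/-- The partial fraction expansion of `∏ b, ratio z (r b)` in the variable `z`, for an odd number
of factors.  A priori there is a constant term `1 - ∑ j, A j`, where the `A j` are the coefficients;
evaluation at `z = -1` shows that it vanishes. -/
lemma prod_ratio_eq_sum {N : ℕ} (hN : Even N) (r : Fin (N + 1) → ℂ) (hinj : Function.Injective r)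
    (h0 : ∀ b, r b ≠ 0) (h1 : ∀ b, r b ≠ 1) (h1' : ∀ b, r b ≠ -1) (z : ℂ)
    (hz : ∀ b, 1 - z * r b ≠ 0) :
    ∏ b, ratio z (r b) =
      ∑ j, ratio z (r j) * ∏ c : Fin N, (ratio (r j) (r (j.succAbove c)))⁻¹ := by
  set A : Fin (N + 1) → ℂ := fun j => ∏ c : Fin N, (ratio (r j) (r (j.succAbove c)))⁻¹ with hA
  set S := ∑ j, A j with hS
  set Q : ℂ[X] := ∏ b, (X - C (r b)) -
    ∑ j, C (A j) * ((X - C (r j)) * ∏ c : Fin N, (1 - X * C (r (j.succAbove c)))) -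
    C (1 - S) * ∏ b, (1 - X * C (r b)) with hQ
  have hQe : ∀ w, Q.eval w = ∏ b, (w - r b) -
      ∑ j, A j * ((w - r j) * ∏ c : Fin N, (1 - w * r (j.succAbove c))) -
      (1 - S) * ∏ b, (1 - w * r b) := fun w => by
    simp only [hQ, eval_sub, eval_prod, eval_finsetSum, eval_mul, eval_C, eval_X, eval_one]
  have hdeg : Q.natDegree ≤ N + 1 := by
    have hlin : ∀ a : ℂ, (1 - X * C a : ℂ[X]).natDegree ≤ 1 := fun a => by
      refine (natDegree_sub_le _ _).trans (max_le (by simp) ?_)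
      exact (natDegree_mul_C_le _ _).trans natDegree_X_le
    refine (natDegree_sub_le _ _).trans (max_le ((natDegree_sub_le _ _).trans (max_le ?_ ?_)) ?_)
    · refine (natDegree_prod_le _ _).trans ?_
      simp
    · refine natDegree_sum_le_of_forall_le _ _ fun j _ => ?_
      refine (natDegree_C_mul_le _ _).trans (natDegree_mul_le.trans ?_)
      have : (∏ c : Fin N, (1 - X * C (r (j.succAbove c)))).natDegree ≤ N :=
        (natDegree_prod_le _ _).trans ((Finset.sum_le_sum fun c _ => hlin _).trans (by simp))
      rw [natDegree_X_sub_C]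
      omega
    · refine (natDegree_C_mul_le _ _).trans ((natDegree_prod_le _ _).trans ?_)
      exact (Finset.sum_le_sum fun c _ => hlin _).trans (by simp)
  -- `Q` has degree at most `N + 1` and vanishes at the `N + 2` points `1` and `1 / r b`.
  have hQ0 : Q = 0 := by
    refine eq_zero_of_natDegree_lt_card_of_eval_eq_zero Q
      (f := Fin.cons (1 : ℂ) fun b => (r b)⁻¹) ?_ ?_ (by simp; omega)
    · rw [Fin.cons_injective_iff]
      refine ⟨?_, fun a b h => hinj (inv_injective h)⟩
      rintro ⟨b, hb⟩
      exact h1 b (by simpa using hb)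
    · intro i
      refine Fin.cases ?_ (fun b => ?_) i
      · rw [hQe, Fin.cons_zero]
        have : ∀ j, (1 - r j) * ∏ c : Fin N, (1 - r (j.succAbove c)) = ∏ b, (1 - r b) :=
          fun j => by rw [Fin.prod_univ_succAbove _ j]
        simp only [one_mul, this, ← Finset.sum_mul, ← hS]
        ring
      · rw [hQe, Fin.cons_succ]
        have hb : 1 - (r b)⁻¹ * r b = 0 := by rw [inv_mul_cancel₀ (h0 b), sub_self]
        have hb' : ∏ c, (1 - (r b)⁻¹ * r c) = 0 := Finset.prod_eq_zero (Finset.mem_univ b) hb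
        rw [hb', mul_zero, sub_zero, Finset.sum_eq_single b, Fin.prod_univ_succAbove _ b, hA]
        · simp only
          rw [mul_left_comm, ← Finset.prod_mul_distrib, sub_eq_zero]
          congr 1
          refine Finset.prod_congr rfl fun c _ => ?_
          have hne : r b - r (b.succAbove c) ≠ 0 :=
            sub_ne_zero.2 fun h => Fin.succAbove_ne b c (hinj h).symm
          have := h0 b
          rw [ratio, inv_div]
          field_simp
        · intro j _ hj
          obtain ⟨c, hc⟩ := Fin.exists_succAbove_eq hj.symm
          have hc' : ∏ c : Fin N, (1 - (r b)⁻¹ * r (j.succAbove c)) = 0 :=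
            Finset.prod_eq_zero (Finset.mem_univ c) (by rw [hc, hb])
          rw [hc', mul_zero, mul_zero]
        · simp
  have hS1 : S = 1 := by
    have h := hQe (-1)
    rw [hQ0, eval_zero] at h
    have e1 : ∏ b, (-1 - r b) = -∏ b, (1 + r b) := by
      simp only [show ∀ b, -1 - r b = -1 * (1 + r b) from fun b => by ring, Finset.prod_mul_distrib]
      simp [pow_succ, hN.neg_one_pow]
    have e2 : ∀ j, (-1 - r j) * ∏ c : Fin N, (1 - -1 * r (j.succAbove c)) = -∏ b, (1 + r b) :=
      fun j => by
        rw [Fin.prod_univ_succAbove (fun b => 1 + r b) j]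
        simp only [neg_one_mul, sub_neg_eq_add]
        ring
    simp only [e1, e2, ← Finset.sum_mul, ← hS] at h
    simp only [neg_one_mul, sub_neg_eq_add] at h
    have hne : ∏ b, (1 + r b) ≠ 0 := Finset.prod_ne_zero_iff.2 fun b _ hb =>
      h1' b (by linear_combination hb)
    have h' : (2 * (S - 1)) * ∏ b, (1 + r b) = 0 := by linear_combination -h
    rcases mul_eq_zero.1 h' with h2 | h2
    · linear_combination h2 / 2
    · exact absurd h2 hne
  have h := hQe z
  rw [hQ0, eval_zero, hS1, sub_self, zero_mul, sub_zero] at h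
  have hD : ∏ b, (1 - z * r b) ≠ 0 := Finset.prod_ne_zero_iff.2 fun b _ => hz b
  simp only [ratio] at hA ⊢
  rw [Finset.prod_div_distrib, sub_eq_zero.1 h.symm, Finset.sum_div]
  refine Finset.sum_congr rfl fun j _ => ?_
  have hD' : ∏ c : Fin N, (1 - z * r (j.succAbove c)) ≠ 0 :=
    Finset.prod_ne_zero_iff.2 fun b _ => hz _
  rw [Fin.prod_univ_succAbove (fun b => 1 - z * r b) j]
  have := hz j
  simp only [hA]
  field_simp

/-- A permutation of `Fin (m + 1)` amounts to the image of `0` and a permutation of the rest. -/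
lemma sum_perm_succ {m : ℕ} (q : Fin (m + 1) → ℂ) (g : (Fin (m + 1) → ℂ) → ℂ) :
    ∑ σ : Equiv.Perm (Fin (m + 1)), g (fun i => q (σ i)) =
      ∑ p, ∑ e : Equiv.Perm (Fin m), g (Fin.cons (q p) fun i => q (p.succAbove (e i))) := by
  rw [← Fintype.sum_prod_type' (f := fun p (e : Equiv.Perm (Fin m)) =>
    g (Fin.cons (q p) fun i => q (p.succAbove (e i))))]
  have hinj : ∀ x : Fin (m + 1) × Equiv.Perm (Fin m),
      Function.Injective (Fin.cons x.1 fun i => x.1.succAbove (x.2 i) : Fin (m + 1) → Fin (m + 1)) :=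
    fun x => by
      rw [Fin.cons_injective_iff]
      refine ⟨?_, fun a b h => x.2.injective (Fin.succAbove_right_injective h)⟩
      rintro ⟨i, hi⟩
      exact Fin.succAbove_ne _ _ hi
  let Φ : Fin (m + 1) × Equiv.Perm (Fin m) → Equiv.Perm (Fin (m + 1)) := fun x =>
    Equiv.ofBijective _ (Finite.injective_iff_bijective.1 (hinj x))
  have hΦ : ∀ x i, Φ x i = (Fin.cons x.1 fun i => x.1.succAbove (x.2 i) :
    Fin (m + 1) → Fin (m + 1)) i := fun _ _ => rfl
  have hbij : Function.Bijective Φ := by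
    rw [Fintype.bijective_iff_injective_and_card]
    refine ⟨fun x y h => ?_, by simp [Fintype.card_perm, Nat.factorial_succ]⟩
    have h0 : x.1 = y.1 := by
      have := DFunLike.congr_fun h 0
      simpa [hΦ] using this
    refine Prod.ext h0 (Equiv.ext fun i => ?_)
    have := DFunLike.congr_fun h i.succ
    rw [hΦ, hΦ, Fin.cons_succ, Fin.cons_succ, h0] at this
    exact Fin.succAbove_right_injective this
  refine (Fintype.sum_bijective Φ hbij _ _ fun x => ?_).symm
  congr 1
  funext i
  rw [hΦ]
  refine Fin.cases ?_ (fun i => ?_) i <;> simp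

/-- The product of the inverse cross ratios of those pairs among `q 0, …, q (2d - 1)` which do not
form one of the blocks `{q (2k), q (2k + 1)}`. -/
noncomputable def offBlockInv : (d : ℕ) → (Fin (2 * d) → ℂ) → ℂ
  | 0, _ => 1
  | d + 1, q => (∏ c : Fin (2 * d), (ratio (q 0) (q c.succ.succ) * ratio (q 1) (q c.succ.succ))⁻¹) *
      offBlockInv d fun c => q c.succ.succ

/-- The product of the cross ratios of the blocks `{q (2k), q (2k + 1)}`. -/
noncomputable def blockProd : (d : ℕ) → (Fin (2 * d) → ℂ) → ℂ
  | 0, _ => 1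
  | d + 1, q => ratio (q 0) (q 1) * blockProd d fun c => q c.succ.succ

lemma ratioProd_two_mul_succ {d : ℕ} (q : Fin (2 * (d + 1)) → ℂ) :
    ratioProd q = ratio (q 0) (q 1) *
      (∏ c : Fin (2 * d), ratio (q 0) (q c.succ.succ) * ratio (q 1) (q c.succ.succ)) *
      ratioProd fun c : Fin (2 * d) => q c.succ.succ := by
  have h1 := ratioProd_succ (N := 2 * d + 1) q
  have h2 := ratioProd_succ (N := 2 * d) fun i => q i.succ
  rw [Fin.prod_univ_succ] at h1
  refine h1.trans ?_
  rw [h2, Finset.prod_mul_distrib]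
  have e : (Fin.succ 0 : Fin (2 * d + 1 + 1)) = 1 := rfl
  rw [e]
  ring

lemma ratioProd_mul_offBlockInv : ∀ (d : ℕ) (q : Fin (2 * d) → ℂ),
    (∀ a b, a ≠ b → ratio (q a) (q b) ≠ 0) → ratioProd q * offBlockInv d q = blockProd d q
  | 0, q, _ => by simp [ratioProd, offBlockInv, blockProd]
  | d + 1, q, h => by
    have ih := ratioProd_mul_offBlockInv d (fun c => q c.succ.succ) fun a b hab =>
      h _ _ fun h' => hab (Fin.succ_injective _ (Fin.succ_injective _ h'))
    rw [ratioProd_two_mul_succ, offBlockInv, blockProd, ← ih, Finset.prod_inv_distrib]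
    have hne : (∏ c : Fin (2 * d), ratio (q 0) (q c.succ.succ) * ratio (q 1) (q c.succ.succ)) ≠ 0 :=
      Finset.prod_ne_zero_iff.2 fun c _ => mul_ne_zero
        (h _ _ (Fin.succ_ne_zero (n := 2 * d + 1) c.succ).symm)
        (h _ _ fun h' => (Fin.succ_ne_zero c).symm (Fin.succ_injective (2 * d + 1) h'))
    generalize (∏ c : Fin (2 * d), ratio (q 0) (q c.succ.succ) * ratio (q 1) (q c.succ.succ)) = T
      at hne
    field_simp

/-- A tuple of pairwise distinct numbers, distinct from `0` and `±1`, with no pair of product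
`1`. -/
structure GenericTuple {N : ℕ} (q : Fin N → ℂ) : Prop where
  inj : Function.Injective q
  ne_zero : ∀ a, q a ≠ 0
  ne_one : ∀ a, q a ≠ 1
  ne_neg_one : ∀ a, q a ≠ -1
  mul_ne : ∀ a b, a ≠ b → 1 - q a * q b ≠ 0

lemma GenericTuple.comp {N M : ℕ} {q : Fin N → ℂ} (hq : GenericTuple q) {f : Fin M → Fin N}
    (hf : Function.Injective f) : GenericTuple fun i => q (f i) :=
  ⟨hq.inj.comp hf, fun _ => hq.ne_zero _, fun _ => hq.ne_one _, fun _ => hq.ne_neg_one _,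
    fun _ _ h => hq.mul_ne _ _ fun h' => h (hf h')⟩

lemma GenericTuple.ratio_ne {N : ℕ} {q : Fin N → ℂ} (hq : GenericTuple q) {a b : Fin N}
    (h : a ≠ b) : ratio (q a) (q b) ≠ 0 :=
  div_ne_zero (sub_ne_zero.2 fun h' => h (hq.inj h')) (hq.mul_ne a b h)

/-- Schur's Pfaffian divided by the product of all cross ratios.  In the induction the image `p` of
`0` is arbitrary, and the sum over the image of `1` is evaluated by `prod_ratio_eq_sum`. -/
lemma sum_offBlockInv : ∀ (d : ℕ) (q : Fin (2 * d) → ℂ), GenericTuple q →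
    ∑ σ : Equiv.Perm (Fin (2 * d)), offBlockInv d (fun i => q (σ i)) = 2 ^ d * d.factorial
  | 0, q, _ => by simp [offBlockInv]
  | d + 1, q, hq => by
    have key : ∀ p : Fin (2 * d + 2), ∑ e : Equiv.Perm (Fin (2 * d + 1)),
        offBlockInv (d + 1) (Fin.cons (q p) fun i => q (p.succAbove (e i))) =
          2 ^ d * d.factorial := by
      intro p
      set r : Fin (2 * d + 1) → ℂ := fun i => q (p.succAbove i) with hr
      have hgr : GenericTuple r := hq.comp Fin.succAbove_right_injective
      have hzr : ∀ b, ratio (q p) (r b) ≠ 0 := fun b => hq.ratio_ne (Fin.succAbove_ne p b).symm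
      refine (sum_perm_succ r fun s => offBlockInv (d + 1) (Fin.cons (q p) s)).trans ?_
      have h1 : ∀ (j : Fin (2 * d + 1)) (e : Equiv.Perm (Fin (2 * d))),
          offBlockInv (d + 1) (Fin.cons (q p) (Fin.cons (r j) fun i => r (j.succAbove (e i)))) =
          (∏ c : Fin (2 * d), (ratio (q p) (r (j.succAbove c)) *
            ratio (r j) (r (j.succAbove c)))⁻¹) *
            offBlockInv d fun i => r (j.succAbove (e i)) := by
        intro j e
        rw [offBlockInv]
        congr 1
        exact Equiv.prod_comp e fun c =>
          (ratio (q p) (r (j.succAbove c)) * ratio (r j) (r (j.succAbove c)))⁻¹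
      refine (Finset.sum_congr rfl fun j _ =>
        Finset.sum_congr rfl fun e _ => h1 j e).trans ?_
      simp only [← Finset.mul_sum]
      have h2 : ∀ j : Fin (2 * d + 1), ∑ e : Equiv.Perm (Fin (2 * d)),
          offBlockInv d (fun i => r (j.succAbove (e i))) = 2 ^ d * d.factorial := fun j =>
        sum_offBlockInv d (fun i => r (j.succAbove i)) (hgr.comp Fin.succAbove_right_injective)
      simp only [h2, ← Finset.sum_mul]
      have h3 := prod_ratio_eq_sum (even_two_mul d) r hgr.inj hgr.ne_zero hgr.ne_one
        hgr.ne_neg_one (q p) fun b => hq.mul_ne _ _ (Fin.succAbove_ne p b).symm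
      have hP : ∏ b, ratio (q p) (r b) ≠ 0 := Finset.prod_ne_zero_iff.2 fun b _ => hzr b
      have h4 : ∑ j, ∏ c : Fin (2 * d), (ratio (q p) (r (j.succAbove c)) *
          ratio (r j) (r (j.succAbove c)))⁻¹ = 1 := by
        rw [← mul_right_inj' hP, mul_one, Finset.mul_sum]
        conv_rhs => rw [h3]
        refine Finset.sum_congr rfl fun j _ => ?_
        rw [Fin.prod_univ_succAbove (fun b => ratio (q p) (r b)) j]
        simp only [mul_inv, Finset.prod_mul_distrib, Finset.prod_inv_distrib]
        have : ∏ c : Fin (2 * d), ratio (q p) (r (j.succAbove c)) ≠ 0 :=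
          Finset.prod_ne_zero_iff.2 fun b _ => hzr _
        field_simp
      rw [h4, one_mul]
    have h := sum_perm_succ (m := 2 * d + 1) q (offBlockInv (d + 1))
    refine (h.trans (Finset.sum_congr rfl fun p _ => key p)).trans ?_
    rw [Finset.sum_const, Finset.card_univ, Fintype.card_fin,
      Nat.factorial_succ, nsmul_eq_mul]
    push_cast
    ring

lemma sum_sign_blockProd_of_generic {d : ℕ} {q : Fin (2 * d) → ℂ} (hq : GenericTuple q) :
    ∑ σ : Equiv.Perm (Fin (2 * d)), ((Equiv.Perm.sign σ : ℤ) : ℂ) * blockProd d (fun i => q (σ i)) =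
      2 ^ d * d.factorial * ratioProd q := by
  rw [← sum_offBlockInv d q hq, Finset.sum_mul]
  refine Finset.sum_congr rfl fun σ _ => ?_
  rw [← ratioProd_mul_offBlockInv d (fun i => q (σ i)) fun a b hab =>
    hq.ratio_ne (σ.injective.ne hab), ratioProd_perm]
  have : ((Equiv.Perm.sign σ : ℤ) : ℂ) * ((Equiv.Perm.sign σ : ℤ) : ℂ) = 1 := by
    rw [← Int.cast_mul, ← Units.val_mul, Int.units_mul_self]
    simp
  linear_combination (ratioProd q * offBlockInv d fun i => q (σ i)) * this

/-- Members of a finite family of lines avoid given values at almost all parameters. -/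
lemma eventually_add_mul_ne {𝕜 : Type*} [NontriviallyNormedField 𝕜] {a b c : 𝕜} (hc : c ≠ 0) :
    ∀ᶠ ε in 𝓝[≠] (0 : 𝕜), a + ε * c ≠ b := by
  by_cases h : a = b
  · filter_upwards [self_mem_nhdsWithin] with ε hε
    simpa [h, hc] using hε
  · have : Tendsto (fun ε : 𝕜 => a + ε * c) (𝓝[≠] 0) (𝓝 a) := by
      have : Continuous fun ε : 𝕜 => a + ε * c := by fun_prop
      simpa using (this.tendsto 0).mono_left nhdsWithin_le_nhds
    exact this.eventually_ne h

lemma eventually_injective_add_mul {𝕜 : Type*} [NontriviallyNormedField 𝕜] [CharZero 𝕜] {N : ℕ}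
    (q : Fin N → 𝕜) :
    ∀ᶠ ε in 𝓝[≠] (0 : 𝕜), Function.Injective fun i : Fin N => q i + ε * ((i : ℕ) + 1 : 𝕜) := by
  have : ∀ i j : Fin N, i ≠ j → ∀ᶠ ε in 𝓝[≠] (0 : 𝕜), q i + ε * ((i : ℕ) - (j : ℕ) : 𝕜) ≠ q j :=
    fun i j hij => eventually_add_mul_ne (sub_ne_zero.2 (by exact_mod_cast Fin.val_ne_of_ne hij))
  filter_upwards [eventually_all.2 fun i => eventually_all.2 fun j =>
    eventually_all.2 (this i j)]
    with ε hε i j hij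
  by_contra hne
  exact hε i j hne (by linear_combination hij)

lemma continuousAt_ratio {X : Type*} [TopologicalSpace X] {x₀ : X} {f g : X → ℂ}
    (hf : ContinuousAt f x₀) (hg : ContinuousAt g x₀) (h : 1 - f x₀ * g x₀ ≠ 0) :
    ContinuousAt (fun x => ratio (f x) (g x)) x₀ :=
  (hf.sub hg).div (continuousAt_const.sub (hf.mul hg)) h

lemma continuousAt_blockProd {X : Type*} [TopologicalSpace X] {x₀ : X} :
    ∀ (d : ℕ) {q : X → Fin (2 * d) → ℂ}, (∀ i, ContinuousAt (fun x => q x i) x₀) →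
    (∀ a b, a ≠ b → 1 - q x₀ a * q x₀ b ≠ 0) → ContinuousAt (fun x => blockProd d (q x)) x₀
  | 0, _, _, _ => by simpa [blockProd] using continuousAt_const
  | d + 1, q, hq, h => by
    simp only [blockProd]
    refine (continuousAt_ratio (hq _) (hq _) (h _ _ ?_)).mul
      (continuousAt_blockProd d (q := fun x c => q x c.succ.succ) (fun _ => hq _)
        fun a b hab => h _ _ fun h' => hab (Fin.succ_injective _ (Fin.succ_injective _ h')))
    exact Fin.ne_of_val_ne (by simp)

/-- Schur's Pfaffian identity, with the Pfaffian written as a sum over all permutations. -/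
lemma sum_sign_blockProd {d : ℕ} {q : Fin (2 * d) → ℂ} (hq : ∀ a b, a ≠ b → 1 - q a * q b ≠ 0) :
    ∑ σ : Equiv.Perm (Fin (2 * d)), ((Equiv.Perm.sign σ : ℤ) : ℂ) * blockProd d (fun i => q (σ i)) =
      2 ^ d * d.factorial * ratioProd q := by
  set p : ℂ → Fin (2 * d) → ℂ := fun ε i => q i + ε * ((i : ℕ) + 1) with hp
  have hp0 : p 0 = q := by simp [hp]
  have hpc : ∀ i, ContinuousAt (fun ε => p ε i) 0 := fun i => by
    simp only [hp]
    fun_prop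
  have hne : ∀ a : Fin (2 * d), ((a : ℕ) + 1 : ℂ) ≠ 0 := fun a => by
    exact_mod_cast Nat.succ_ne_zero (a : ℕ)
  have hmul : ∀ a b : Fin (2 * d), a ≠ b → ∀ᶠ ε in 𝓝[≠] (0 : ℂ), 1 - p ε a * p ε b ≠ 0 := by
    intro a b hab
    have : ContinuousAt (fun ε => 1 - p ε a * p ε b) 0 :=
      continuousAt_const.sub ((hpc a).mul (hpc b))
    exact (this.eventually_ne (by rw [hp0]; exact hq a b hab)).filter_mono nhdsWithin_le_nhds
  have hgen : ∀ᶠ ε in 𝓝[≠] (0 : ℂ), GenericTuple (p ε) := by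
    filter_upwards [eventually_injective_add_mul q,
      eventually_all.2 fun a => eventually_add_mul_ne (a := q a) (b := 0) (hne a),
      eventually_all.2 fun a => eventually_add_mul_ne (a := q a) (b := 1) (hne a),
      eventually_all.2 fun a => eventually_add_mul_ne (a := q a) (b := -1) (hne a),
      eventually_all.2 fun a => eventually_all.2 fun b => eventually_all.2 fun hab : a ≠ b =>
        hmul a b hab] with ε h1 h2 h3 h4 h5
    exact ⟨h1, h2, h3, h4, h5⟩
  have hL : ContinuousAt (fun ε => ∑ σ : Equiv.Perm (Fin (2 * d)),
      ((Equiv.Perm.sign σ : ℤ) : ℂ) * blockProd d (fun i => p ε (σ i))) 0 := by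
    refine tendsto_finsetSum _ fun σ _ => tendsto_const_nhds.mul ?_
    exact continuousAt_blockProd d (q := fun ε i => p ε (σ i)) (fun i => hpc _)
      fun a b hab => by rw [hp0]; exact hq _ _ (σ.injective.ne hab)
  have hR : ContinuousAt (fun ε => 2 ^ d * d.factorial * ratioProd (p ε)) 0 := by
    refine tendsto_const_nhds.mul (tendsto_finsetProd _ fun i _ => tendsto_finsetProd _ fun j hj => ?_)
    exact continuousAt_ratio (hpc i) (hpc j)
      (by rw [hp0]; exact hq _ _ (Finset.mem_Ioi.1 hj).ne)
  have h1 := hL.tendsto.mono_left (nhdsWithin_le_nhds (s := {0}ᶜ))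
  have h2 := hR.tendsto.mono_left (nhdsWithin_le_nhds (s := {0}ᶜ))
  simp only [hp0] at h1 h2
  refine tendsto_nhds_unique (h1.congr' ?_) h2
  filter_upwards [hgen] with ε hε
  exact sum_sign_blockProd_of_generic hε


/-! ### Pfaffians of matrices of integrals -/

/-- The lexicographic enumeration of `Fin d × Fin 2`. -/
def blockEquiv (d : ℕ) : Fin d × Fin 2 ≃ Fin (2 * d) :=
  finProdFinEquiv.trans (finCongr (mul_comm d 2))

lemma blockEquiv_val {d : ℕ} (b : Fin d × Fin 2) : (blockEquiv d b : ℕ) = b.2 + 2 * b.1 := by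
  simp [blockEquiv]

lemma blockEquiv_zero_zero {d : ℕ} : blockEquiv (d + 1) (0, 0) = 0 :=
  Fin.ext (by simp [blockEquiv_val])

lemma blockEquiv_zero_one {d : ℕ} : blockEquiv (d + 1) (0, 1) = 1 :=
  Fin.ext (by rw [blockEquiv_val]; rfl)

lemma blockEquiv_succ {d : ℕ} (k : Fin d) (i : Fin 2) :
    blockEquiv (d + 1) (k.succ, i) = (blockEquiv d (k, i)).succ.succ := by
  refine Fin.ext ?_
  have h : (((blockEquiv d (k, i)).succ.succ : Fin (2 * d + 2)) : ℕ) = blockEquiv d (k, i) + 2 := rfl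
  refine Eq.trans ?_ h.symm
  rw [blockEquiv_val, blockEquiv_val]
  simp only [Fin.val_succ]
  ring

lemma blockProd_eq_prod : ∀ (d : ℕ) (q : Fin (2 * d) → ℂ),
    blockProd d q = ∏ k, ratio (q (blockEquiv d (k, 0))) (q (blockEquiv d (k, 1)))
  | 0, q => by simp [blockProd]
  | d + 1, q => by
    rw [Fin.prod_univ_succ, blockProd, blockProd_eq_prod d, blockEquiv_zero_zero,
      blockEquiv_zero_one]
    simp only [blockEquiv_succ]

/-- The product of `ratio (p a) (p b)` over all `a < b` in `Fin d × Fin 2`, in lexicographic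
order. -/
noncomputable def blockRatioProd {d : ℕ} (p : Fin d × Fin 2 → ℂ) : ℂ :=
  ratioProd fun i => p ((blockEquiv d).symm i)

lemma blockRatioProd_eq : ∀ {d : ℕ} (p : Fin d × Fin 2 → ℂ),
    blockRatioProd p = (∏ k, ratio (p (k, 0)) (p (k, 1))) * ∏ k, ∏ l ∈ Finset.Ioi k,
      (ratio (p (k, 0)) (p (l, 0)) * ratio (p (k, 0)) (p (l, 1)) *
        (ratio (p (k, 1)) (p (l, 0)) * ratio (p (k, 1)) (p (l, 1))))
  | 0, p => by simp [blockRatioProd, ratioProd]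
  | d + 1, p => by
    have h0 : (blockEquiv (d + 1)).symm 0 = (0, 0) := by
      rw [Equiv.symm_apply_eq, blockEquiv_zero_zero]
    have h1 : (blockEquiv (d + 1)).symm 1 = (0, 1) := by
      rw [Equiv.symm_apply_eq, blockEquiv_zero_one]
    have h2 : ∀ c : Fin (2 * d), (blockEquiv (d + 1)).symm c.succ.succ =
        (((blockEquiv d).symm c).1.succ, ((blockEquiv d).symm c).2) := fun c => by
      rw [Equiv.symm_apply_eq, blockEquiv_succ]
      simp
    have ih := blockRatioProd_eq fun b : Fin d × Fin 2 => p (b.1.succ, b.2)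
    rw [blockRatioProd] at ih ⊢
    rw [ratioProd_two_mul_succ, h0, h1]
    simp only [h2, ih, Fin.prod_univ_succ (n := d), Fin.prod_Ioi_zero, Fin.prod_Ioi_succ]
    rw [← Equiv.prod_comp (blockEquiv d), Fintype.prod_prod_type]
    simp only [Equiv.symm_apply_apply, Fin.prod_univ_two]
    have : ∀ l : Fin d, ratio (p (0, 0)) (p (l.succ, 0)) * ratio (p (0, 1)) (p (l.succ, 0)) *
        (ratio (p (0, 0)) (p (l.succ, 1)) * ratio (p (0, 1)) (p (l.succ, 1))) =
        ratio (p (0, 0)) (p (l.succ, 0)) * ratio (p (0, 0)) (p (l.succ, 1)) *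
        (ratio (p (0, 1)) (p (l.succ, 0)) * ratio (p (0, 1)) (p (l.succ, 1))) := fun l => by ring
    simp only [this]
    ring

/-- Schur's Pfaffian identity, indexed by blocks of size two. -/
lemma sum_sign_prod_ratio {d : ℕ} (p : Fin d × Fin 2 → ℂ)
    (hp : ∀ a b, a ≠ b → 1 - p a * p b ≠ 0) :
    ∑ σ : Equiv.Perm (Fin d × Fin 2), ((Equiv.Perm.sign σ : ℤ) : ℂ) *
      ∏ k, ratio (p (σ (k, 0))) (p (σ (k, 1))) = 2 ^ d * d.factorial * blockRatioProd p := by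
  rw [blockRatioProd, ← sum_sign_blockProd fun a b hab =>
    hp _ _ ((blockEquiv d).symm.injective.ne hab)]
  refine Fintype.sum_equiv (blockEquiv d).permCongr _ _ fun σ => ?_
  rw [Equiv.Perm.sign_permCongr, blockProd_eq_prod]
  simp [Equiv.permCongr_apply]

/-- Distributing pairs of numbers to the positions in the blocks of a permutation. -/
def pairMap {d : ℕ} (σ : Equiv.Perm (Fin d × Fin 2)) (R : Fin d → ℂ × ℂ) (b : Fin d × Fin 2) : ℂ :=
  if (σ.symm b).2 = 0 then (R (σ.symm b).1).1 else (R (σ.symm b).1).2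

lemma pairMap_zero {d : ℕ} (σ : Equiv.Perm (Fin d × Fin 2)) (R : Fin d → ℂ × ℂ) (k : Fin d) :
    pairMap σ R (σ (k, 0)) = (R k).1 := by simp [pairMap]

lemma pairMap_one {d : ℕ} (σ : Equiv.Perm (Fin d × Fin 2)) (R : Fin d → ℂ × ℂ) (k : Fin d) :
    pairMap σ R (σ (k, 1)) = (R k).2 := by simp [pairMap]

lemma measurable_pairMap {d : ℕ} (σ : Equiv.Perm (Fin d × Fin 2)) : Measurable (pairMap σ) := by
  refine measurable_pi_lambda _ fun b => ?_
  unfold pairMap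
  split_ifs <;> fun_prop

lemma measurePreserving_pairMap {d : ℕ} (σ : Equiv.Perm (Fin d × Fin 2))
    (ν : Fin d × Fin 2 → Measure ℂ) [∀ b, SigmaFinite (ν b)] :
    MeasurePreserving (pairMap σ) (Measure.pi fun k => (ν (σ (k, 0))).prod (ν (σ (k, 1))))
      (Measure.pi ν) := by
  refine ⟨measurable_pairMap σ, (Measure.pi_eq fun s hs => ?_).symm⟩
  rw [Measure.map_apply (measurable_pairMap σ) (MeasurableSet.univ_pi hs)]
  have : pairMap σ ⁻¹' Set.univ.pi s =
      Set.univ.pi fun k => s (σ (k, 0)) ×ˢ s (σ (k, 1)) := by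
    ext R
    simp only [Set.mem_preimage, Set.mem_pi, Set.mem_univ, true_imp_iff, Set.mem_prod]
    rw [← σ.forall_congr_right (q := fun b => pairMap σ R b ∈ s b), Prod.forall]
    simp only [Fin.forall_fin_two, pairMap_zero, pairMap_one]
  rw [this, Measure.pi_pi, ← Equiv.prod_comp σ, Fintype.prod_prod_type]
  simp only [Measure.prod_prod, Fin.prod_univ_two]

section

variable {d : ℕ} {ν : Fin d × Fin 2 → Measure ℂ} [∀ b, SigmaFinite (ν b)]
  {F : Fin d × Fin 2 → Fin d × Fin 2 → ℂ → ℂ → ℂ}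

lemma measurable_prod_pairs (hF : ∀ a b, Measurable (Function.uncurry (F a b)))
    (σ : Equiv.Perm (Fin d × Fin 2)) : Measurable fun P : Fin d × Fin 2 → ℂ =>
      ∏ k, F (σ (k, 0)) (σ (k, 1)) (P (σ (k, 0))) (P (σ (k, 1))) := by
  refine Finset.measurable_fun_prod _ fun k _ => ?_
  have : Measurable fun P : Fin d × Fin 2 → ℂ => (P (σ (k, 0)), P (σ (k, 1))) := by fun_prop
  exact (hF (σ (k, 0)) (σ (k, 1))).comp this

lemma pair_ne (σ : Equiv.Perm (Fin d × Fin 2)) (k : Fin d) : σ (k, 0) ≠ σ (k, 1) :=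
  σ.injective.ne (by simp)

lemma integrable_prod_pairs (hF : ∀ a b, Measurable (Function.uncurry (F a b)))
    (hint : ∀ a b, a ≠ b → Integrable (Function.uncurry (F a b)) ((ν a).prod (ν b)))
    (σ : Equiv.Perm (Fin d × Fin 2)) : Integrable (fun P : Fin d × Fin 2 → ℂ =>
      ∏ k, F (σ (k, 0)) (σ (k, 1)) (P (σ (k, 0))) (P (σ (k, 1)))) (Measure.pi ν) := by
  have hmp := measurePreserving_pairMap σ ν
  rw [← hmp.map_eq, integrable_map_measure (measurable_prod_pairs hF σ).aestronglyMeasurable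
    hmp.measurable.aemeasurable]
  have := Integrable.fintype_prod_dep (μ := fun k => (ν (σ (k, 0))).prod (ν (σ (k, 1))))
    (f := fun k => Function.uncurry (F (σ (k, 0)) (σ (k, 1)))) fun k => hint _ _ (pair_ne σ k)
  refine this.congr (Eventually.of_forall fun R => ?_)
  simp only [Function.comp, pairMap_zero, pairMap_one, Function.uncurry]

lemma integral_prod_pairs (hF : ∀ a b, Measurable (Function.uncurry (F a b)))
    (hint : ∀ a b, a ≠ b → Integrable (Function.uncurry (F a b)) ((ν a).prod (ν b)))
    (σ : Equiv.Perm (Fin d × Fin 2)) :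
    ∫ P, ∏ k, F (σ (k, 0)) (σ (k, 1)) (P (σ (k, 0))) (P (σ (k, 1))) ∂Measure.pi ν =
      ∏ k, ∫ z, ∫ w, F (σ (k, 0)) (σ (k, 1)) z w ∂ν (σ (k, 1)) ∂ν (σ (k, 0)) := by
  have hmp := measurePreserving_pairMap σ ν
  conv_lhs => rw [← hmp.map_eq]
  rw [integral_map hmp.measurable.aemeasurable (measurable_prod_pairs hF σ).aestronglyMeasurable]
  simp only [pairMap_zero, pairMap_one]
  refine (integral_fintype_prod_eq_prod (μ := fun k => (ν (σ (k, 0))).prod (ν (σ (k, 1))))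
    (f := fun k => Function.uncurry (F (σ (k, 0)) (σ (k, 1))))).trans ?_
  exact Finset.prod_congr rfl fun k _ => integral_prod _ (hint _ _ (pair_ne σ k))

/-- The Pfaffian of a matrix of double integrals is a single multiple integral (de Bruijn). -/
lemma pfaffian_integral {A : Matrix (Fin d × Fin 2) (Fin d × Fin 2) ℂ}
    (hA : ∀ a b, a ≠ b → A a b = ∫ z, ∫ w, F a b z w ∂ν b ∂ν a)
    (hF : ∀ a b, Measurable (Function.uncurry (F a b)))
    (hint : ∀ a b, a ≠ b → Integrable (Function.uncurry (F a b)) ((ν a).prod (ν b))) :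
    pfaffian A = (1 / (2 ^ d * (d.factorial : ℂ))) * ∫ P, ∑ σ : Equiv.Perm (Fin d × Fin 2),
      ((Equiv.Perm.sign σ : ℤ) : ℂ) *
        ∏ k, F (σ (k, 0)) (σ (k, 1)) (P (σ (k, 0))) (P (σ (k, 1))) ∂Measure.pi ν := by
  rw [pfaffian, integral_finsetSum _ fun σ _ => (integrable_prod_pairs hF hint σ).const_mul _]
  congr 1
  refine Finset.sum_congr rfl fun σ _ => ?_
  rw [integral_const_mul, integral_prod_pairs hF hint]
  congr 1
  exact Finset.prod_congr rfl fun k _ => hA _ _ (pair_ne σ k)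

lemma measurable_ratio : Measurable (Function.uncurry ratio) := by
  unfold Function.uncurry ratio
  fun_prop

/-- The Pfaffian of the double integrals of `-ratio` against weights is a multiple integral of the
product of all cross ratios. -/
lemma pfaffian_integral_ratio {A : Matrix (Fin d × Fin 2) (Fin d × Fin 2) ℂ}
    {ω : Fin d × Fin 2 → ℂ → ℂ} (hω : ∀ b, Measurable (ω b))
    (hA : ∀ a b, a ≠ b → A a b = ∫ z, ∫ w, -ratio z w * (ω a z * ω b w) ∂ν b ∂ν a)
    (hint : ∀ a b, a ≠ b → Integrable (fun p : ℂ × ℂ => -ratio p.1 p.2 * (ω a p.1 * ω b p.2))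
      ((ν a).prod (ν b)))
    (hne : ∀ a b, a ≠ b → ∀ᵐ P ∂Measure.pi ν, 1 - P a * P b ≠ 0) :
    pfaffian A = (-1) ^ d * ∫ P, blockRatioProd P * ∏ b, ω b (P b) ∂Measure.pi ν := by
  rw [pfaffian_integral (F := fun a b z w => -ratio z w * (ω a z * ω b w)) hA
    (fun a b => (measurable_ratio.neg).mul (((hω a).comp measurable_fst).mul
      ((hω b).comp measurable_snd))) hint, ← integral_const_mul, ← integral_const_mul]
  refine integral_congr_ae ?_
  have hne' : ∀ᵐ P ∂Measure.pi ν, ∀ a b, a ≠ b → 1 - P a * P b ≠ 0 :=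
    eventually_all.2 fun a => eventually_all.2 fun b => eventually_all.2 (hne a b)
  filter_upwards [hne'] with P hP
  have h1 : ∀ σ : Equiv.Perm (Fin d × Fin 2),
      ∏ k, -ratio (P (σ (k, 0))) (P (σ (k, 1))) *
        (ω (σ (k, 0)) (P (σ (k, 0))) * ω (σ (k, 1)) (P (σ (k, 1)))) =
      (-1) ^ d * (∏ b, ω b (P b)) * ∏ k, ratio (P (σ (k, 0))) (P (σ (k, 1))) := by
    intro σ
    rw [Finset.prod_mul_distrib, Finset.prod_neg, Finset.card_univ, Fintype.card_fin,
      ← Equiv.prod_comp σ fun b => ω b (P b), Fintype.prod_prod_type]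
    simp only [Fin.prod_univ_two]
    ring
  have h2 : ((2 : ℂ) ^ d * (d.factorial : ℂ)) ≠ 0 :=
    mul_ne_zero (by simp) (by exact_mod_cast d.factorial_ne_zero)
  simp only [h1, mul_left_comm _ ((-1 : ℂ) ^ d * _), ← Finset.mul_sum, sum_sign_prod_ratio P hP]
  rw [← mul_assoc, ← mul_assoc, one_div]
  generalize (2 : ℂ) ^ d * (d.factorial : ℂ) = T at h2
  field_simp

end


/-! ### Complete homogeneous symmetric functions -/

lemma eval_hsymm {n : ℕ} (x : Fin n → ℝ) (k : ℕ) :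
    MvPolynomial.eval x (MvPolynomial.hsymm (Fin n) ℝ k) =
      ∑ s : Sym (Fin n) k, ∏ i, x i ^ (s : Multiset (Fin n)).count i := by
  rw [MvPolynomial.hsymm, map_sum]
  refine Finset.sum_congr rfl fun s _ => ?_
  rw [← Multiset.prod_hom, Multiset.map_map]
  simp only [Function.comp_apply, MvPolynomial.eval_X]
  rw [Finset.prod_multiset_map_count]
  refine Finset.prod_subset (Finset.subset_univ _) fun i _ hi => ?_
  rw [Multiset.count_eq_zero_of_notMem (by simpa using hi), pow_zero]

lemma hComplete_natCast {n : ℕ} (x : Fin n → ℝ) (k : ℕ) :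
    hComplete x k = ∑ s : Sym (Fin n) k, ∏ i, x i ^ (s : Multiset (Fin n)).count i := by
  rw [hComplete, if_pos (by omega), Int.toNat_natCast, eval_hsymm]

lemma hComplete_of_neg {n : ℕ} (x : Fin n → ℝ) {k : ℤ} (hk : k < 0) : hComplete x k = 0 :=
  if_neg (by omega)

lemma hComplete_zero {n : ℕ} (x : Fin n → ℝ) : hComplete x 0 = 1 := by
  simp [hComplete]

lemma hComplete_nonneg {n : ℕ} {x : Fin n → ℝ} (hx : ∀ i, 0 ≤ x i) (k : ℤ) : 0 ≤ hComplete x k := by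
  rcases lt_or_ge k 0 with hk | hk
  · rw [hComplete_of_neg x hk]
  · obtain ⟨m, rfl⟩ := Int.eq_ofNat_of_zero_le hk
    rw [hComplete_natCast]
    exact Finset.sum_nonneg fun s _ => Finset.prod_nonneg fun i _ => pow_nonneg (hx i) _

lemma hComplete_mono {n : ℕ} {x y : Fin n → ℝ} (hx : ∀ i, 0 ≤ x i) (hxy : ∀ i, x i ≤ y i) (k : ℤ) :
    hComplete x k ≤ hComplete y k := by
  rcases lt_or_ge k 0 with hk | hk
  · rw [hComplete_of_neg x hk, hComplete_of_neg y hk]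
  · obtain ⟨m, rfl⟩ := Int.eq_ofNat_of_zero_le hk
    rw [hComplete_natCast, hComplete_natCast]
    exact Finset.sum_le_sum fun s _ => Finset.prod_le_prod (fun i _ => pow_nonneg (hx i) _)
      fun i _ => pow_le_pow_left₀ (hx i) (hxy i) _

lemma continuous_hComplete {n : ℕ} (k : ℤ) : Continuous fun x : Fin n → ℝ => hComplete x k := by
  unfold hComplete
  split_ifs
  · exact MvPolynomial.continuous_eval _
  · exact continuous_const

open PowerSeries in
/-- The generating function of the `h_k` as a formal product of geometric series. -/
lemma mk_hComplete_eq_prod {n : ℕ} (x : Fin n → ℝ) :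
    PowerSeries.mk (fun k : ℕ => hComplete x k) = ∏ i, PowerSeries.mk fun k : ℕ => x i ^ k := by
  ext k
  rw [PowerSeries.coeff_mk, PowerSeries.coeff_prod, hComplete_natCast]
  refine Finset.sum_bij' (fun s _ => Multiset.toFinsupp (s : Multiset (Fin n)))
    (fun l hl => ⟨Finsupp.toMultiset l, by
      simpa [Finsupp.card_toMultiset, Finset.mem_finsuppAntidiag, Finsupp.sum_fintype] using hl⟩)
    ?_ ?_ ?_ ?_ ?_
  · intro s _
    rw [Finset.mem_finsuppAntidiag]
    refine ⟨?_, Finset.subset_univ _⟩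
    change ∑ i, (s : Multiset (Fin n)).count i = k
    rw [Multiset.sum_count_eq_card (by simp)]
    exact s.2
  · exact fun l _ => Finset.mem_univ _
  · intro s _
    ext1
    simp
  · intro l _
    simp
  · intro s _
    simp

lemma mk_pow_mul {R : Type*} [CommRing R] (a : R) :
    PowerSeries.mk (fun k : ℕ => a ^ k) * (1 - PowerSeries.C a * PowerSeries.X) = 1 := by
  ext k
  rw [mul_sub, mul_one, map_sub, mul_comm (PowerSeries.C a), ← mul_assoc]
  rcases k with _ | k
  · simp
  · rw [PowerSeries.coeff_mul_C, PowerSeries.coeff_succ_mul_X]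
    simp [pow_succ, PowerSeries.coeff_one]

lemma mk_hComplete_mul_prod {n : ℕ} (x : Fin n → ℝ) :
    PowerSeries.mk (fun k : ℕ => hComplete x k) *
      ∏ i, (1 - PowerSeries.C (x i) * PowerSeries.X) = 1 := by
  rw [mk_hComplete_eq_prod, ← Finset.prod_mul_distrib]
  exact Finset.prod_eq_one fun i _ => mk_pow_mul _

lemma hasSum_coeff_mul {f g : PowerSeries ℂ} {u a b : ℂ}
    (hf : HasSum (fun k => PowerSeries.coeff k f * u ^ k) a)
    (hf' : Summable fun k => ‖PowerSeries.coeff k f * u ^ k‖)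
    (hg : HasSum (fun k => PowerSeries.coeff k g * u ^ k) b)
    (hg' : Summable fun k => ‖PowerSeries.coeff k g * u ^ k‖) :
    HasSum (fun k => PowerSeries.coeff k (f * g) * u ^ k) (a * b) ∧
      Summable fun k => ‖PowerSeries.coeff k (f * g) * u ^ k‖ := by
  have h : ∀ k, PowerSeries.coeff k (f * g) * u ^ k = ∑ p ∈ Finset.HasAntidiagonal.antidiagonal k,
      (PowerSeries.coeff p.1 f * u ^ p.1) * (PowerSeries.coeff p.2 g * u ^ p.2) := fun k => by
    rw [PowerSeries.coeff_mul, Finset.sum_mul]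
    refine Finset.sum_congr rfl fun p hp => ?_
    rw [← Finset.HasAntidiagonal.mem_antidiagonal.1 hp, pow_add]
    ring
  simp only [h]
  have hs := summable_norm_sum_mul_antidiagonal_of_summable_norm hf' hg'
  refine ⟨?_, hs⟩
  rw [← hf.tsum_eq, ← hg.tsum_eq, tsum_mul_tsum_eq_tsum_sum_antidiagonal_of_summable_norm hf' hg']
  exact hs.of_norm.hasSum

/-- The generating function of the complete homogeneous symmetric functions. -/
lemma hasSum_hComplete {n : ℕ} (x : Fin n → ℝ) {u : ℂ} (hu : ∀ i, ‖u * x i‖ < 1) :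
    HasSum (fun k : ℕ => (hComplete x k : ℂ) * u ^ k) (∏ i, (1 - u * x i)⁻¹) ∧
      Summable fun k : ℕ => ‖(hComplete x k : ℂ) * u ^ k‖ := by
  have key : ∀ s : Finset (Fin n),
      HasSum (fun k => PowerSeries.coeff k (∏ i ∈ s, PowerSeries.mk fun k : ℕ => (x i : ℂ) ^ k) *
        u ^ k) (∏ i ∈ s, (1 - u * x i)⁻¹) ∧
      Summable fun k => ‖PowerSeries.coeff k (∏ i ∈ s, PowerSeries.mk fun k : ℕ => (x i : ℂ) ^ k) *
        u ^ k‖ := by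
    intro s
    induction s using Finset.induction_on with
    | empty =>
      have h : ∀ k : ℕ, PowerSeries.coeff k (1 : PowerSeries ℂ) * u ^ k = if k = 0 then 1 else 0 :=
        fun k => by rcases k with _ | k <;> simp [PowerSeries.coeff_one]
      simp only [Finset.prod_empty, h]
      refine ⟨by simpa using hasSum_ite_eq 0 (1 : ℂ), ?_⟩
      refine summable_of_ne_finset_zero (s := {0}) fun k hk => ?_
      rw [Finset.mem_singleton] at hk
      simp [hk]
    | insert i s hi ih =>
      simp only [Finset.prod_insert hi]
      have h : ∀ k : ℕ, PowerSeries.coeff k (PowerSeries.mk fun k : ℕ => (x i : ℂ) ^ k) * u ^ k =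
          (u * x i) ^ k := fun k => by rw [PowerSeries.coeff_mk, mul_pow, mul_comm]
      refine hasSum_coeff_mul ?_ ?_ ih.1 ih.2
      · simpa only [h] using hasSum_geometric_of_norm_lt_one (hu i)
      · simp only [h, norm_pow]
        exact summable_geometric_of_lt_one (norm_nonneg _) (hu i)
  have h : ∀ k, PowerSeries.coeff k (∏ i, PowerSeries.mk fun k : ℕ => (x i : ℂ) ^ k) =
      (hComplete x k : ℂ) := fun k => by
    have h1 : (∏ i, PowerSeries.mk fun k : ℕ => (x i : ℂ) ^ k) =
        PowerSeries.map Complex.ofRealHom (PowerSeries.mk fun k : ℕ => hComplete x k) := by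
      rw [mk_hComplete_eq_prod, map_prod]
      refine Finset.prod_congr rfl fun i _ => ?_
      ext k
      simp
    rw [h1, PowerSeries.coeff_map, PowerSeries.coeff_mk]
    rfl
  simpa only [h] using key Finset.univ

/-- The `h_k` grow at most like `ρ ^ k`, uniformly in variables bounded by `r < ρ`. -/
lemma exists_hComplete_le {n : ℕ} {r ρ : ℝ} (hr : 0 ≤ r) (hrρ : r < ρ) :
    ∃ C : ℝ, ∀ (x : Fin n → ℝ), (∀ i, 0 ≤ x i ∧ x i ≤ r) → ∀ k : ℤ, hComplete x k ≤ C * ρ ^ k := by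
  have hρ : 0 < ρ := hr.trans_lt hrρ
  have hs := (hasSum_hComplete (fun _ : Fin n => r) (u := ((ρ⁻¹ : ℝ) : ℂ)) fun i => by
    rw [← Complex.ofReal_mul, Complex.norm_real, Real.norm_of_nonneg (by positivity),
      inv_mul_lt_one₀ hρ]
    exact hrρ).2
  obtain ⟨C, hC⟩ := hs.tendsto_atTop_zero.bddAbove_range
  refine ⟨C, fun x hx k => ?_⟩
  have hC0 : 0 ≤ C := (norm_nonneg _).trans (hC ⟨0, rfl⟩)
  rcases lt_or_ge k 0 with hk | hk
  · rw [hComplete_of_neg x hk]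
    positivity
  · obtain ⟨m, rfl⟩ := Int.eq_ofNat_of_zero_le hk
    have h1 : hComplete (fun _ : Fin n => r) m * ρ⁻¹ ^ m ≤ C := by
      refine le_trans (le_of_eq ?_) (hC ⟨m, rfl⟩)
      simp only [norm_mul, Complex.norm_real, norm_pow]
      rw [Real.norm_of_nonneg (hComplete_nonneg (fun _ => hr) _),
        Real.norm_of_nonneg (inv_nonneg.2 hρ.le)]
    refine (hComplete_mono (fun i => (hx i).1) (fun i => (hx i).2) _).trans ?_
    rw [inv_pow, ← div_eq_mul_inv, div_le_iff₀ (by positivity)] at h1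
    exact_mod_cast h1

/-! ### Jacobi–Trudi determinants -/

/-- The Jacobi–Trudi determinant `det (h_{l_i - m_j})`. -/
noncomputable def jtDet {n N : ℕ} (y : Fin n → ℝ) (l m : Fin N → ℕ) : ℝ :=
  Matrix.det (Matrix.of fun i j => hComplete y ((l i : ℤ) - (m j : ℤ)))

/-- The positions `lam_i - i + N` (with `i` counted from `1`) of the first `N` parts. -/
def shiftedParts (N : ℕ) (lam : YoungDiagram) (i : Fin N) : ℕ := lam.rowLen i + (N - 1 - i)

lemma shiftedParts_cast {N : ℕ} (lam : YoungDiagram) (i : Fin N) :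
    (shiftedParts N lam i : ℤ) = lam.rowLen i + N - 1 - i := by
  have := i.2
  simp only [shiftedParts]
  omega

lemma rowLen_eq_zero {lam : YoungDiagram} {i : ℕ} (h : lam.colLen 0 ≤ i) : lam.rowLen i = 0 := by
  by_contra hne
  have : (i, 0) ∈ lam := YoungDiagram.mem_iff_lt_rowLen.2 (Nat.pos_of_ne_zero hne)
  exact absurd (YoungDiagram.mem_iff_lt_colLen.1 this) (not_lt.2 h)

lemma rowLen_pos {lam : YoungDiagram} {i : ℕ} (h : i < lam.colLen 0) : 0 < lam.rowLen i :=
  YoungDiagram.mem_iff_lt_rowLen.1 (YoungDiagram.mem_iff_lt_colLen.2 h)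

lemma rowLen_le_of_le {lam mu : YoungDiagram} (h : mu ≤ lam) (i : ℕ) :
    mu.rowLen i ≤ lam.rowLen i := by
  by_contra! hlt
  have := h (YoungDiagram.mem_iff_lt_rowLen.2 hlt)
  exact lt_irrefl _ (YoungDiagram.mem_iff_lt_rowLen.1 this)

lemma le_of_rowLen_le {lam mu : YoungDiagram} (h : ∀ i, mu.rowLen i ≤ lam.rowLen i) : mu ≤ lam := by
  rintro ⟨i, j⟩ hc
  exact YoungDiagram.mem_iff_lt_rowLen.2 ((YoungDiagram.mem_iff_lt_rowLen.1 hc).trans_le (h i))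

lemma rowLen_bot (i : ℕ) : (⊥ : YoungDiagram).rowLen i = 0 := by
  by_contra hne
  exact YoungDiagram.notMem_bot _ (YoungDiagram.mem_iff_lt_rowLen.2 (Nat.pos_of_ne_zero hne))

/-- The determinant defining a skew Schur function does not change when the size of the matrix
is increased beyond the length of the outer partition. -/
lemma jtDet_shiftedParts {n N : ℕ} (y : Fin n → ℝ) {lam mu : YoungDiagram} (h : mu ≤ lam)
    (hN : lam.colLen 0 ≤ N) :
    jtDet y (shiftedParts N lam) (shiftedParts N mu) = skewSchur lam mu y := by
  have hform : ∀ M, jtDet y (shiftedParts M lam) (shiftedParts M mu) =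
      Matrix.det (Matrix.of fun i j : Fin M =>
        hComplete y ((lam.rowLen i : ℤ) - (mu.rowLen j : ℤ) - (i : ℤ) + (j : ℤ))) := fun M => by
    unfold jtDet
    congr 2
    funext i j
    rw [shiftedParts_cast, shiftedParts_cast]
    congr 1
    ring
  rw [hform, skewSchur]
  induction N, hN using Nat.le_induction with
  | base => rfl
  | succ M hM ih =>
    rw [← ih, Matrix.det_succ_row _ (Fin.last M), Finset.sum_eq_single (Fin.last M)]
    · have h0 := rowLen_eq_zero hM
      have h1 : mu.rowLen M = 0 := Nat.le_zero.1 (h0 ▸ rowLen_le_of_le h M)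
      simp only [Matrix.of_apply, Fin.val_last, h0, h1, Fin.succAbove_last]
      rw [Even.neg_one_pow ⟨M, rfl⟩]
      simp only [Nat.cast_zero, sub_self, zero_sub, neg_add_cancel, hComplete_zero, one_mul]
      rfl
    · intro j _ hj
      have h0 := rowLen_eq_zero hM
      have hjM : (j : ℕ) < M := by
        have := j.2
        have := Fin.val_ne_of_ne hj
        simp only [Fin.val_last] at this
        omega
      rw [Matrix.of_apply, hComplete_of_neg, mul_zero, zero_mul]
      simp only [Fin.val_last, h0]
      omega
    · simp

lemma jtDet_eq_zero_of_not_le {n N : ℕ} (y : Fin n → ℝ) {lam mu : YoungDiagram} (h : ¬ mu ≤ lam)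
    (hN : mu.colLen 0 ≤ N) : jtDet y (shiftedParts N lam) (shiftedParts N mu) = 0 := by
  obtain ⟨k, hk⟩ : ∃ k, lam.rowLen k < mu.rowLen k := by
    by_contra! hcon
    exact h (le_of_rowLen_le hcon)
  have hkN : k < N := by
    by_contra! hcon
    rw [rowLen_eq_zero (hN.trans hcon)] at hk
    exact Nat.not_lt_zero _ hk
  rw [jtDet, Matrix.det_apply]
  refine Finset.sum_eq_zero fun σ _ => ?_
  -- a permutation cannot map the first `k + 1` indices into the first `k`
  obtain ⟨j, hj, hσ⟩ : ∃ j : Fin N, (j : ℕ) ≤ k ∧ k ≤ (σ j : ℕ) := by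
    by_contra! hcon
    have hc : (Finset.Iic (⟨k, hkN⟩ : Fin N)).card ≤ (Finset.Iio (⟨k, hkN⟩ : Fin N)).card :=
      Finset.card_le_card_of_injOn σ (fun j hj => by
        simp only [Finset.coe_Iic, Set.mem_Iic, Fin.le_def] at hj
        simp only [Finset.coe_Iio, Set.mem_Iio, Fin.lt_def]
        exact hcon j hj) σ.injective.injOn
    simp at hc
  rw [Finset.prod_eq_zero (Finset.mem_univ j), smul_zero]
  rw [Matrix.of_apply, hComplete_of_neg]
  rw [shiftedParts_cast, shiftedParts_cast]
  have h1 := lam.rowLen_anti _ _ hσ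
  have h2 := mu.rowLen_anti _ _ hj
  omega

lemma sum_coeff_mul_hComplete {n L : ℕ} (x : Fin n → ℝ) {q : Polynomial ℝ} (hq : q.natDegree < L)
    (m : ℕ) : PowerSeries.coeff m ((q : PowerSeries ℝ) * PowerSeries.mk fun k : ℕ => hComplete x k) =
      ∑ k ∈ Finset.range L, q.coeff k * hComplete x ((m : ℤ) - k) := by
  rw [PowerSeries.coeff_mul, Finset.Nat.sum_antidiagonal_eq_sum_range_succ
    (fun i j => PowerSeries.coeff i (q : PowerSeries ℝ) *
      PowerSeries.coeff j (PowerSeries.mk fun k : ℕ => hComplete x k))]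
  have hz1 : ∀ k, k ∉ Finset.range L → q.coeff k = 0 := fun k hk => by
    apply Polynomial.coeff_eq_zero_of_natDegree_lt
    simp only [Finset.mem_range] at hk
    omega
  have hz2 : ∀ k, k ∉ Finset.range (m + 1) → hComplete x ((m : ℤ) - k) = 0 := fun k hk => by
    apply hComplete_of_neg
    simp only [Finset.mem_range] at hk
    omega
  trans ∑ k ∈ Finset.range (max L (m + 1)), q.coeff k * hComplete x ((m : ℤ) - k)
  · refine (Finset.sum_congr rfl fun k hk => ?_).trans
      (Finset.sum_subset (Finset.range_mono (le_max_right L (m + 1))) fun k _ hk => by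
        rw [hz2 k hk, mul_zero])
    rw [PowerSeries.coeff_mk, Polynomial.coeff_coe]
    simp only [Finset.mem_range] at hk
    congr 2
    omega
  · symm
    refine Finset.sum_subset (Finset.range_mono (le_max_left _ _)) fun k _ hk => ?_
    rw [hz1 k hk, zero_mul]

lemma coe_prod_one_sub {ι : Type*} (s : Finset ι) (x : ι → ℝ) :
    ((∏ i ∈ s, (1 - Polynomial.C (x i) * Polynomial.X) : Polynomial ℝ) : PowerSeries ℝ) =
      ∏ i ∈ s, (1 - PowerSeries.C (x i) * PowerSeries.X) := by
  rw [← Polynomial.coeToPowerSeries.ringHom_apply, map_prod]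
  simp

lemma natDegree_prod_one_sub_le {ι : Type*} (s : Finset ι) (x : ι → ℝ) :
    (∏ i ∈ s, (1 - Polynomial.C (x i) * Polynomial.X) : Polynomial ℝ).natDegree ≤ s.card := by
  refine (Polynomial.natDegree_prod_le _ _).trans ((Finset.sum_le_sum fun i _ =>
    (?_ : _ ≤ 1)).trans (by simp))
  refine (Polynomial.natDegree_sub_le _ _).trans (max_le (by simp) ?_)
  exact (Polynomial.natDegree_C_mul_le _ _).trans Polynomial.natDegree_X_le

/-- The Schur function of a partition with more parts than variables vanishes: the last
columns of the Jacobi–Trudi matrix satisfy the recursion of the `h_k`. -/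
lemma schur_eq_zero {n : ℕ} (x : Fin n → ℝ) {lam : YoungDiagram} (h : n < lam.colLen 0) :
    schur lam x = 0 := by
  set L := lam.colLen 0 with hL
  set p : Polynomial ℝ := ∏ i, (1 - Polynomial.C (x i) * Polynomial.X) with hp
  have hdeg : p.natDegree < L :=
    (natDegree_prod_one_sub_le _ _).trans_lt (by simpa using h)
  have hrec : ∀ m : ℤ, 0 < m →
      ∑ k ∈ Finset.range L, p.coeff k * hComplete x (m - k) = 0 := by
    intro m hm
    obtain ⟨m, rfl⟩ := Int.eq_ofNat_of_zero_le hm.le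
    rw [← sum_coeff_mul_hComplete x hdeg, hp, coe_prod_one_sub, mul_comm, mk_hComplete_mul_prod,
      PowerSeries.coeff_one, if_neg (by omega)]
  rw [schur, skewSchur, ← hL, ← Matrix.exists_mulVec_eq_zero_iff]
  refine ⟨fun j => p.coeff (L - 1 - j), fun h0 => ?_, ?_⟩
  · have := congrFun h0 ⟨L - 1, by omega⟩
    have hE0 : p.coeff 0 = 1 := by
      rw [hp, Polynomial.coeff_zero_eq_eval_zero, Polynomial.eval_prod]
      simp
    simp [hE0] at this
  · funext i
    have hpos := rowLen_pos (lam := lam) (i := i) i.2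
    have h1 := hrec (lam.rowLen i - i + (L - 1 : ℕ)) (by have := i.2; omega)
    rw [Pi.zero_apply, ← h1, Matrix.mulVec, dotProduct, Finset.sum_range,
      ← Equiv.sum_comp Fin.revPerm]
    refine Finset.sum_congr rfl fun j _ => ?_
    simp only [Matrix.of_apply, Fin.revPerm_apply, Fin.val_rev, rowLen_bot]
    have := j.2
    rw [mul_comm]
    congr 2
    · omega
    · push_cast
      omega


/-! ### Alternants -/

/-- The alternant `det (x_i ^ l_j)`. -/
noncomputable def alternant {R : Type*} [CommRing R] {n : ℕ} (x : Fin n → R) (l : Fin n → ℕ) : R :=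
  Matrix.det (Matrix.of fun i j => x i ^ l j)

/-- The factorisation of the alternant matrix through the matrix of the `h_k`: apart from `x i`
itself, the variables are removed from `∑ h_k u ^ k` by multiplication with `1 - x_j u`. -/
lemma pow_eq_sum_hComplete {n : ℕ} (x : Fin n → ℝ) (i : Fin n) (m : ℕ) :
    x i ^ m = ∑ r : Fin n, (∏ j ∈ Finset.univ.erase i,
      (1 - Polynomial.C (x j) * Polynomial.X) : Polynomial ℝ).coeff r *
        hComplete x ((m : ℤ) - (r : ℕ)) := by
  have hdeg := natDegree_prod_one_sub_le (Finset.univ.erase i) x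
  rw [Finset.card_erase_of_mem (Finset.mem_univ i), Finset.card_univ, Fintype.card_fin] at hdeg
  rw [← Finset.sum_range fun r => (∏ j ∈ Finset.univ.erase i,
      (1 - Polynomial.C (x j) * Polynomial.X) : Polynomial ℝ).coeff r *
        hComplete x ((m : ℤ) - r),
    ← sum_coeff_mul_hComplete x (lt_of_le_of_lt hdeg (by have := i.2; omega)), coe_prod_one_sub]
  have h1 := mk_hComplete_mul_prod x
  rw [← Finset.mul_prod_erase _ _ (Finset.mem_univ i)] at h1
  have h2 := mk_pow_mul (x i)
  set P := ∏ j ∈ Finset.univ.erase i, (1 - PowerSeries.C (x j) * PowerSeries.X)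
  set H := PowerSeries.mk fun k : ℕ => hComplete x k
  have h3 : P * H = PowerSeries.mk fun k : ℕ => x i ^ k := by
    linear_combination -(P * H) * h2 + (PowerSeries.mk fun k : ℕ => x i ^ k) * h1
  rw [h3, PowerSeries.coeff_mk]

lemma shiftedParts_bot {n : ℕ} (j : Fin n) : shiftedParts n ⊥ j = n - 1 - j := by
  simp [shiftedParts, rowLen_bot]

/-- The bialternant formula for Schur functions. -/
lemma alternant_shiftedParts {n : ℕ} (x : Fin n → ℝ) {lam : YoungDiagram} (h : lam.colLen 0 ≤ n) :
    alternant x (shiftedParts n lam) = alternant x (shiftedParts n ⊥) * schur lam x := by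
  set E : Matrix (Fin n) (Fin n) ℝ := Matrix.of fun i r => (∏ j ∈ Finset.univ.erase i,
      (1 - Polynomial.C (x j) * Polynomial.X) : Polynomial ℝ).coeff (n - 1 - r) with hE
  have key : ∀ l : Fin n → ℕ, alternant x l = E.det * jtDet x l (shiftedParts n ⊥) := by
    intro l
    rw [alternant, jtDet, ← Matrix.det_transpose (Matrix.of fun i j => hComplete x _),
      ← Matrix.det_mul]
    congr 1
    ext i j
    rw [Matrix.of_apply, pow_eq_sum_hComplete, Matrix.mul_apply, ← Equiv.sum_comp Fin.revPerm]
    refine Finset.sum_congr rfl fun r _ => ?_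
    simp only [hE, Matrix.of_apply, Matrix.transpose_apply, shiftedParts_bot, Fin.revPerm_apply,
      Fin.val_rev]
    have := r.2
    congr 2
    · omega
    · congr 2
      omega
  have hbot : (⊥ : YoungDiagram).colLen 0 = 0 := by
    by_contra hne
    exact YoungDiagram.notMem_bot _ (YoungDiagram.mem_iff_lt_colLen.2 (Nat.pos_of_ne_zero hne))
  have h1 : jtDet x (shiftedParts n ⊥) (shiftedParts n ⊥) = 1 := by
    rw [jtDet_shiftedParts x le_rfl (by omega), skewSchur]
    have : IsEmpty (Fin ((⊥ : YoungDiagram).colLen 0)) := by rw [hbot]; infer_instance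
    exact Matrix.det_isEmpty
  rw [key, key (shiftedParts n ⊥), h1, mul_one, jtDet_shiftedParts x bot_le h, schur]

lemma alternant_bot {R : Type*} [CommRing R] {n : ℕ} (x : Fin n → R) :
    alternant x (shiftedParts n ⊥) = ∏ i, ∏ j ∈ Finset.Ioi i, (x i - x j) := by
  have h1 : alternant x (shiftedParts n ⊥) = (Matrix.vandermonde fun i => x (Fin.rev i)).det := by
    rw [alternant, ← Matrix.det_submatrix_equiv_self Fin.revPerm]
    congr 1
    ext i j
    simp only [Matrix.submatrix_apply, Matrix.of_apply, Matrix.vandermonde_apply,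
      Fin.revPerm_apply, shiftedParts_bot, Fin.val_rev]
    congr 1
    have := j.2
    omega
  rw [h1, Matrix.det_vandermonde, ← Equiv.prod_comp Fin.revPerm]
  have h2 : ∀ b : Fin n, ∏ j ∈ Finset.Ioi (Fin.revPerm b), (x (Fin.rev j) - x (Fin.rev (Fin.revPerm b))) =
      ∏ a ∈ Finset.Iio b, (x a - x b) := fun b => by
    refine Finset.prod_bij' (fun j _ => Fin.rev j) (fun a _ => Fin.rev a) ?_ ?_ ?_ ?_ ?_
    · intro j hj
      simp only [Fin.revPerm_apply, Finset.mem_Ioi, Finset.mem_Iio] at hj ⊢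
      rwa [← Fin.rev_lt_rev, Fin.rev_rev]
    · intro a ha
      simpa using ha
    all_goals simp
  simp only [h2]
  exact Finset.prod_comm' (by simp)

/-! ### Partitions and strictly decreasing sequences -/

lemma shiftedParts_strictAnti {N : ℕ} (lam : YoungDiagram) : StrictAnti (shiftedParts N lam) := by
  intro i j hij
  have h := lam.rowLen_anti i j (Fin.le_def.1 hij.le)
  have h1 := shiftedParts_cast lam i
  have h2 := shiftedParts_cast lam j
  have h3 := Fin.lt_def.1 hij
  omega

/-- The Young diagram whose row lengths are given by an antitone function. -/
def ofAntitone {N : ℕ} (f : Fin N → ℕ) (hf : Antitone f) : YoungDiagram where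
  cells := Finset.univ.biUnion fun i : Fin N => {(i : ℕ)} ×ˢ Finset.range (f i)
  isLowerSet := by
    rintro ⟨i, j⟩ ⟨i', j'⟩ hle h
    simp only [Finset.mem_coe, Finset.mem_biUnion, Finset.mem_univ, true_and, Finset.mem_product,
      Finset.mem_singleton, Finset.mem_range] at h ⊢
    obtain ⟨a, rfl, hb⟩ := h
    obtain ⟨h1, h2⟩ := Prod.mk_le_mk.1 hle
    exact ⟨⟨i', h1.trans_lt a.2⟩, rfl, h2.trans_lt (hb.trans_le (hf (Fin.le_def.2 h1)))⟩

lemma mem_ofAntitone {N : ℕ} {f : Fin N → ℕ} {hf : Antitone f} {i j : ℕ} :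
    (i, j) ∈ ofAntitone f hf ↔ ∃ a : Fin N, i = a ∧ j < f a := by
  rw [← YoungDiagram.mem_cells]
  simp only [ofAntitone, Finset.mem_biUnion, Finset.mem_univ, true_and, Finset.mem_product,
    Finset.mem_singleton, Finset.mem_range]

lemma rowLen_ofAntitone {N : ℕ} (f : Fin N → ℕ) (hf : Antitone f) (i : Fin N) :
    (ofAntitone f hf).rowLen i = f i := by
  have : ∀ j, j < (ofAntitone f hf).rowLen i ↔ j < f i := fun j => by
    rw [← YoungDiagram.mem_iff_lt_rowLen, mem_ofAntitone]
    constructor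
    · rintro ⟨a, ha, hb⟩
      rwa [Fin.ext ha]
    · exact fun h => ⟨i, rfl, h⟩
  exact le_antisymm (not_lt.1 fun h => lt_irrefl _ ((this _).1 h))
    (not_lt.1 fun h => lt_irrefl _ ((this _).2 h))

lemma colLen_ofAntitone_le {N : ℕ} (f : Fin N → ℕ) (hf : Antitone f) :
    (ofAntitone f hf).colLen 0 ≤ N := by
  by_contra! h
  obtain ⟨a, ha, -⟩ := mem_ofAntitone.1 (YoungDiagram.mem_iff_lt_colLen.2 h)
  exact absurd ha a.2.ne'

lemma exists_shiftedParts_eq {N : ℕ} {l : Fin N → ℕ} (hl : StrictAnti l) :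
    ∃ lam : YoungDiagram, lam.colLen 0 ≤ N ∧ shiftedParts N lam = l := by
  have hge : ∀ m : ℕ, ∀ i : Fin N, N - 1 - i = m → m ≤ l i := by
    intro m
    induction m with
    | zero => simp
    | succ m ih =>
      intro i hi
      have hi' : (i : ℕ) + 1 < N := by omega
      have h1 := ih ⟨i + 1, hi'⟩ (by simp only; omega)
      have h2 : l ⟨i + 1, hi'⟩ < l i := hl (Fin.lt_def.2 (by simp))
      omega
  have hanti : Antitone fun i : Fin N => l i - (N - 1 - i) := by
    have hstep : ∀ m : ℕ, ∀ i j : Fin N, (j : ℕ) = i + m → l j + m ≤ l i := by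
      intro m
      induction m with
      | zero =>
        intro i j h
        rw [Fin.ext (h : (j : ℕ) = i), add_zero]
      | succ m ih =>
        intro i j h
        have hj := j.2
        have h1 := ih i ⟨i + m, by omega⟩ rfl
        have h2 : l j < l ⟨i + m, by omega⟩ := hl (Fin.lt_def.2 (by simp only; omega))
        omega
    intro i j hij
    have h1 := Fin.le_def.1 hij
    have h2 := hstep (j - i) i j (by omega)
    have := j.2
    simp only
    omega
  refine ⟨ofAntitone _ hanti, colLen_ofAntitone_le _ _, funext fun i => ?_⟩
  rw [shiftedParts, rowLen_ofAntitone]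
  have := hge _ i rfl
  omega

lemma shiftedParts_inj {N : ℕ} {lam mu : YoungDiagram} (hl : lam.colLen 0 ≤ N)
    (hm : mu.colLen 0 ≤ N) (h : shiftedParts N lam = shiftedParts N mu) : lam = mu := by
  have : ∀ i, lam.rowLen i = mu.rowLen i := fun i => by
    rcases lt_or_ge i N with hi | hi
    · have := congrFun h ⟨i, hi⟩
      simp only [shiftedParts] at this
      omega
    · rw [rowLen_eq_zero (hl.trans hi), rowLen_eq_zero (hm.trans hi)]
  exact le_antisymm (le_of_rowLen_le fun i => (this i).le) (le_of_rowLen_le fun i => (this i).ge)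

/-- Partitions with at most `N` parts are the same as strictly decreasing sequences of length
`N`. -/
noncomputable def partsEquiv (N : ℕ) :
    {lam : YoungDiagram // lam.colLen 0 ≤ N} ≃ {l : Fin N → ℕ // StrictAnti l} :=
  Equiv.ofBijective (fun lam => ⟨shiftedParts N lam.1, shiftedParts_strictAnti lam.1⟩)
    ⟨fun a b h => Subtype.ext (shiftedParts_inj a.2 b.2 (Subtype.ext_iff.1 h)), fun l => by
      obtain ⟨lam, h1, h2⟩ := exists_shiftedParts_eq l.2
      exact ⟨⟨lam, h1⟩, Subtype.ext h2⟩⟩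

/-- The columns of a partition are even if and only if its rows come in equal pairs. -/
lemma isEven_transpose_iff {mu : YoungDiagram} :
    IsEven mu.transpose ↔ ∀ r, mu.rowLen (2 * r) = mu.rowLen (2 * r + 1) := by
  simp only [IsEven, YoungDiagram.rowLen_transpose]
  constructor
  · intro h r
    refine le_antisymm ?_ (mu.rowLen_anti _ _ (by omega))
    by_contra! hlt
    have h1 := YoungDiagram.mem_iff_lt_colLen.1 (YoungDiagram.mem_iff_lt_rowLen.2 hlt)
    have h2 : ¬ 2 * r + 1 < mu.colLen (mu.rowLen (2 * r + 1)) := fun h2 =>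
      lt_irrefl _ (YoungDiagram.mem_iff_lt_rowLen.1 (YoungDiagram.mem_iff_lt_colLen.2 h2))
    obtain ⟨c, hc⟩ := h (mu.rowLen (2 * r + 1))
    omega
  · intro h j
    by_contra hodd
    obtain ⟨r, hr⟩ := Nat.not_even_iff_odd.1 hodd
    have h1 : j < mu.rowLen (2 * r) :=
      YoungDiagram.mem_iff_lt_rowLen.1 (YoungDiagram.mem_iff_lt_colLen.2 (by omega))
    rw [h r] at h1
    have := YoungDiagram.mem_iff_lt_colLen.1 (YoungDiagram.mem_iff_lt_rowLen.2 h1)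
    omega

/-- Injective sequences are permutations of strictly decreasing ones. -/
noncomputable def injectiveEquiv (n : ℕ) :
    {l : Fin n → ℕ // StrictAnti l} × Equiv.Perm (Fin n) ≃ {l : Fin n → ℕ // Function.Injective l} :=
  Equiv.ofBijective (fun p => ⟨fun i => p.1.1 (p.2 i), p.1.2.injective.comp p.2.injective⟩) <| by
    constructor
    · rintro ⟨⟨l, hl⟩, σ⟩ ⟨⟨l', hl'⟩, σ'⟩ h
      have h' : (fun i => l (σ i)) = fun i => l' (σ' i) := Subtype.ext_iff.1 h
      have hrange : Set.range (fun i => l (Fin.rev i)) = Set.range (fun i => l' (Fin.rev i)) := by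
        have e1 : Set.range (fun i => l (Fin.rev i)) = Set.range fun i => l (σ i) := by
          rw [← Function.comp_def l, ← Function.comp_def l, Fin.rev_surjective.range_comp,
            σ.surjective.range_comp]
        have e2 : Set.range (fun i => l' (Fin.rev i)) = Set.range fun i => l' (σ' i) := by
          rw [← Function.comp_def l', ← Function.comp_def l', Fin.rev_surjective.range_comp,
            σ'.surjective.range_comp]
        rw [e1, e2, h']
      have hm : StrictMono fun i => l (Fin.rev i) := fun i j hij => hl (Fin.rev_lt_rev.2 hij)
      have hm' : StrictMono fun i => l' (Fin.rev i) := fun i j hij => hl' (Fin.rev_lt_rev.2 hij)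
      have hll : l = l' := by
        have := (StrictMono.range_inj hm hm').1 hrange
        funext i
        simpa using congrFun this (Fin.rev i)
      subst hll
      have : σ = σ' := Equiv.ext fun i => hl.injective (congrFun h' i)
      rw [this]
    · rintro ⟨l, hl⟩
      have hmono : StrictMono (l ∘ Tuple.sort l) :=
        (Tuple.monotone_sort l).strictMono_of_injective (hl.comp (Equiv.injective _))
      refine ⟨⟨⟨fun i => l (Tuple.sort l (Fin.rev i)), fun i j hij =>
        hmono (Fin.rev_lt_rev.2 hij)⟩, (Fin.revPerm.trans (Tuple.sort l)).symm⟩, Subtype.ext ?_⟩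
      funext i
      simp

/-- A sum over all sequences of a function which vanishes at the sequences with repetitions. -/
lemma tsum_eq_tsum_strictAnti {E : Type*} [NormedAddCommGroup E] [CompleteSpace E] {n : ℕ}
    {f : (Fin n → ℕ) → E} (hf : Summable f) (h0 : ∀ l, ¬ Function.Injective l → f l = 0) :
    ∑' l, f l = ∑' l : {l : Fin n → ℕ // StrictAnti l}, ∑ σ : Equiv.Perm (Fin n),
      f fun i => l.1 (σ i) := by
  have h1 : ∑' l, f l = ∑' l : {l : Fin n → ℕ // Function.Injective l}, f l :=
    (tsum_subtype_eq_of_support_subset (s := {l | Function.Injective l}) fun l hl => by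
      by_contra hcon
      exact hl (h0 l hcon)).symm
  have h2 : Summable fun p : {l : Fin n → ℕ // StrictAnti l} × Equiv.Perm (Fin n) =>
      f fun i => p.1.1 (p.2 i) :=
    hf.comp_injective (i := fun p : {l : Fin n → ℕ // StrictAnti l} × Equiv.Perm (Fin n) =>
      (fun i => p.1.1 (p.2 i) : Fin n → ℕ))
      (Subtype.val_injective.comp (injectiveEquiv n).injective)
  rw [h1, ← (injectiveEquiv n).tsum_eq]
  refine (h2.tsum_prod).trans ?_
  exact tsum_congr fun l => tsum_fintype _


/-! ### Multiple series -/

lemma summable_norm_pi_prod : ∀ {n : ℕ} {f : Fin n → ℕ → ℂ}, (∀ i, Summable fun k => ‖f i k‖) →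
    Summable fun l : Fin n → ℕ => ‖∏ i, f i (l i)‖
  | 0, f, _ => (hasSum_fintype _).summable
  | n + 1, f, hf => by
    rw [← (Fin.consEquiv fun _ : Fin (n + 1) => ℕ).summable_iff]
    have ih := summable_norm_pi_prod fun i : Fin n => hf i.succ
    refine ((hf 0).mul_norm ih).congr fun p => ?_
    simp [Fin.prod_univ_succ, Fin.consEquiv]

lemma hasSum_pi_prod : ∀ {n : ℕ} {f : Fin n → ℕ → ℂ}, (∀ i, Summable fun k => ‖f i k‖) →
    HasSum (fun l : Fin n → ℕ => ∏ i, f i (l i)) (∏ i, ∑' k, f i k)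
  | 0, f, _ => by simp
  | n + 1, f, hf => by
    rw [← (Fin.consEquiv fun _ : Fin (n + 1) => ℕ).hasSum_iff]
    have ih := hasSum_pi_prod fun i : Fin n => hf i.succ
    have h := summable_norm_pi_prod fun i : Fin n => hf i.succ
    rw [Fin.prod_univ_succ, ← ih.tsum_eq, tsum_mul_tsum_of_summable_norm (hf 0) h]
    refine (summable_mul_of_summable_norm (hf 0) h).hasSum.congr_fun fun p => ?_
    simp [Fin.prod_univ_succ, Fin.consEquiv]

/-! ### The coefficients of the generating function -/

/-- The sequence `k_1 + 1, k_1, k_2 + 1, k_2, …`.  Its strictly decreasing instances are the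
sequences `mu_i - i + 2e` of the partitions with even transpose. -/
def pairSeq {e : ℕ} (k : Fin e → ℕ) (i : Fin (2 * e)) : ℕ :=
  k ((blockEquiv e).symm i).1 + (1 - ((blockEquiv e).symm i).2)

lemma pairSeq_zero {e : ℕ} (k : Fin e → ℕ) (r : Fin e) :
    pairSeq k (blockEquiv e (r, 0)) = k r + 1 := by simp [pairSeq]

lemma pairSeq_one {e : ℕ} (k : Fin e → ℕ) (r : Fin e) :
    pairSeq k (blockEquiv e (r, 1)) = k r := by simp [pairSeq]

lemma jtDet_perm_left {n N : ℕ} (y : Fin n → ℝ) (l m : Fin N → ℕ) (σ : Equiv.Perm (Fin N)) :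
    jtDet y (fun i => l (σ i)) m = (Equiv.Perm.sign σ : ℤ) * jtDet y l m := by
  rw [jtDet, jtDet]
  exact Matrix.det_permute σ (Matrix.of fun i j => hComplete y ((l i : ℤ) - (m j : ℤ)))

lemma jtDet_perm_right {n N : ℕ} (y : Fin n → ℝ) (l m : Fin N → ℕ) (σ : Equiv.Perm (Fin N)) :
    jtDet y l (fun j => m (σ j)) = (Equiv.Perm.sign σ : ℤ) * jtDet y l m := by
  rw [jtDet, jtDet]
  exact Matrix.det_permute' σ (Matrix.of fun i j => hComplete y ((l i : ℤ) - (m j : ℤ)))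

lemma jtDet_eq_zero_of_not_injective {n N : ℕ} (y : Fin n → ℝ) (l : Fin N → ℕ) {m : Fin N → ℕ}
    (hm : ¬ Function.Injective m) : jtDet y l m = 0 := by
  obtain ⟨i, j, hij, hne⟩ : ∃ i j, m i = m j ∧ i ≠ j := by
    simpa [Function.Injective] using hm
  exact Matrix.det_zero_of_column_eq hne fun k => by simp [hij]

/-- The permutation of `2e` indices induced by a permutation of the blocks. -/
def blockPerm {e : ℕ} (π : Equiv.Perm (Fin e)) : Equiv.Perm (Fin (2 * e)) :=
  (blockEquiv e).permCongr (π.prodCongr (Equiv.refl (Fin 2)))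

lemma sign_blockPerm {e : ℕ} (π : Equiv.Perm (Fin e)) : Equiv.Perm.sign (blockPerm π) = 1 := by
  have h : π.prodCongr (Equiv.refl (Fin 2)) = Equiv.prodCongrLeft fun _ : Fin 2 => π := by
    ext <;> rfl
  rw [blockPerm, Equiv.Perm.sign_permCongr, h, Equiv.Perm.sign_prodCongrLeft]
  simp

lemma pairSeq_perm {e : ℕ} (k : Fin e → ℕ) (π : Equiv.Perm (Fin e)) :
    pairSeq (fun r => k (π r)) = fun i => pairSeq k (blockPerm π i) := by
  funext i
  simp [pairSeq, blockPerm, Equiv.permCongr_apply]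

lemma pairSeq_antitone {e : ℕ} {k : Fin e → ℕ} (hk : StrictAnti k) : Antitone (pairSeq k) := by
  intro i j hij
  obtain ⟨⟨r, a⟩, rfl⟩ := (blockEquiv e).surjective i
  obtain ⟨⟨s, b⟩, rfl⟩ := (blockEquiv e).surjective j
  have h := Fin.le_def.1 hij
  rw [blockEquiv_val, blockEquiv_val] at h
  simp only [pairSeq, Equiv.symm_apply_apply]
  simp only at h
  rcases eq_or_ne r s with rfl | hrs
  · omega
  · have h1 : r < s := by
      rw [Fin.lt_def]
      have := Fin.val_ne_of_ne hrs
      omega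
    have := hk h1
    omega

/-- If some `k r` exceeds all `l i`, a column of the Jacobi–Trudi matrix vanishes. -/
lemma finite_jtDet_pairSeq_ne_zero {n e : ℕ} (y : Fin n → ℝ) (l : Fin (2 * e) → ℕ) :
    (Function.support fun k : Fin e → ℕ => jtDet y l (pairSeq k)).Finite := by
  refine (Set.finite_Iic (fun _ : Fin e => Finset.univ.sup l)).subset fun k hk => ?_
  by_contra hcon
  obtain ⟨r, hr⟩ : ∃ r, Finset.univ.sup l < k r := by
    simpa [Pi.le_def] using hcon
  apply hk
  refine Matrix.det_eq_zero_of_column_eq_zero (blockEquiv e (r, 1)) fun i => ?_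
  rw [Matrix.of_apply, pairSeq_one, hComplete_of_neg]
  have : l i ≤ Finset.univ.sup l := Finset.le_sup (Finset.mem_univ i)
  omega

/-- The coefficients of the generating function for an even number of variables: the sum of the
Jacobi–Trudi determinants over all sets of `e` pairs `k + 1, k`.  The division by `e!` compensates for
the order of the pairs; only finitely many terms are nonzero. -/
noncomputable def evenWeight {n : ℕ} (y : Fin n → ℝ) (e : ℕ) (l : Fin (2 * e) → ℕ) : ℝ :=
  (e.factorial : ℝ)⁻¹ * ∑' k : Fin e → ℕ, jtDet y l (pairSeq k)

lemma evenWeight_perm {n : ℕ} (y : Fin n → ℝ) {e : ℕ} (l : Fin (2 * e) → ℕ)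
    (σ : Equiv.Perm (Fin (2 * e))) :
    evenWeight y e (fun i => l (σ i)) = (Equiv.Perm.sign σ : ℤ) * evenWeight y e l := by
  simp only [evenWeight, jtDet_perm_left, tsum_mul_left]
  ring

/-- Permuting the pairs does not change the determinant, so that each set of values of `k` may be
counted once, in decreasing order. -/
lemma evenWeight_eq_tsum {n : ℕ} (y : Fin n → ℝ) {e : ℕ} (l : Fin (2 * e) → ℕ) :
    evenWeight y e l = ∑' k : {k : Fin e → ℕ // StrictAnti k}, jtDet y l (pairSeq k.1) := by
  rw [evenWeight, tsum_eq_tsum_strictAnti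
    (summable_of_hasFiniteSupport (finite_jtDet_pairSeq_ne_zero y l))]
  · simp only [pairSeq_perm, jtDet_perm_right, sign_blockPerm, Units.val_one, Int.cast_one, one_mul,
      Finset.sum_const, Finset.card_univ, Fintype.card_perm, Fintype.card_fin, nsmul_eq_mul,
      tsum_mul_left]
    rw [inv_mul_cancel_left₀]
    exact_mod_cast e.factorial_ne_zero
  · intro k hk
    refine jtDet_eq_zero_of_not_injective y l fun h => hk fun r s hrs => ?_
    have := @h (blockEquiv e (r, 1)) (blockEquiv e (s, 1)) (by rw [pairSeq_one, pairSeq_one, hrs])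
    simpa using this

lemma colLen_le_of_le {lam mu : YoungDiagram} (h : mu ≤ lam) : mu.colLen 0 ≤ lam.colLen 0 := by
  by_contra! hlt
  exact lt_irrefl _ (YoungDiagram.mem_iff_lt_colLen.1 (h (YoungDiagram.mem_iff_lt_colLen.2 hlt)))

lemma pairSeq_shiftedParts {e : ℕ} {mu : YoungDiagram} (h : IsEven mu.transpose) :
    pairSeq (fun r => shiftedParts (2 * e) mu (blockEquiv e (r, 1))) = shiftedParts (2 * e) mu := by
  funext i
  obtain ⟨⟨r, a⟩, rfl⟩ := (blockEquiv e).surjective i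
  have hr := r.2
  rw [isEven_transpose_iff] at h
  have h1 := shiftedParts_cast mu (blockEquiv e (r, 1))
  have h2 := shiftedParts_cast mu (blockEquiv e (r, 0))
  rw [blockEquiv_val] at h1 h2
  simp only [Fin.val_zero, Fin.val_one, zero_add, add_comm 1] at h1 h2
  rw [h r] at h2
  match a with
  | 0 => rw [pairSeq_zero]; push_cast at h1 h2; omega
  | 1 => rw [pairSeq_one]

/-- The strictly decreasing sequences `pairSeq k` enumerate the partitions with even transpose, and
only those contained in `lam` contribute. -/
lemma evenWeight_shiftedParts {n : ℕ} (y : Fin n → ℝ) {e : ℕ} {lam : YoungDiagram}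
    (h : lam.colLen 0 ≤ 2 * e) : evenWeight y e (shiftedParts (2 * e) lam) = tau lam y := by
  rw [evenWeight_eq_tsum, tau]
  set S := (finite_evenTransposeBelow lam).toFinset with hS
  have hmem : ∀ mu ∈ S, mu ≤ lam ∧ IsEven mu.transpose := fun mu hmu => by simpa [hS] using hmu
  let g : S → {k : Fin e → ℕ // StrictAnti k} := fun mu =>
    ⟨fun r => shiftedParts (2 * e) mu.1 (blockEquiv e (r, 1)), fun r s hrs =>
      shiftedParts_strictAnti mu.1 (Fin.lt_def.2 (by
        rw [blockEquiv_val, blockEquiv_val]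
        have := Fin.lt_def.1 hrs
        simp only
        omega))⟩
  have hg : ∀ mu : S, pairSeq (g mu).1 = shiftedParts (2 * e) mu.1 := fun mu =>
    pairSeq_shiftedParts (hmem _ mu.2).2
  have hginj : Function.Injective g := fun mu nu hmn => by
    have h1 := hg mu
    rw [hmn, hg nu] at h1
    exact Subtype.ext (shiftedParts_inj ((colLen_le_of_le (hmem _ mu.2).1).trans h)
      ((colLen_le_of_le (hmem _ nu.2).1).trans h) h1.symm)
  have hsupp : Function.support (fun k : {k : Fin e → ℕ // StrictAnti k} =>
      jtDet y (shiftedParts (2 * e) lam) (pairSeq k.1)) ⊆ Set.range g := by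
    intro k hk
    have hinj : Function.Injective (pairSeq k.1) := by
      by_contra hcon
      exact hk (jtDet_eq_zero_of_not_injective y _ hcon)
    obtain ⟨mu, hmu, hmuk⟩ := exists_shiftedParts_eq
      ((pairSeq_antitone k.2).strictAnti_of_injective hinj)
    have hle : mu ≤ lam := by
      by_contra hcon
      apply hk
      simp only [← hmuk]
      exact jtDet_eq_zero_of_not_le y hcon hmu
    have heven : IsEven mu.transpose := by
      rw [isEven_transpose_iff]
      intro r
      rcases lt_or_ge r e with hr | hr
      · have h1 := congrFun hmuk (blockEquiv e (⟨r, hr⟩, 0))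
        have h2 := congrFun hmuk (blockEquiv e (⟨r, hr⟩, 1))
        rw [pairSeq_zero] at h1
        rw [pairSeq_one] at h2
        have h3 := shiftedParts_cast mu (blockEquiv e (⟨r, hr⟩, 1))
        have h4 := shiftedParts_cast mu (blockEquiv e (⟨r, hr⟩, 0))
        rw [blockEquiv_val] at h3 h4
        simp only [Fin.val_zero, Fin.val_one, zero_add, add_comm 1] at h3 h4
        push_cast at h3 h4
        omega
      · rw [rowLen_eq_zero (by omega), rowLen_eq_zero (by omega)]
    refine ⟨⟨mu, by simpa [hS] using ⟨hle, heven⟩⟩, Subtype.ext (funext fun r => ?_)⟩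
    change shiftedParts (2 * e) mu (blockEquiv e (r, 1)) = k.1 r
    rw [hmuk, pairSeq_one]
  rw [← hginj.tsum_eq hsupp, tsum_fintype, ← Finset.sum_coe_sort S]
  refine Finset.sum_congr rfl fun mu _ => ?_
  rw [hg, jtDet_shiftedParts y (hmem _ mu.2).1 h]

/-! ### Littlewood's identity -/

lemma hComplete_shift_eq_zero {n : ℕ} (y : Fin n → ℝ) (v : ℂ) (m : ℕ) :
    ∀ a ∉ Set.range (fun k : ℕ => m + k), v ^ a * (hComplete y ((a : ℤ) - m) : ℂ) = 0 := by
  intro a ha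
  have : a < m := by
    by_contra! h
    exact ha ⟨a - m, by simp only; omega⟩
  rw [hComplete_of_neg _ (by omega)]
  simp

lemma hasSum_hComplete_shift {n : ℕ} (y : Fin n → ℝ) {v : ℂ} (hv : ∀ j, ‖v * y j‖ < 1) (m : ℕ) :
    HasSum (fun a : ℕ => v ^ a * (hComplete y ((a : ℤ) - m) : ℂ))
      (v ^ m * ∏ j, (1 - v * y j)⁻¹) := by
  rw [← (add_right_injective m).hasSum_iff (hComplete_shift_eq_zero y v m)]
  refine ((hasSum_hComplete y hv).1.mul_left (v ^ m)).congr_fun fun k => ?_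
  simp only [Function.comp, pow_add, Nat.cast_add, add_sub_cancel_left]
  ring

lemma hasSum_norm_hComplete_shift {n : ℕ} (y : Fin n → ℝ) {v : ℂ} (hv : ∀ j, ‖v * y j‖ < 1)
    (m : ℕ) : HasSum (fun a : ℕ => ‖v ^ a * (hComplete y ((a : ℤ) - m) : ℂ)‖)
      (‖v‖ ^ m * ∑' k : ℕ, ‖(hComplete y k : ℂ) * v ^ k‖) := by
  rw [← (add_right_injective m).hasSum_iff fun a ha => by
    rw [hComplete_shift_eq_zero y v m a ha, norm_zero]]
  refine ((hasSum_hComplete y hv).2.hasSum.mul_left (‖v‖ ^ m)).congr_fun fun k => ?_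
  simp only [Function.comp, pow_add, Nat.cast_add, add_sub_cancel_left, norm_mul, norm_pow]
  ring

lemma prod_pow_pairSeq {R : Type*} [CommRing R] {e : ℕ} (u : Fin (2 * e) → R) (k : Fin e → ℕ) :
    ∏ i, u i ^ pairSeq k i = ∏ r, u (blockEquiv e (r, 0)) *
      (u (blockEquiv e (r, 0)) * u (blockEquiv e (r, 1))) ^ k r := by
  rw [← Equiv.prod_comp (blockEquiv e), Fintype.prod_prod_type]
  refine Finset.prod_congr rfl fun r _ => ?_
  rw [Fin.prod_univ_two, pairSeq_zero, pairSeq_one]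
  ring

section

variable {n e : ℕ} {y : Fin n → ℝ} {v : Fin (2 * e) → ℂ}

lemma summable_norm_pairSeq (hv1 : ∀ i, ‖v i‖ < 1) :
    Summable fun k : Fin e → ℕ => ‖∏ r, v (blockEquiv e (r, 0)) *
      (v (blockEquiv e (r, 0)) * v (blockEquiv e (r, 1))) ^ k r‖ := by
  refine summable_norm_pi_prod (f := fun r a => v (blockEquiv e (r, 0)) *
      (v (blockEquiv e (r, 0)) * v (blockEquiv e (r, 1))) ^ a) fun r => ?_
  simp only [norm_mul, norm_pow]
  refine (summable_geometric_of_lt_one (by positivity) ?_).mul_left _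
  exact mul_lt_one_of_nonneg_of_lt_one_left (norm_nonneg _) (hv1 _) (hv1 _).le

lemma hasSum_pairSeq (hv1 : ∀ i, ‖v i‖ < 1) :
    HasSum (fun k : Fin e → ℕ => ∏ r, v (blockEquiv e (r, 0)) *
      (v (blockEquiv e (r, 0)) * v (blockEquiv e (r, 1))) ^ k r)
      (∏ r, v (blockEquiv e (r, 0)) / (1 - v (blockEquiv e (r, 0)) * v (blockEquiv e (r, 1)))) := by
  have hlt : ∀ r, ‖v (blockEquiv e (r, 0)) * v (blockEquiv e (r, 1))‖ < 1 := fun r => by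
    rw [norm_mul]
    exact mul_lt_one_of_nonneg_of_lt_one_left (norm_nonneg _) (hv1 _) (hv1 _).le
  have h := hasSum_pi_prod (f := fun r a => v (blockEquiv e (r, 0)) *
      (v (blockEquiv e (r, 0)) * v (blockEquiv e (r, 1))) ^ a) fun r => by
    simp only [norm_mul (v (blockEquiv e (r, 0))) ((_ : ℂ) ^ _), norm_pow]
    exact (summable_geometric_of_lt_one (norm_nonneg _) (hlt r)).mul_left _
  simpa only [tsum_mul_left, tsum_geometric_of_norm_lt_one (hlt _), ← div_eq_mul_inv] using h

lemma prod_shift_eq {R : Type*} [CommRing R] (u c : Fin (2 * e) → R) (σ : Equiv.Perm (Fin (2 * e)))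
    (k : Fin e → ℕ) : ∏ i, u i ^ pairSeq k (σ i) * c i = (∏ i, c i) *
      ∏ r, u (σ.symm (blockEquiv e (r, 0))) * (u (σ.symm (blockEquiv e (r, 0))) *
        u (σ.symm (blockEquiv e (r, 1)))) ^ k r := by
  rw [Finset.prod_mul_distrib, mul_comm, ← prod_pow_pairSeq fun i => u (σ.symm i),
    ← Equiv.prod_comp σ fun i => u (σ.symm i) ^ pairSeq k i]
  simp

lemma summable_norm_term (hv1 : ∀ i, ‖v i‖ < 1) (hvy : ∀ i j, ‖v i * y j‖ < 1)
    (σ : Equiv.Perm (Fin (2 * e))) :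
    Summable fun p : (Fin e → ℕ) × (Fin (2 * e) → ℕ) =>
      ‖∏ i, v i ^ p.2 i * (hComplete y ((p.2 i : ℤ) - pairSeq p.1 (σ i)) : ℂ)‖ := by
  rw [summable_prod_of_nonneg fun _ => norm_nonneg _]
  refine ⟨fun k => summable_norm_pi_prod (f := fun i a =>
    v i ^ a * (hComplete y ((a : ℤ) - pairSeq k (σ i)) : ℂ)) fun i =>
      (hasSum_norm_hComplete_shift y (hvy i) _).summable, ?_⟩
  have h1 : ∀ k : Fin e → ℕ, ∑' l : Fin (2 * e) → ℕ,
      ‖∏ i, v i ^ l i * (hComplete y ((l i : ℤ) - pairSeq k (σ i)) : ℂ)‖ =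
      (∏ i, ∑' a : ℕ, ‖(hComplete y a : ℂ) * v i ^ a‖) *
        ‖∏ r, v (σ.symm (blockEquiv e (r, 0))) * (v (σ.symm (blockEquiv e (r, 0))) *
          v (σ.symm (blockEquiv e (r, 1)))) ^ k r‖ := by
    intro k
    have h2 := (hasSum_pi_prod (f := fun i a => ((‖v i ^ a *
      (hComplete y ((a : ℤ) - pairSeq k (σ i)) : ℂ)‖ : ℝ) : ℂ)) fun i => by
        simpa using (hasSum_norm_hComplete_shift y (hvy i) (pairSeq k (σ i))).summable).tsum_eq
    simp only [← Complex.ofReal_prod, ← Complex.ofReal_tsum, ← norm_prod] at h2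
    rw [Complex.ofReal_inj.1 h2]
    simp only [(hasSum_norm_hComplete_shift y (hvy _) _).tsum_eq]
    rw [prod_shift_eq (fun i => ‖v i‖)]
    simp only [norm_prod, norm_mul, norm_pow]
  simp only [h1]
  exact (summable_norm_pairSeq (v := fun i => v (σ.symm i)) fun i => hv1 _).mul_left _

lemma hasSum_term (hv1 : ∀ i, ‖v i‖ < 1) (hvy : ∀ i j, ‖v i * y j‖ < 1)
    (σ : Equiv.Perm (Fin (2 * e))) :
    HasSum (fun p : (Fin e → ℕ) × (Fin (2 * e) → ℕ) =>
      ∏ i, v i ^ p.2 i * (hComplete y ((p.2 i : ℤ) - pairSeq p.1 (σ i)) : ℂ))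
      ((∏ i, ∏ j, (1 - v i * y j)⁻¹) * ∏ r, v (σ.symm (blockEquiv e (r, 0))) /
        (1 - v (σ.symm (blockEquiv e (r, 0))) * v (σ.symm (blockEquiv e (r, 1))))) := by
  have hs := (summable_norm_term hv1 hvy σ).of_norm
  have h1 : ∀ k : Fin e → ℕ, HasSum (fun l : Fin (2 * e) → ℕ =>
      ∏ i, v i ^ l i * (hComplete y ((l i : ℤ) - pairSeq k (σ i)) : ℂ))
      ((∏ i, ∏ j, (1 - v i * y j)⁻¹) * ∏ r, v (σ.symm (blockEquiv e (r, 0))) *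
        (v (σ.symm (blockEquiv e (r, 0))) * v (σ.symm (blockEquiv e (r, 1)))) ^ k r) := by
    intro k
    have h2 := hasSum_pi_prod (f := fun i a => v i ^ a *
      (hComplete y ((a : ℤ) - pairSeq k (σ i)) : ℂ)) fun i =>
        (hasSum_norm_hComplete_shift y (hvy i) _).summable
    simp only [(hasSum_hComplete_shift y (hvy _) _).tsum_eq] at h2
    rwa [prod_shift_eq] at h2
  have h3 := hs.hasSum.prod_fiberwise h1
  have h4 := (hasSum_pairSeq (v := fun i => v (σ.symm i)) fun i => hv1 _).mul_left
    (∏ i, ∏ j, (1 - v i * y j)⁻¹)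
  rw [h4.unique h3]
  exact hs.hasSum

end


/-- In a Pfaffian sum the matrix may be antisymmetrised. -/
lemma sum_sign_prod_sub {e : ℕ} (f : Fin (2 * e) → Fin (2 * e) → ℂ) :
    ∑ σ : Equiv.Perm (Fin (2 * e)), ((Equiv.Perm.sign σ : ℤ) : ℂ) *
      ∏ r, (f (σ (blockEquiv e (r, 0))) (σ (blockEquiv e (r, 1))) -
        f (σ (blockEquiv e (r, 1))) (σ (blockEquiv e (r, 0)))) =
    2 ^ e * ∑ σ : Equiv.Perm (Fin (2 * e)), ((Equiv.Perm.sign σ : ℤ) : ℂ) *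
      ∏ r, f (σ (blockEquiv e (r, 0))) (σ (blockEquiv e (r, 1))) := by
  set b := blockEquiv e with hb
  have key : ∀ s : Finset (Fin e), ∑ σ : Equiv.Perm (Fin (2 * e)),
      ((Equiv.Perm.sign σ : ℤ) : ℂ) * ∏ r, (f (σ (b (r, 0))) (σ (b (r, 1))) -
        if r ∈ s then f (σ (b (r, 1))) (σ (b (r, 0))) else 0) =
      2 ^ s.card * ∑ σ : Equiv.Perm (Fin (2 * e)), ((Equiv.Perm.sign σ : ℤ) : ℂ) *
        ∏ r, f (σ (b (r, 0))) (σ (b (r, 1))) := by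
    intro s
    induction s using Finset.induction_on with
    | empty => simp
    | insert a s ha ih =>
      rw [Finset.card_insert_of_notMem ha, pow_succ, mul_comm _ (2 : ℂ), mul_assoc, ← ih]
      set g : Equiv.Perm (Fin (2 * e)) → ℂ := fun σ => ∏ r ∈ Finset.univ.erase a,
        (f (σ (b (r, 0))) (σ (b (r, 1))) -
        if r ∈ s then f (σ (b (r, 1))) (σ (b (r, 0))) else 0) with hg
      set τ := Equiv.swap (b (a, 0)) (b (a, 1)) with hτ
      have hgτ : ∀ σ, g (σ * τ) = g σ := by
        intro σ
        refine Finset.prod_congr rfl fun r hr => ?_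
        have hra := Finset.ne_of_mem_erase hr
        have h1 : ∀ i, τ (b (r, i)) = b (r, i) := fun i =>
          Equiv.swap_apply_of_ne_of_ne (by simp [hra]) (by simp [hra])
        simp only [Equiv.Perm.mul_apply, h1]
      have hsgn : Equiv.Perm.sign τ = -1 := Equiv.Perm.sign_swap (by simp)
      have e1 : ∀ σ : Equiv.Perm (Fin (2 * e)), ∏ r, (f (σ (b (r, 0))) (σ (b (r, 1))) -
          if r ∈ insert a s then f (σ (b (r, 1))) (σ (b (r, 0))) else 0) =
          (f (σ (b (a, 0))) (σ (b (a, 1))) - f (σ (b (a, 1))) (σ (b (a, 0)))) * g σ := by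
        intro σ
        rw [← Finset.mul_prod_erase _ _ (Finset.mem_univ a), if_pos (Finset.mem_insert_self a s)]
        congr 1
        refine Finset.prod_congr rfl fun r hr => ?_
        simp [Finset.ne_of_mem_erase hr]
      have e2 : ∀ σ : Equiv.Perm (Fin (2 * e)), ∏ r, (f (σ (b (r, 0))) (σ (b (r, 1))) -
          if r ∈ s then f (σ (b (r, 1))) (σ (b (r, 0))) else 0) =
          f (σ (b (a, 0))) (σ (b (a, 1))) * g σ := by
        intro σ
        rw [← Finset.mul_prod_erase _ _ (Finset.mem_univ a), if_neg ha, sub_zero]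
      have e3 : ∑ σ : Equiv.Perm (Fin (2 * e)), ((Equiv.Perm.sign σ : ℤ) : ℂ) *
          (f (σ (b (a, 1))) (σ (b (a, 0))) * g σ) = -∑ σ : Equiv.Perm (Fin (2 * e)),
          ((Equiv.Perm.sign σ : ℤ) : ℂ) * (f (σ (b (a, 0))) (σ (b (a, 1))) * g σ) := by
        rw [← Equiv.sum_comp (Equiv.mulRight τ), ← Finset.sum_neg_distrib]
        refine Finset.sum_congr rfl fun σ _ => ?_
        rw [Equiv.coe_mulRight, hgτ, Equiv.Perm.sign_mul, hsgn]
        simp only [Equiv.Perm.mul_apply, hτ, Equiv.swap_apply_left, Equiv.swap_apply_right]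
        push_cast
        ring
      simp only [e1, e2, sub_mul, mul_sub, Finset.sum_sub_distrib, e3]
      ring
  have := key Finset.univ
  simpa using this

section

variable {n e : ℕ} {y : Fin n → ℝ} {v : Fin (2 * e) → ℂ}

/-- Antisymmetrisation turns `v / (1 - v v')` into a cross ratio, so that Schur's Pfaffian
applies. -/
lemma sum_sign_prod_div (hv1 : ∀ i, ‖v i‖ < 1) :
    ∑ σ : Equiv.Perm (Fin (2 * e)), ((Equiv.Perm.sign σ : ℤ) : ℂ) *
      ∏ r, v (σ (blockEquiv e (r, 0))) /
        (1 - v (σ (blockEquiv e (r, 0))) * v (σ (blockEquiv e (r, 1)))) =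
      e.factorial * ratioProd v := by
  have h := sum_sign_blockProd (q := v) fun a b _ => by
    refine sub_ne_zero.2 fun h => ?_
    have : ‖v a * v b‖ < 1 := by
      rw [norm_mul]
      exact mul_lt_one_of_nonneg_of_lt_one_left (norm_nonneg _) (hv1 _) (hv1 _).le
    rw [← h, norm_one] at this
    exact lt_irrefl _ this
  simp only [blockProd_eq_prod] at h
  have h2 := sum_sign_prod_sub (e := e) fun a b => v a / (1 - v a * v b)
  have h3 : ∀ a b : Fin (2 * e), v a / (1 - v a * v b) - v b / (1 - v b * v a) =
      ratio (v a) (v b) := fun a b => by rw [ratio, mul_comm (v b), sub_div]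
  simp only [h3] at h2
  rw [h2, mul_assoc] at h
  exact mul_left_cancel₀ (pow_ne_zero _ two_ne_zero) h

lemma prod_pow_mul_jtDet (k : Fin e → ℕ) (l : Fin (2 * e) → ℕ) :
    (∏ i, v i ^ l i) * (jtDet y l (pairSeq k) : ℂ) =
      ∑ σ : Equiv.Perm (Fin (2 * e)), ((Equiv.Perm.sign σ : ℤ) : ℂ) *
        ∏ i, v i ^ l i * (hComplete y ((l i : ℤ) - pairSeq k (σ i)) : ℂ) := by
  rw [jtDet, ← Matrix.det_transpose, Matrix.det_apply', Complex.ofReal_sum, Finset.mul_sum]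
  refine Finset.sum_congr rfl fun σ _ => ?_
  rw [Finset.prod_mul_distrib]
  simp only [Matrix.transpose_apply, Matrix.of_apply]
  push_cast
  ring

/-- Littlewood's identity for an even number of variables. -/
lemma hasSum_evenWeight (hv1 : ∀ i, ‖v i‖ < 1) (hvy : ∀ i j, ‖v i * y j‖ < 1) :
    HasSum (fun l : Fin (2 * e) → ℕ => (evenWeight y e l : ℂ) * ∏ i, v i ^ l i)
      (ratioProd v * ∏ i, ∏ j, (1 - v i * y j)⁻¹) := by
  have h1 : HasSum (fun p : (Fin e → ℕ) × (Fin (2 * e) → ℕ) =>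
      (∏ i, v i ^ p.2 i) * (jtDet y p.2 (pairSeq p.1) : ℂ))
      (e.factorial * (ratioProd v * ∏ i, ∏ j, (1 - v i * y j)⁻¹)) := by
    have h2 := hasSum_sum (s := Finset.univ) fun σ (_ : σ ∈ Finset.univ) =>
      (hasSum_term hv1 hvy σ).mul_left ((Equiv.Perm.sign σ : ℤ) : ℂ)
    simp only [← prod_pow_mul_jtDet] at h2
    refine (congrArg (HasSum _) ?_).mpr h2
    rw [← Equiv.sum_comp (Equiv.inv _)]
    simp only [Equiv.inv_apply, Equiv.Perm.sign_inv]
    have h3 : ∀ σ : Equiv.Perm (Fin (2 * e)), Equiv.symm σ⁻¹ = σ := fun σ => rfl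
    simp only [h3, mul_left_comm _ (∏ i, ∏ j, (1 - v i * (y j : ℂ))⁻¹), ← Finset.mul_sum,
      sum_sign_prod_div hv1]
    ring
  rw [← (Equiv.prodComm (Fin (2 * e) → ℕ) (Fin e → ℕ)).hasSum_iff] at h1
  have h4 := (h1.prod_fiberwise (g := fun l => e.factorial *
    ((evenWeight y e l : ℂ) * ∏ i, v i ^ l i)) fun l => ?_).mul_left (e.factorial : ℂ)⁻¹
  · have he : (e.factorial : ℂ) ≠ 0 := by exact_mod_cast e.factorial_ne_zero
    simpa only [inv_mul_cancel_left₀ he] using h4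
  · have h5 : HasSum (fun k : Fin e → ℕ => jtDet y l (pairSeq k))
        (e.factorial * evenWeight y e l) := by
      rw [evenWeight, mul_inv_cancel_left₀ (by exact_mod_cast e.factorial_ne_zero)]
      exact (summable_of_hasFiniteSupport (finite_jtDet_pairSeq_ne_zero y l)).hasSum
    have h6 := (Complex.hasSum_ofReal.2 h5).mul_left (∏ i, v i ^ l i)
    push_cast at h6
    refine (congrArg (HasSum _) ?_).mpr h6
    ring

end

/-- A weight `W` on sequences extending `tau` antisymmetrically, with a product formula for its
generating function.  The variables are taken nonzero because for odd `n` the series arises from one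
with a factor `∏ i, v i`, which has to be cancelled. -/
structure IsWeight {n M : ℕ} (y : Fin M → ℝ) (W : (Fin n → ℕ) → ℝ) : Prop where
  perm : ∀ (l : Fin n → ℕ) (σ : Equiv.Perm (Fin n)),
    W (fun i => l (σ i)) = (Equiv.Perm.sign σ : ℤ) * W l
  shiftedParts : ∀ lam : YoungDiagram, lam.colLen 0 ≤ n → W (shiftedParts n lam) = tau lam y
  hasSum : ∀ v : Fin n → ℂ, (∀ i, v i ≠ 0) → (∀ i, ‖v i‖ < 1) →
    HasSum (fun l => (W l : ℂ) * ∏ i, v i ^ l i) (ratioProd v * ∏ i, ∏ j, (1 - v i * y j)⁻¹)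

lemma eq_zero_of_not_injective {n : ℕ} {W : (Fin n → ℕ) → ℝ}
    (hW : ∀ (l : Fin n → ℕ) (σ : Equiv.Perm (Fin n)),
      W (fun i => l (σ i)) = (Equiv.Perm.sign σ : ℤ) * W l)
    {l : Fin n → ℕ} (hl : ¬ Function.Injective l) : W l = 0 := by
  obtain ⟨i, j, hij, hne⟩ : ∃ i j, l i = l j ∧ i ≠ j := by
    simpa [Function.Injective] using hl
  have h := hW l (Equiv.swap i j)
  have h2 : (fun a => l (Equiv.swap i j a)) = l := by
    funext a
    rcases eq_or_ne a i with rfl | hai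
    · rw [Equiv.swap_apply_left, hij]
    rcases eq_or_ne a j with rfl | haj
    · rw [Equiv.swap_apply_right, hij]
    · rw [Equiv.swap_apply_of_ne_of_ne hai haj]
  rw [h2, Equiv.Perm.sign_swap hne] at h
  push_cast at h
  linarith

/-- Since `ratio v 0 = v`, an additional variable `0` multiplies the product by all variables. -/
lemma ratioProd_snoc_zero {n : ℕ} (v : Fin n → ℂ) :
    ratioProd (Fin.snoc v 0 : Fin (n + 1) → ℂ) = ratioProd v * ∏ i, v i := by
  have h : ∀ {N : ℕ} (q : Fin N → ℂ), ratioProd q = ∏ i, ∏ j, if i < j then ratio (q i) (q j) else 1 := by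
    intro N q
    refine Finset.prod_congr rfl fun i _ => ?_
    rw [← Finset.prod_filter]
    congr 1
    ext j
    simp
  rw [h, h, Fin.prod_univ_castSucc, ← Finset.prod_mul_distrib]
  simp only [Fin.prod_univ_castSucc, Fin.snoc_castSucc, Fin.snoc_last]
  have h2 : ∀ j : Fin n, ¬ Fin.last n < j.castSucc := fun j => (Fin.castSucc_lt_last j).not_gt
  simp [h2, ratio, Fin.castSucc_lt_last]

lemma exists_isWeight_even {n M : ℕ} (hn : Even n) {y : Fin M → ℝ} (hy : ∀ j, 0 < y j ∧ y j < 1) :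
    ∃ W : (Fin n → ℕ) → ℝ, (∀ (l : Fin n → ℕ) (σ : Equiv.Perm (Fin n)),
        W (fun i => l (σ i)) = (Equiv.Perm.sign σ : ℤ) * W l) ∧
      (∀ lam : YoungDiagram, lam.colLen 0 ≤ n → W (shiftedParts n lam) = tau lam y) ∧
      ∀ v : Fin n → ℂ, (∀ i, ‖v i‖ < 1) → HasSum (fun l => (W l : ℂ) * ∏ i, v i ^ l i)
        (ratioProd v * ∏ i, ∏ j, (1 - v i * y j)⁻¹) := by
  obtain ⟨e, rfl⟩ := hn.exists_two_nsmul
  rw [nsmul_eq_mul, Nat.cast_ofNat]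
  refine ⟨evenWeight y e, evenWeight_perm y, fun lam h => evenWeight_shiftedParts y h,
    fun v hv => hasSum_evenWeight hv fun i j => ?_⟩
  rw [norm_mul, Complex.norm_real, Real.norm_of_nonneg (hy j).1.le]
  exact mul_lt_one_of_nonneg_of_lt_one_left (norm_nonneg _) (hv _) (hy j).2.le

/-- For an odd number of variables, `W` is obtained from the even case with one more variable by
setting that variable to `0` and removing the common factor `∏ v_i`. -/
lemma exists_isWeight {M : ℕ} (n : ℕ) {y : Fin M → ℝ} (hy : ∀ j, 0 < y j ∧ y j < 1) :
    ∃ W : (Fin n → ℕ) → ℝ, IsWeight y W := by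
  rcases Nat.even_or_odd n with hn | hn
  · obtain ⟨W, h1, h2, h3⟩ := exists_isWeight_even hn hy
    exact ⟨W, h1, h2, fun v _ hv => h3 v hv⟩
  obtain ⟨W, h1, h2, h3⟩ := exists_isWeight_even hn.add_one hy
  let E : (Fin n → ℕ) → Fin (n + 1) → ℕ := fun l => Fin.snoc (fun i => l i + 1) 0
  have hE : ∀ l i, E l (Fin.castSucc i) = l i + 1 := fun l i => by simp [E]
  have hE' : ∀ l, E l (Fin.last n) = 0 := fun l => by simp [E]
  have hEinj : Function.Injective E := fun l l' h => funext fun i => by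
    have := congrFun h i.castSucc
    rw [hE, hE] at this
    omega
  refine ⟨fun l => W (E l), fun l σ => ?_, fun lam hlam => ?_, fun v hv0 hv1 => ?_⟩
  · have := h1 (E l) (σ.viaFintypeEmbedding Fin.castSuccEmb)
    rw [Equiv.Perm.viaFintypeEmbedding_sign] at this
    rw [← this]
    congr 1
    funext i
    refine Fin.lastCases ?_ (fun i => ?_) i
    · rw [Equiv.Perm.viaFintypeEmbedding_apply_notMem_range, hE', hE']
      rintro ⟨i, hi⟩
      exact (Fin.castSucc_lt_last i).ne hi
    · have := Equiv.Perm.viaFintypeEmbedding_apply_image σ Fin.castSuccEmb i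
      rw [Fin.coe_castSuccEmb] at this
      rw [this, hE, hE]
  · rw [← h2 lam (by omega)]
    congr 1
    funext i
    have h4 := shiftedParts_cast lam i
    refine Fin.lastCases (fun h4 => ?_) (fun i h4 => ?_) i h4
    · rw [hE']
      rw [rowLen_eq_zero (by simpa using hlam)] at h4
      simp only [Fin.val_last] at h4
      push_cast at h4
      omega
    · have h5 := shiftedParts_cast lam i
      rw [hE]
      simp only [Fin.val_castSucc] at h4
      push_cast at h4 h5
      omega
  · have hp : ∏ i, v i ≠ 0 := Finset.prod_ne_zero_iff.2 fun i _ => hv0 i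
    have h4 := h3 (Fin.snoc v 0) fun i => by
      refine Fin.lastCases ?_ (fun i => ?_) i
      · simp
      · simpa using hv1 i
    rw [ratioProd_snoc_zero] at h4
    rw [← hEinj.hasSum_iff] at h4
    · have h5 := h4.mul_left (∏ i, v i)⁻¹
      simp only [Function.comp_def, Fin.prod_univ_castSucc, Fin.snoc_castSucc, Fin.snoc_last, hE, hE',
        pow_succ, Finset.prod_mul_distrib, pow_zero, mul_one, zero_mul, sub_zero, inv_one,
        Finset.prod_const_one] at h5
      have h6 : ratioProd v * ∏ i, ∏ j, (1 - v i * (y j : ℂ))⁻¹ = (∏ i, v i)⁻¹ *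
          (ratioProd v * (∏ i, v i) * ∏ i, ∏ j, (1 - v i * (y j : ℂ))⁻¹) := by
        generalize ∏ i, ∏ j, (1 - v i * (y j : ℂ))⁻¹ = c
        field_simp
      rw [h6]
      refine h5.congr_fun fun l => ?_
      field_simp
    · intro l hl
      by_cases hlast : l (Fin.last n) = 0
      · rw [eq_zero_of_not_injective h1, Complex.ofReal_zero, zero_mul]
        intro hinj
        refine hl ⟨fun i => l i.castSucc - 1, funext fun i => ?_⟩
        refine Fin.lastCases ?_ (fun i => ?_) i
        · rw [hE', hlast]
        · rw [hE]
          have : l i.castSucc ≠ l (Fin.last n) := hinj.ne (Fin.castSucc_lt_last i).ne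
          omega
      · rw [Fin.prod_univ_castSucc, Fin.snoc_last, zero_pow hlast, mul_zero, mul_zero]


/-! ### Evaluation of the kernel -/

section Factors

variable {n : ℕ} (x y : Fin n → ℝ) (t : ℤ)

/-- The factor of the kernels that belongs to a variable on a contour outside the unit circle. -/
noncomputable def outerFactor (z : ℂ) : ℂ :=
  (∏ i, (1 - z⁻¹ * x i) * (1 - z⁻¹ * y i) / (1 - z * x i)) * (z ^ 2 - 1)⁻¹ * z ^ (-t)

/-- The factor of the kernels that belongs to a variable of the second kind. -/
noncomputable def innerFactor (w : ℂ) : ℂ :=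
  w⁻¹ * (∏ i, (1 - w⁻¹ * x i) / ((1 - w * x i) * (1 - w * y i))) * w ^ (-t)

/-- `outerFactor` without its poles at the points `1 / x_i`. -/
noncomputable def outerNumerator (z : ℂ) : ℂ :=
  (∏ i, (1 - z⁻¹ * x i) * (1 - z⁻¹ * y i) * (-(x i : ℂ)⁻¹)) * (z ^ 2 - 1)⁻¹ * z ^ (-t)

/-- The residue of `outerFactor` at `1 / x_i`, for pairwise distinct `x_i`. -/
noncomputable def outerResidue (i : Fin n) : ℂ :=
  outerNumerator x y t (x i : ℂ)⁻¹ * ∏ j ∈ Finset.univ.erase i, ((x i : ℂ)⁻¹ - (x j : ℂ)⁻¹)⁻¹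

variable {x y}

lemma one_sub_mul_inv {a : ℂ} (ha : a ≠ 0) (z : ℂ) : (1 - z * a)⁻¹ = -a⁻¹ * (z - a⁻¹)⁻¹ := by
  rw [show 1 - z * a = -a * (z - a⁻¹) by field_simp; ring, mul_inv, inv_neg]

lemma outerFactor_eq (hx : ∀ i, 0 < x i) (z : ℂ) :
    outerFactor x y t z = outerNumerator x y t z * ∏ i, (z - (x i : ℂ)⁻¹)⁻¹ := by
  have h : ∀ i, (1 - z⁻¹ * x i) * (1 - z⁻¹ * y i) / (1 - z * x i) =
      (1 - z⁻¹ * x i) * (1 - z⁻¹ * y i) * (-(x i : ℂ)⁻¹) * (z - (x i : ℂ)⁻¹)⁻¹ := fun i => by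
    rw [div_eq_mul_inv, one_sub_mul_inv (by exact_mod_cast (hx i).ne')]
    ring
  simp only [outerFactor, outerNumerator, h, Finset.prod_mul_distrib]
  ring

lemma isRat_one_sub_inv_mul {S : Set ℂ} (h0 : (0 : ℂ) ∈ S) (a : ℂ) :
    IsRat S fun z => 1 - z⁻¹ * a :=
  (IsRat.const h0 1).sub ((IsRat.inv h0).mul (IsRat.const h0 a))

lemma isRat_ratio {S : Set ℂ} (h0 : (0 : ℂ) ∈ S) {w : ℂ} (hw : w ≠ 0) (h : w⁻¹ ∈ S) :
    IsRat S fun z => ratio z w :=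
  ((IsRat.id h0).sub (IsRat.const h0 w)).mul (IsRat.inv_one_sub_mul hw h)

lemma isRat_outerNumerator {S : Set ℂ} (h0 : (0 : ℂ) ∈ S) (h1 : (1 : ℂ) ∈ S) (h1' : (-1 : ℂ) ∈ S) :
    IsRat S (outerNumerator x y t) := by
  refine ((IsRat.prod _ h0 fun i _ => ((isRat_one_sub_inv_mul h0 _).mul
    (isRat_one_sub_inv_mul h0 _)).mul (IsRat.const h0 _)).mul ?_).mul (IsRat.zpow h0 _)
  refine ((IsRat.inv_sub h1).mul (IsRat.inv_sub h1')).congr fun z _ => ?_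
  rw [← mul_inv]
  ring

lemma isRat_innerFactor {S : Set ℂ} (h0 : (0 : ℂ) ∈ S) (hx : ∀ i, 0 < x i) (hy : ∀ i, 0 < y i)
    (hxS : ∀ i, (x i : ℂ)⁻¹ ∈ S) (hyS : ∀ i, (y i : ℂ)⁻¹ ∈ S) : IsRat S (innerFactor x y t) := by
  refine ((IsRat.inv h0).mul (IsRat.prod _ h0 fun i _ => ?_)).mul (IsRat.zpow h0 _)
  refine ((isRat_one_sub_inv_mul h0 (x i : ℂ)).mul ((IsRat.inv_one_sub_mul
    (by exact_mod_cast (hx i).ne') (hxS i)).mul (IsRat.inv_one_sub_mul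
    (by exact_mod_cast (hy i).ne') (hyS i)))).congr fun z _ => ?_
  rw [div_eq_mul_inv, mul_inv]

/-- If `‖z w‖ > 1` along `C`, then the disc `‖a‖ ≤ ‖1 / w‖` does not meet `C`, and `C` does not wind
around `1 / w` if it does not wind around `0`. -/
lemma winding_inv_eq_zero {C : ClosedContour} (h0 : C.winding 0 = 0) {w : ℂ} (hw0 : w ≠ 0)
    (hw : ∀ z ∈ C.image, 1 < ‖z * w‖) : C.winding w⁻¹ = 0 := by
  refine C.winding_eq_zero_of_norm_le (r := ‖w⁻¹‖) (fun z hz => ?_) h0 le_rfl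
  have := hw z hz
  rw [norm_mul] at this
  rw [norm_inv, inv_lt_iff_one_lt_mul₀ (norm_pos_iff.2 hw0), mul_comm]
  rwa [mul_comm]

/-- A contour outside the unit circle sees only the simple poles `1 / x_i` of `outerFactor`: the
poles `0`, `±1` and `1 / w` have winding number `0`. -/
lemma integral_ratio_outerFactor (hn : 0 < n) (hinj : Function.Injective x)
    (hx : ∀ i, 0 < x i ∧ x i < 1) {C : ClosedContour} (hC : ∀ z ∈ C.image, 1 < ‖z‖)
    (h0 : C.winding 0 = 0) (he : ∀ i, C.Encloses (x i : ℂ)⁻¹) {w : ℂ} (hw0 : w ≠ 0)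
    (hw : ∀ z ∈ C.image, 1 < ‖z * w‖) :
    C.integral (fun z => -ratio z w * outerFactor x y t z) = 2 * Real.pi * Complex.I *
      ∑ i, -ratio (x i : ℂ)⁻¹ w * outerResidue x y t i := by
  set S : Set ℂ := {0, 1, -1, w⁻¹} with hS
  have hSC : ∀ a ∈ S, C.winding a = 0 := by
    rintro a (rfl | rfl | rfl | rfl)
    · exact h0
    · exact C.winding_eq_zero_of_norm_le hC h0 (by simp)
    · exact C.winding_eq_zero_of_norm_le hC h0 (by simp)
    · exact winding_inv_eq_zero h0 hw0 hw
  have hrat : IsRat S fun z => -ratio z w * outerNumerator x y t z := by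
    refine (((isRat_ratio (by simp [hS]) hw0 (by simp [hS])).const_mul (-1)).mul
      (isRat_outerNumerator (x := x) (y := y) t (by simp [hS]) (by simp [hS]) (by simp [hS]))).congr fun z _ => ?_
    ring
  have h := IsRat.integral_mul_prod_inv_sub hrat (C := C) ?_ hSC (b := fun i => (x i : ℂ)⁻¹) hn
    (fun i j hij => hinj (by exact_mod_cast inv_injective hij))
    (fun i hi => by have := hSC _ hi; rw [(he i).2] at this; exact one_ne_zero this) he
  · simp only [mul_assoc] at h
    simp only [outerFactor_eq t (fun i => (hx i).1), outerResidue, mul_assoc, h]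
  · rintro a (rfl | rfl | rfl | rfl) ha
    · have := hC _ ha; simp at this; linarith
    · simpa using hC _ ha
    · simpa using hC _ ha
    · simpa [hw0] using hw _ ha

/-- The cross ratio with `1 / a` cancels a factor of `innerFactor`, including its pole at
`w = 1 / a` and its zero at `w = a`. -/
lemma ratio_inv_mul_div {a w : ℂ} (ha : a ≠ 0) (hw : w ≠ 0) (haw : w ≠ a) (haw' : w ≠ a⁻¹) :
    -ratio a⁻¹ w * ((1 - w⁻¹ * a) / (1 - w * a)) = w⁻¹ := by
  have h1 : a - w ≠ 0 := sub_ne_zero.2 haw.symm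
  have h2 : 1 - w * a ≠ 0 := fun h => haw' (eq_inv_of_mul_eq_one_left (sub_eq_zero.1 h).symm)
  have h3 : 1 - a⁻¹ * w ≠ 0 := by
    rw [show 1 - a⁻¹ * w = a⁻¹ * (a - w) by field_simp]
    exact mul_ne_zero (inv_ne_zero ha) h1
  have h4 : a⁻¹ - w = a⁻¹ * (1 - w * a) := by field_simp
  have h5 : 1 - a⁻¹ * w = a⁻¹ * (a - w) := by field_simp
  have h6 : 1 - w⁻¹ * a = -w⁻¹ * (a - w) := by field_simp; ring
  have h7 : 1 - a * w ≠ 0 := by rwa [mul_comm]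
  rw [ratio, h4, h5, h6]
  field_simp

/-- `-ratio (1 / x_i) w * innerFactor w` after cancellation. -/
noncomputable def reducedInner (x y : Fin n → ℝ) (t : ℤ) (i : Fin n) (w : ℂ) : ℂ :=
  w⁻¹ * w⁻¹ * (1 - w * y i)⁻¹ * (∏ j ∈ Finset.univ.erase i,
    (1 - w⁻¹ * x j) * ((1 - w * x j)⁻¹ * (1 - w * y j)⁻¹)) * w ^ (-t)

lemma ratio_mul_innerFactor {i : Fin n} (hx : 0 < x i) {w : ℂ} (hw : w ≠ 0) (hwx : w ≠ x i)
    (hwx' : w ≠ (x i : ℂ)⁻¹) :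
    -ratio (x i : ℂ)⁻¹ w * innerFactor x y t w = reducedInner x y t i w := by
  have h := ratio_inv_mul_div (by exact_mod_cast hx.ne') hw hwx hwx'
  rw [innerFactor, reducedInner, ← Finset.mul_prod_erase _ _ (Finset.mem_univ i)]
  simp only [div_eq_mul_inv, mul_inv] at h ⊢
  generalize (∏ j ∈ Finset.univ.erase i,
    (1 - w⁻¹ * (x j : ℂ)) * ((1 - w * x j)⁻¹ * (1 - w * y j)⁻¹)) = P
  linear_combination (w⁻¹ * (1 - w * y i)⁻¹ * P * w ^ (-t)) * h

lemma isRat_reducedInner {S : Set ℂ} (h0 : (0 : ℂ) ∈ S) (hx : ∀ i, 0 < x i) (hy : ∀ i, 0 < y i)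
    (hxS : ∀ i, (x i : ℂ)⁻¹ ∈ S) (hyS : ∀ i, (y i : ℂ)⁻¹ ∈ S) (i : Fin n) :
    IsRat S (reducedInner x y t i) := by
  have hX : ∀ j, IsRat S fun w => (1 - w * (x j : ℂ))⁻¹ := fun j =>
    IsRat.inv_one_sub_mul (by exact_mod_cast (hx j).ne') (hxS j)
  have hY : ∀ j, IsRat S fun w => (1 - w * (y j : ℂ))⁻¹ := fun j =>
    IsRat.inv_one_sub_mul (by exact_mod_cast (hy j).ne') (hyS j)
  exact ((((IsRat.inv h0).mul (IsRat.inv h0)).mul (hY i)).mul (IsRat.prod _ h0 fun j _ =>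
    (isRat_one_sub_inv_mul h0 _).mul ((hX j).mul (hY j)))).mul (IsRat.zpow h0 _)

/-- At infinity `reducedInner` is of order `w ^ (-(t + 2 n + 1))`. -/
lemma exists_reducedInner_le (hx : ∀ i, 0 < x i) (hy : ∀ i, 0 < y i) (ht : 1 ≤ t + 2 * n)
    (i : Fin n) :
    ∃ R₀ M : ℝ, ∀ w : ℂ, R₀ ≤ ‖w‖ → ‖reducedInner x y t i w‖ * ‖w‖ ^ 2 ≤ M := by
  set k : ℂ → ℂ := fun ζ => (ζ - y i)⁻¹ * ∏ j ∈ Finset.univ.erase i,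
    (1 - ζ * x j) * ((ζ - x j)⁻¹ * (ζ - y j)⁻¹) with hk
  have hkc : ContinuousAt k 0 := by
    have hX : ∀ j, ContinuousAt (fun ζ : ℂ => (ζ - x j)⁻¹) 0 := fun j =>
      (continuousAt_id.sub continuousAt_const).inv₀ (by simpa using (hx j).ne')
    have hY : ∀ j, ContinuousAt (fun ζ : ℂ => (ζ - y j)⁻¹) 0 := fun j =>
      (continuousAt_id.sub continuousAt_const).inv₀ (by simpa using (hy j).ne')
    refine (hY i).mul (tendsto_finsetProd _ fun j _ => ContinuousAt.mul ?_ ((hX j).mul (hY j)))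
    fun_prop
  obtain ⟨δ, hδ, hM⟩ := Metric.eventually_nhds_iff.1
    (hkc.norm.eventually_le_const (lt_add_one ‖k 0‖))
  refine ⟨max 1 (2 / δ), ‖k 0‖ + 1, fun w hw => ?_⟩
  have hw1 : 1 ≤ ‖w‖ := (le_max_left _ _).trans hw
  have hw0 : w ≠ 0 := by
    rintro rfl
    simp at hw1
    linarith
  have hδw : dist w⁻¹ 0 < δ := by
    rw [dist_zero_right, norm_inv, inv_lt_comm₀ (by linarith) hδ]
    refine lt_of_lt_of_le ?_ ((le_max_right _ _).trans hw)
    rw [← one_div]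
    gcongr
    norm_num
  have hfac : ∀ a : ℂ, (1 - w * a)⁻¹ = w⁻¹ * (w⁻¹ - a)⁻¹ := fun a => by
    rw [← mul_inv]
    congr 1
    field_simp
  have hcard : (Finset.univ.erase i).card + 1 = n := by
    rw [Finset.card_erase_add_one (Finset.mem_univ i), Finset.card_univ, Fintype.card_fin]
  have e : reducedInner x y t i w * w ^ 2 = w ^ (-(t + 2 * n - 1)) * k w⁻¹ := by
    have e1 : ∏ j ∈ Finset.univ.erase i, (1 - w⁻¹ * x j) * ((1 - w * x j)⁻¹ * (1 - w * y j)⁻¹) =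
        (w⁻¹ * w⁻¹) ^ (Finset.univ.erase i).card * ∏ j ∈ Finset.univ.erase i,
          (1 - w⁻¹ * (x j : ℂ)) * ((w⁻¹ - x j)⁻¹ * (w⁻¹ - y j)⁻¹) := by
      rw [← Finset.prod_const, ← Finset.prod_mul_distrib]
      refine Finset.prod_congr rfl fun j _ => ?_
      rw [hfac, hfac]
      ring
    have e2 : w ^ (-(t + 2 * n - 1)) =
        (w⁻¹ * w⁻¹) ^ (Finset.univ.erase i).card * w⁻¹ * w ^ (-t) := by
      rw [← mul_inv, inv_pow, ← pow_two, ← pow_mul, ← zpow_natCast, ← zpow_neg, ← zpow_neg_one,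
        ← zpow_add₀ hw0, ← zpow_add₀ hw0]
      congr 1
      push_cast
      have : ((Finset.univ.erase i).card : ℤ) + 1 = n := by exact_mod_cast hcard
      linear_combination 2 * this
    rw [reducedInner, e1, e2, hk, hfac]
    field_simp
  have h1 : ‖w ^ (-(t + 2 * n - 1))‖ ≤ 1 := by
    rw [norm_zpow]
    exact zpow_le_one_of_nonpos₀ hw1 (by linarith)
  rw [← norm_pow, ← norm_mul, e, norm_mul]
  calc _ ≤ 1 * ‖k w⁻¹‖ := by gcongr
    _ ≤ _ := by rw [one_mul]; exact hM hδw

/-- The poles `0`, `1 / x_j`, `1 / y_j` exhaust the singularities of the integrand, which decays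
like `w⁻²` at infinity, so that the exterior of a small circle can be traded for its interior. -/
lemma integral_ratio_innerFactor_exterior (hx : ∀ i, 0 < x i ∧ x i < 1)
    (hy : ∀ i, 0 < y i ∧ y i < 1) (ht : 1 ≤ t + 2 * n) {C : ClosedContour} (h0 : C.Excludes 0)
    (hex : ∀ i, C.Encloses (x i : ℂ)⁻¹) (hey : ∀ i, C.Encloses (y i : ℂ)⁻¹) {r : ℝ} (hr : 0 < r)
    {i : Fin n} (hr1 : r < x i) (hxi : (x i : ℂ) ∉ C.image) :
    C.integral (fun w => -ratio (x i : ℂ)⁻¹ w * innerFactor x y t w) =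
      -(circleContour r).integral fun w => -ratio (x i : ℂ)⁻¹ w * innerFactor x y t w := by
  have hr1' : r < 1 := hr1.trans (hx i).2
  have hnx : ∀ j, 1 < ‖(x j : ℂ)⁻¹‖ := fun j => by
    rw [norm_inv, Complex.norm_real, Real.norm_of_nonneg (hx j).1.le]
    exact (one_lt_inv₀ (hx j).1).2 (hx j).2
  have hny : ∀ j, 1 < ‖(y j : ℂ)⁻¹‖ := fun j => by
    rw [norm_inv, Complex.norm_real, Real.norm_of_nonneg (hy j).1.le]
    exact (one_lt_inv₀ (hy j).1).2 (hy j).2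
  have e1 : C.integral (fun w => -ratio (x i : ℂ)⁻¹ w * innerFactor x y t w) =
      C.integral (reducedInner x y t i) := C.integral_congr fun w hw =>
    ratio_mul_innerFactor t (hx i).1 (fun h => h0.1 (h ▸ hw)) (fun h => hxi (h ▸ hw))
      fun h => (hex i).1 (h ▸ hw)
  have e2 : (circleContour r).integral (fun w => -ratio (x i : ℂ)⁻¹ w * innerFactor x y t w) =
      (circleContour r).integral (reducedInner x y t i) := by
    refine (circleContour r).integral_congr fun w hw => ?_
    have hwr := norm_of_mem_circleContour hr.le hw
    refine ratio_mul_innerFactor t (hx i).1 ?_ ?_ ?_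
    · rintro rfl
      simp at hwr
      linarith
    · rintro rfl
      rw [Complex.norm_real, Real.norm_of_nonneg (hx i).1.le] at hwr
      linarith
    · rintro rfl
      linarith [hnx i]
  rw [e1, e2]
  set S : Set ℂ := {0} ∪ (Set.range (fun j => (x j : ℂ)⁻¹) ∪ Set.range fun j => (y j : ℂ)⁻¹) with hS
  have hrat : IsRat S (reducedInner x y t i) :=
    isRat_reducedInner t (by simp [hS]) (fun i => (hx i).1) (fun i => (hy i).1)
      (fun j => .inr (.inl ⟨j, rfl⟩)) (fun j => .inr (.inr ⟨j, rfl⟩)) i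
  obtain ⟨R₀, M, hM⟩ := exists_reducedInner_le t (fun i => (hx i).1) (fun i => (hy i).1) ht i
  have hlim := tendsto_circleContour_integral hM
  have hlarge : ∀ᶠ R : ℝ in atTop, (∀ j, ‖(x j : ℂ)⁻¹‖ < R) ∧ ∀ j, ‖(y j : ℂ)⁻¹‖ < R :=
    (eventually_all.2 fun j => eventually_gt_atTop _).and
      (eventually_all.2 fun j => eventually_gt_atTop _)
  -- Winding numbers around each pole: those of `C` and the small circle add up to those of the
  -- large circle.
  have hconst : ∀ᶠ R : ℝ in atTop, (circleContour R).integral (reducedInner x y t i) =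
      C.integral (reducedInner x y t i) + (circleContour r).integral (reducedInner x y t i) := by
    filter_upwards [hlarge, eventually_gt_atTop 0] with R hR hR0
    have h := hrat.sum_integral_eq_zero Finset.univ ![C, circleContour r, circleContour R]
      ![1, 1, -1] ?_ ?_
    · simp [Fin.sum_univ_three] at h
      linear_combination -h
    · intro m _ a ha
      rcases ha with rfl | ⟨j, rfl⟩ | ⟨j, rfl⟩ <;> fin_cases m
      · exact h0.1
      · exact notMem_circleContour hr.le (by simpa using hr.ne)
      · exact notMem_circleContour hR0.le (by simpa using hR0.ne)
      · exact (hex j).1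
      · exact notMem_circleContour hr.le (by linarith [hnx j] : ‖(x j : ℂ)⁻¹‖ > r).ne'
      · exact notMem_circleContour hR0.le (hR.1 j).ne
      · exact (hey j).1
      · exact notMem_circleContour hr.le (by linarith [hny j] : ‖(y j : ℂ)⁻¹‖ > r).ne'
      · exact notMem_circleContour hR0.le (hR.2 j).ne
    · rintro a (rfl | ⟨j, rfl⟩ | ⟨j, rfl⟩)
      · simp [Fin.sum_univ_three, h0.2, circleContour_winding_zero, hr, hR0]
      · simp only [Fin.sum_univ_three]
        simp [(hex j).2, circleContour_winding_of_gt hr.le (hr1'.trans (hnx j)),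
          circleContour_winding_of_lt hR0 (hR.1 j)]
      · simp only [Fin.sum_univ_three]
        simp [(hey j).2, circleContour_winding_of_gt hr.le (hr1'.trans (hny j)),
          circleContour_winding_of_lt hR0 (hR.2 j)]
  have h := tendsto_nhds_unique (tendsto_const_nhds.congr' (hconst.mono fun _ h => h.symm)) hlim
  linear_combination h

/-- Inside the unit disc `0` is the only pole, so that the contour may be replaced by a circle. -/
lemma integral_ratio_innerFactor (hx : ∀ i, 0 < x i ∧ x i < 1) (hy : ∀ i, 0 < y i ∧ y i < 1)
    {C : ClosedContour} (hC : ∀ w ∈ C.image, ‖w‖ < 1) (h0 : C.Encloses 0) {r : ℝ} (hr : 0 < r)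
    (hr1 : r < 1) {z : ℂ} (hz : ‖z‖ < 1) (hz0 : z ≠ 0) :
    C.integral (fun w => -ratio z w * innerFactor x y t w) =
      (circleContour r).integral fun w => -ratio z w * innerFactor x y t w := by
  have hnx : ∀ j, 1 < ‖(x j : ℂ)⁻¹‖ := fun j => by
    rw [norm_inv, Complex.norm_real, Real.norm_of_nonneg (hx j).1.le]
    exact (one_lt_inv₀ (hx j).1).2 (hx j).2
  have hny : ∀ j, 1 < ‖(y j : ℂ)⁻¹‖ := fun j => by
    rw [norm_inv, Complex.norm_real, Real.norm_of_nonneg (hy j).1.le]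
    exact (one_lt_inv₀ (hy j).1).2 (hy j).2
  have hnz : 1 < ‖z⁻¹‖ := by
    rw [norm_inv]
    exact (one_lt_inv₀ (norm_pos_iff.2 hz0)).2 hz
  set S : Set ℂ := {0, z⁻¹} ∪ (Set.range (fun j => (x j : ℂ)⁻¹) ∪ Set.range fun j => (y j : ℂ)⁻¹)
    with hS
  have hSn : ∀ a ∈ S, a = 0 ∨ 1 < ‖a‖ := by
    rintro a ((rfl | rfl) | ⟨j, rfl⟩ | ⟨j, rfl⟩)
    exacts [.inl rfl, .inr hnz, .inr (hnx j), .inr (hny j)]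
  have hrat : IsRat S fun w => -ratio z w * innerFactor x y t w := by
    refine (isRat_ratio (by simp [hS]) hz0 (by simp [hS])).mul
      (isRat_innerFactor t (by simp [hS]) (fun i => (hx i).1) (fun i => (hy i).1)
      (fun j => .inr (.inl ⟨j, rfl⟩)) (fun j => .inr (.inr ⟨j, rfl⟩))) |>.congr fun w _ => ?_
    rw [ratio_antisymm z w, neg_neg]
  refine hrat.integral_eq (fun a ha => ?_) (fun a ha => ?_) fun a ha => ?_
  · rcases hSn a ha with rfl | h
    · exact h0.1
    · exact fun h' => (hC a h').not_gt h
  · rcases hSn a ha with rfl | h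
    · exact notMem_circleContour hr.le (by simpa using hr.ne)
    · exact notMem_circleContour hr.le (by linarith : ‖a‖ > r).ne'
  · rcases hSn a ha with rfl | h
    · rw [h0.2, circleContour_winding_zero hr]
    · rw [circleContour_winding_of_gt hr.le (hr1.trans h),
        C.winding_eq_zero_of_lt_norm fun w hw => (hC w hw).trans h]

end Factors


/-! ### The kernel as a matrix of integrals -/

/-- The normalised rotation invariant measure on the circle of radius `r` around `0`. -/
noncomputable def circleMeasure (r : ℝ) : Measure ℂ :=
  Measure.map (circleContour r).toFun (volume.restrict (Set.Ioc (0 : ℝ) 1))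

lemma continuous_circleContour (r : ℝ) : Continuous (circleContour r).toFun := by
  change Continuous fun u : ℝ => (r : ℂ) * Complex.exp (2 * Real.pi * Complex.I * u)
  fun_prop

instance (r : ℝ) : IsProbabilityMeasure (circleMeasure r) := by
  have : IsProbabilityMeasure (volume.restrict (Set.Ioc (0 : ℝ) 1)) := ⟨by simp⟩
  exact Measure.isProbabilityMeasure_map (continuous_circleContour r).aemeasurable

lemma circleContour_integral_eq {r : ℝ} {f : ℂ → ℂ} (hf : Measurable f) :
    (circleContour r).integral f =
      2 * Real.pi * Complex.I * ∫ z, f z * z ∂circleMeasure r := by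
  rw [circleContour_integral, intervalIntegral.integral_of_le zero_le_one, circleMeasure,
    integral_map (continuous_circleContour r).aemeasurable (f := fun z => f z * z)
      (hf.mul measurable_id).aestronglyMeasurable]

lemma ae_circleMeasure {r : ℝ} (hr : 0 ≤ r) : ∀ᵐ z ∂circleMeasure r, ‖z‖ = r := by
  rw [circleMeasure, ae_map_iff (continuous_circleContour r).aemeasurable
    (measurableSet_eq_fun measurable_norm measurable_const)]
  exact Eventually.of_forall fun u => norm_circleContour hr u

lemma integral_zpow_circleMeasure {r : ℝ} (hr : 0 < r) (m : ℤ) :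
    ∫ z, z ^ m ∂circleMeasure r = if m = 0 then 1 else 0 := by
  have h0 : (0 : ℂ) ∉ (circleContour r).image :=
    notMem_circleContour hr.le (by simpa using hr.ne)
  have h1 := (circleContour r).integral_sub_zpow_eq h0 (m - 1)
  simp only [sub_zero] at h1
  rw [circleContour_integral_eq (f := fun z => z ^ (m - 1)) (by fun_prop), circleContour_winding_zero hr] at h1
  have h2 : ∫ z, z ^ (m - 1) * z ∂circleMeasure r = ∫ z, z ^ m ∂circleMeasure r := by
    refine integral_congr_ae ?_
    filter_upwards [ae_circleMeasure hr.le] with z hz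
    have : z ≠ 0 := by
      rintro rfl
      simp at hz
      linarith
    rw [← zpow_add_one₀ this, sub_add_cancel]
  have h3 : (2 * Real.pi * Complex.I : ℂ) ≠ 0 := Complex.two_pi_I_ne_zero
  rw [h2] at h1
  refine mul_left_cancel₀ h3 (h1.trans ?_)
  simp only [show m - 1 = -1 ↔ m = 0 by omega]
  split_ifs <;> simp

section

variable {n : ℕ} {x y : Fin n → ℝ}

lemma measurable_innerFactor (t : ℤ) : Measurable (innerFactor x y t) := by
  unfold innerFactor
  fun_prop

lemma kernel11_integrand (t t' : ℤ) (z w : ℂ) :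
    (z - w) / ((z ^ 2 - 1) * (w ^ 2 - 1) * (z * w - 1)) *
      (∏ i : Fin n,
        ((1 - z⁻¹ * (x i : ℂ)) * (1 - w⁻¹ * (x i : ℂ)) *
            (1 - z⁻¹ * (y i : ℂ)) * (1 - w⁻¹ * (y i : ℂ))) /
          ((1 - z * (x i : ℂ)) * (1 - w * (x i : ℂ)))) *
      (1 / (z ^ t * w ^ t')) =
    -ratio z w * (outerFactor x y t z * outerFactor x y t' w) := by
  rw [ratio, outerFactor, outerFactor, zpow_neg, zpow_neg, ← neg_sub (1 : ℂ) (z * w)]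
  simp only [Finset.prod_mul_distrib, div_eq_mul_inv, mul_inv, inv_neg]
  ring

lemma kernel12_integrand (t t' : ℤ) (z w : ℂ) :
    (z - w) / (w * (z ^ 2 - 1) * (z * w - 1)) *
      (∏ i : Fin n,
        ((1 - w⁻¹ * (x i : ℂ)) * (1 - z⁻¹ * (x i : ℂ)) * (1 - z⁻¹ * (y i : ℂ))) /
          ((1 - z * (x i : ℂ)) * (1 - w * (x i : ℂ)) * (1 - w * (y i : ℂ)))) *
      (1 / (z ^ t * w ^ t')) =
    -ratio z w * (outerFactor x y t z * innerFactor x y t' w) := by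
  rw [ratio, outerFactor, innerFactor, zpow_neg, zpow_neg, ← neg_sub (1 : ℂ) (z * w)]
  simp only [Finset.prod_mul_distrib, div_eq_mul_inv, mul_inv, inv_neg]
  ring

lemma kernel22_integrand (t t' : ℤ) (z w : ℂ) :
    (z - w) / (z * w * (z * w - 1)) *
      (∏ i : Fin n,
        ((1 - z⁻¹ * (x i : ℂ)) * (1 - w⁻¹ * (x i : ℂ))) /
          ((1 - z * (x i : ℂ)) * (1 - w * (x i : ℂ)) *
            (1 - z * (y i : ℂ)) * (1 - w * (y i : ℂ)))) *
      (1 / (z ^ t * w ^ t')) =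
    -ratio z w * (innerFactor x y t z * innerFactor x y t' w) := by
  rw [ratio, innerFactor, innerFactor, zpow_neg, zpow_neg, ← neg_sub (1 : ℂ) (z * w)]
  simp only [Finset.prod_mul_distrib, div_eq_mul_inv, mul_inv, inv_neg]
  ring

lemma continuousOn_ratio {U V : Set ℂ} (h : ∀ z ∈ U, ∀ w ∈ V, z * w ≠ 1) :
    ContinuousOn (fun p : ℂ × ℂ => ratio p.1 p.2) (U ×ˢ V) := by
  refine ContinuousOn.div (by fun_prop) (by fun_prop) fun p hp => ?_
  exact sub_ne_zero.2 (h _ hp.1 _ hp.2).symm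

lemma continuousOn_innerFactor (t : ℤ) {U : Set ℂ} (h0 : (0 : ℂ) ∉ U)
    (hx : ∀ i, 0 < x i) (hy : ∀ i, 0 < y i)
    (hxU : ∀ i, (x i : ℂ)⁻¹ ∉ U) (hyU : ∀ i, (y i : ℂ)⁻¹ ∉ U) :
    ContinuousOn (innerFactor x y t) U := by
  refine (isRat_innerFactor (S := Uᶜ) t h0 hx hy hxU hyU).continuousOn fun z hz hz' => hz' hz

lemma continuousOn_outerFactor (t : ℤ) {U : Set ℂ} (hU : ∀ z ∈ U, 1 < ‖z‖)
    (hx : ∀ i, 0 < x i) (hxU : ∀ i, (x i : ℂ)⁻¹ ∉ U) :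
    ContinuousOn (outerFactor x y t) U := by
  have hS : ∀ a : ℂ, ‖a‖ ≤ 1 → a ∈ Uᶜ := fun a ha h => (hU a h).not_ge ha
  have h0 : (0 : ℂ) ∈ Uᶜ := hS _ (by simp)
  refine IsRat.continuousOn (S := Uᶜ) ?_ fun z hz hz' => hz' hz
  refine ((isRat_outerNumerator (x := x) (y := y) t h0 (hS _ (by simp)) (hS _ (by simp))).mul
    (IsRat.prod Finset.univ h0 fun i _ => IsRat.inv_sub (hxU i))).congr fun z _ => ?_
  exact outerFactor_eq t hx z

variable {d : ℕ} (t : Fin d → ℤ)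

/-- The points `1 / x_i` carry the outer variables, and a small circle the inner ones. -/
noncomputable def nodeMeasure (x : Fin n → ℝ) (r : ℝ) (b : Fin d × Fin 2) : Measure ℂ :=
  if b.2 = 0 then ∑ i, Measure.dirac (x i : ℂ)⁻¹ else circleMeasure r

/-- The weights of the variables: the residues of `outerFactor`, and `-w * innerFactor w`. -/
noncomputable def nodeWeight (x y : Fin n → ℝ) (t : Fin d → ℤ) (b : Fin d × Fin 2) (z : ℂ) : ℂ :=
  if b.2 = 0 then ∑ i, if z = (x i : ℂ)⁻¹ then outerResidue x y (t b.1) i else 0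
  else -(z * innerFactor x y (t b.1) z)

variable {t}

lemma nodeWeight_zero (hinj : Function.Injective x) (k : Fin d) (i : Fin n) :
    nodeWeight x y t (k, 0) (x i : ℂ)⁻¹ = outerResidue x y (t k) i := by
  rw [nodeWeight, if_pos rfl, Finset.sum_eq_single i]
  · simp
  · intro j _ hj
    rw [if_neg]
    intro h
    exact hj (hinj (by exact_mod_cast (inv_injective h).symm))
  · simp

lemma nodeWeight_one (k : Fin d) (z : ℂ) :
    nodeWeight x y t (k, 1) z = -(z * innerFactor x y (t k) z) := by
  simp [nodeWeight]

lemma measurable_nodeWeight (b : Fin d × Fin 2) : Measurable (nodeWeight x y t b) := by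
  unfold nodeWeight
  split_ifs
  · refine Finset.measurable_sum _ fun i _ => ?_
    exact Measurable.ite (measurableSet_singleton _) measurable_const measurable_const
  · exact (measurable_id.mul (measurable_innerFactor _)).neg

instance (r : ℝ) (b : Fin d × Fin 2) : IsFiniteMeasure (nodeMeasure x r b) := by
  unfold nodeMeasure
  split_ifs <;> infer_instance

lemma integral_nodeMeasure_zero {r : ℝ} (k : Fin d) (f : ℂ → ℂ) :
    ∫ z, f z ∂nodeMeasure x r (k, 0) = ∑ i, f (x i : ℂ)⁻¹ := by
  rw [nodeMeasure, if_pos rfl, integral_finsetSum_measure fun i _ => integrable_dirac (by simp)]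
  simp

lemma nodeMeasure_one {r : ℝ} (k : Fin d) : nodeMeasure x r (k, 1) = circleMeasure r := by
  simp [nodeMeasure]

end


section

variable {n d : ℕ} {x y : Fin n → ℝ} {t : Fin d → ℤ} {r : ℝ}

/-- The set which carries `nodeMeasure`. -/
def nodeSet (x : Fin n → ℝ) (r : ℝ) (b : Fin d × Fin 2) : Set ℂ :=
  if b.2 = 0 then Set.range fun i => (x i : ℂ)⁻¹ else Metric.sphere 0 r

lemma norm_inv_ofReal {a : ℝ} (ha : 0 < a) : ‖(a : ℂ)⁻¹‖ = a⁻¹ := by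
  rw [norm_inv, Complex.norm_real, Real.norm_of_nonneg ha.le]

lemma isCompact_nodeSet (b : Fin d × Fin 2) : IsCompact (nodeSet x r b) := by
  unfold nodeSet
  split_ifs
  · exact (Set.finite_range _).isCompact
  · exact isCompact_sphere 0 r

lemma ae_nodeSet (hr : 0 ≤ r) (b : Fin d × Fin 2) : ∀ᵐ z ∂nodeMeasure x r b, z ∈ nodeSet x r b := by
  unfold nodeMeasure nodeSet
  split_ifs with h
  · rw [ae_iff]
    simp
  · simpa using ae_circleMeasure hr

/-- The cross ratios of the integration variables have no singularities: for `r < x_i < 1` the product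
of two of them has norm `> 1` or `< 1`. -/
lemma mul_ne_one_of_mem_nodeSet (hx : ∀ i, 0 < x i ∧ x i < 1) (hr : 0 < r) (hrx : ∀ i, r < x i)
    (hr1 : r < 1) {a b : Fin d × Fin 2} {z w : ℂ} (hz : z ∈ nodeSet x r a)
    (hw : w ∈ nodeSet x r b) : z * w ≠ 1 := by
  have h1 : ∀ i, 1 < (x i)⁻¹ := fun i => (one_lt_inv₀ (hx i).1).2 (hx i).2
  have hlt : ∀ i, (x i)⁻¹ * r < 1 := fun i => by
    rw [inv_mul_lt_iff₀ (hx i).1, mul_one]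
    exact hrx i
  intro h
  have h' := congrArg norm h
  rw [norm_mul, norm_one] at h'
  unfold nodeSet at hz hw
  split_ifs at hz hw
  · obtain ⟨i, rfl⟩ := hz
    obtain ⟨j, rfl⟩ := hw
    simp only [norm_inv_ofReal (hx _).1] at h'
    nlinarith [h1 i, h1 j]
  · obtain ⟨i, rfl⟩ := hz
    simp only [norm_inv_ofReal (hx _).1, mem_sphere_zero_iff_norm.1 hw] at h'
    exact (hlt i).ne h'
  · obtain ⟨i, rfl⟩ := hw
    simp only [norm_inv_ofReal (hx _).1, mem_sphere_zero_iff_norm.1 hz] at h'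
    rw [mul_comm] at h'
    exact (hlt i).ne h'
  · rw [mem_sphere_zero_iff_norm.1 hw, mem_sphere_zero_iff_norm.1 hz] at h'
    nlinarith

/-- The weights are bounded on the compact carriers of the measures. -/
lemma exists_nodeWeight_le (hx : ∀ i, 0 < x i ∧ x i < 1) (hy : ∀ i, 0 < y i ∧ y i < 1)
    (hr : 0 < r) (hr1 : r < 1) (b : Fin d × Fin 2) :
    ∃ M, ∀ z ∈ nodeSet x r b, ‖nodeWeight x y t b z‖ ≤ M := by
  have hb := isCompact_nodeSet (x := x) (r := r) b
  obtain ⟨k, m⟩ := b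
  fin_cases m
  · obtain ⟨M, hM⟩ := ((Set.finite_range fun i => (x i : ℂ)⁻¹).image
      fun z => ‖nodeWeight x y t (k, 0) z‖).bddAbove
    exact ⟨M, fun z hz => hM ⟨z, by simpa [nodeSet] using hz, rfl⟩⟩
  · refine hb.exists_bound_of_continuousOn ?_
    have h : nodeWeight x y t (k, 1) = fun z => -(z * innerFactor x y (t k) z) :=
      funext fun z => nodeWeight_one k z
    have hS : ∀ a : ℂ, ‖a‖ ≠ r → a ∉ nodeSet x r ((k, 1) : Fin d × Fin 2) := fun a ha hz =>
      ha (by simpa [nodeSet] using hz)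
    refine ContinuousOn.congr (f := fun z => -(z * innerFactor x y (t k) z)) ?_
      fun z _ => nodeWeight_one k z
    refine (continuousOn_id.mul (continuousOn_innerFactor _ (hS _ (by simpa using hr.ne))
      (fun i => (hx i).1) (fun i => (hy i).1) (fun i => hS _ ?_) fun i => hS _ ?_)).neg
    · rw [norm_inv_ofReal (hx i).1]
      exact (hr1.trans ((one_lt_inv₀ (hx i).1).2 (hx i).2)).ne'
    · rw [norm_inv_ofReal (hy i).1]
      exact (hr1.trans ((one_lt_inv₀ (hy i).1).2 (hy i).2)).ne'

lemma integrable_node (hx : ∀ i, 0 < x i ∧ x i < 1) (hy : ∀ i, 0 < y i ∧ y i < 1)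
    (hr : 0 < r) (hrx : ∀ i, r < x i) (hr1 : r < 1) (a b : Fin d × Fin 2) :
    Integrable (fun p : ℂ × ℂ => -ratio p.1 p.2 * (nodeWeight x y t a p.1 * nodeWeight x y t b p.2))
      ((nodeMeasure x r a).prod (nodeMeasure x r b)) := by
  obtain ⟨A, hA⟩ := exists_nodeWeight_le (t := t) hx hy hr hr1 a
  obtain ⟨B, hB⟩ := exists_nodeWeight_le (t := t) hx hy hr hr1 b
  obtain ⟨R, hR⟩ := ((isCompact_nodeSet (x := x) (r := r) a).prod
    (isCompact_nodeSet (x := x) (r := r) b)).exists_bound_of_continuousOn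
    (continuousOn_ratio fun z hz w hw => mul_ne_one_of_mem_nodeSet hx hr hrx hr1 hz hw)
  refine Integrable.of_bound (C := R * (A * B)) ?_ ?_
  · refine Measurable.aestronglyMeasurable ?_
    exact measurable_ratio.neg.mul (((measurable_nodeWeight a).comp measurable_fst).mul
      ((measurable_nodeWeight b).comp measurable_snd))
  · have h1 := Measure.quasiMeasurePreserving_fst (μ := nodeMeasure x r a) (ν := nodeMeasure x r b)
      |>.ae (ae_nodeSet hr.le a)
    have h2 := Measure.quasiMeasurePreserving_snd (μ := nodeMeasure x r a) (ν := nodeMeasure x r b)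
      |>.ae (ae_nodeSet hr.le b)
    filter_upwards [h1, h2] with p hp1 hp2
    have h3 := hR p ⟨hp1, hp2⟩
    have h4 := hA _ hp1
    have h5 := hB _ hp2
    rw [norm_mul, norm_neg, norm_mul]
    have h6 := (norm_nonneg _).trans h3
    have h7 := (norm_nonneg _).trans h4
    gcongr

variable (y t r) in
/-- The entries of the kernel, as integrals against the measures `nodeMeasure`. -/
noncomputable def nodeIntegral (x : Fin n → ℝ) (a b : Fin d × Fin 2) : ℂ :=
  ∫ z, ∫ w, -ratio z w * (nodeWeight x y t a z * nodeWeight x y t b w) ∂nodeMeasure x r b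
    ∂nodeMeasure x r a

lemma nodeIntegral_antisymm (hx : ∀ i, 0 < x i ∧ x i < 1) (hy : ∀ i, 0 < y i ∧ y i < 1)
    (hr : 0 < r) (hrx : ∀ i, r < x i) (hr1 : r < 1) (a b : Fin d × Fin 2) :
    nodeIntegral y t r x b a = -nodeIntegral y t r x a b := by
  rw [nodeIntegral, nodeIntegral, integral_integral_swap (integrable_node hx hy hr hrx hr1 b a),
    ← integral_neg]
  congr 1
  funext z
  rw [← integral_neg]
  congr 1
  funext w
  rw [ratio_antisymm w z]
  ring

/-- Both contours are collapsed to the points `1 / x_i`. -/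
lemma kernel11_eq (hn : 0 < n) (hinj : Function.Injective x)
    (hx : ∀ i, 0 < x i ∧ x i < 1) {C₁ C₂ : ClosedContour}
    (hC₁ : (∀ z ∈ C₁.image, 1 < ‖z‖) ∧ C₁.Excludes 0 ∧ ∀ i, C₁.Encloses ((x i : ℂ)⁻¹))
    (hC₂ : (∀ w ∈ C₂.image, 1 < ‖w‖) ∧ C₂.Excludes 0 ∧ ∀ i, C₂.Encloses ((x i : ℂ)⁻¹))
    (k l : Fin d) :
    kernel11 x y t C₁ C₂ k l = nodeIntegral y t r x (k, 0) (l, 0) := by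
  have h1 : ∀ j, 1 < ‖(x j : ℂ)⁻¹‖ := fun j => by
    rw [norm_inv_ofReal (hx j).1]
    exact (one_lt_inv₀ (hx j).1).2 (hx j).2
  have hne : ∀ j, (x j : ℂ)⁻¹ ≠ 0 := fun j => inv_ne_zero (by exact_mod_cast (hx j).1.ne')
  have hmul : ∀ z w : ℂ, 1 < ‖z‖ → 1 < ‖w‖ → 1 < ‖z * w‖ := fun z w hz hw => by
    rw [norm_mul]
    nlinarith
  rw [kernel11, doubleIntegral]
  simp only [kernel11_integrand]
  have e1 : C₁.integral (fun z => C₂.integral fun w =>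
      -ratio z w * (outerFactor x y (t k) z * outerFactor x y (t l) w)) =
      C₁.integral fun z => ∑ j, (2 * Real.pi * Complex.I * outerResidue x y (t l) j) *
        (-ratio z (x j : ℂ)⁻¹ * outerFactor x y (t k) z) := by
    refine C₁.integral_congr fun z hz => ?_
    have hz1 := hC₁.1 z hz
    have hz0 : z ≠ 0 := by
      rintro rfl
      simp at hz1
      linarith
    have h := integral_ratio_outerFactor (y := y) (t l) hn hinj hx hC₂.1 hC₂.2.1.2 hC₂.2.2 hz0
      fun w hw => hmul _ _ (hC₂.1 w hw) hz1
    have e : ∀ w, -ratio z w * (outerFactor x y (t k) z * outerFactor x y (t l) w) =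
        (-outerFactor x y (t k) z) * (-ratio w z * outerFactor x y (t l) w) := fun w => by
      rw [ratio_antisymm z w]
      ring
    simp only [e, C₂.integral_const_mul, h, Finset.mul_sum]
    refine Finset.sum_congr rfl fun j _ => ?_
    rw [ratio_antisymm _ z]
    ring
  rw [e1, C₁.integral_finsetSum]
  · simp only [C₁.integral_const_mul, integral_ratio_outerFactor (y := y) (t k) hn hinj hx hC₁.1
      hC₁.2.1.2 hC₁.2.2 (hne _) fun z hz => hmul _ _ (hC₁.1 z hz) (h1 _)]
    rw [nodeIntegral, integral_nodeMeasure_zero]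
    simp only [integral_nodeMeasure_zero, nodeWeight_zero hinj, Finset.mul_sum]
    rw [Finset.sum_comm]
    refine Finset.sum_congr rfl fun i _ => Finset.sum_congr rfl fun j _ => ?_
    have := Complex.two_pi_I_ne_zero
    field_simp
  · intro j _
    refine continuousOn_const.mul (ContinuousOn.mul (ContinuousOn.neg ?_) (continuousOn_outerFactor _ hC₁.1
      (fun i => (hx i).1) fun i => (hC₁.2.2 i).1))
    refine ContinuousOn.div (by fun_prop) (by fun_prop) fun z hz => ?_
    refine sub_ne_zero.2 fun h => ?_
    have := hmul _ _ (hC₁.1 z hz) (h1 j)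
    rw [← h, norm_one] at this
    exact lt_irrefl _ this

/-- The `z`-contour is collapsed to the points `1 / x_i` first, after interchanging the integrals; the
`w`-contour is then exchanged for a small circle. -/
lemma kernel12_eq (hn : 0 < n) (hinj : Function.Injective x)
    (hx : ∀ i, 0 < x i ∧ x i < 1) (hy : ∀ i, 0 < y i ∧ y i < 1) (hr : 0 < r) (hrx : ∀ i, r < x i)
    (ht : ∀ k, 1 ≤ t k + 2 * n) {C₃ C₄ : ClosedContour}
    (hC₃ : (∀ z ∈ C₃.image, 1 < ‖z‖) ∧ C₃.Excludes 0 ∧ ∀ i, C₃.Encloses ((x i : ℂ)⁻¹))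
    (hC₃₄ : ∀ z ∈ C₃.image, ∀ w ∈ C₄.image, 1 < ‖z * w‖)
    (hC₄ : C₄.Excludes 0 ∧ ∀ i, C₄.Encloses ((x i : ℂ)⁻¹) ∧ C₄.Encloses ((y i : ℂ)⁻¹))
    (k l : Fin d) :
    kernel12 x y t C₃ C₄ k l = nodeIntegral y t r x (k, 0) (l, 1) := by
  have hne : ∀ w ∈ C₄.image, w ≠ 0 := fun w hw h => hC₄.1.1 (h ▸ hw)
  -- If `x i` were on `C₄`, then `C₃` would not wind around `1 / x i`.
  have hxC : ∀ i, (x i : ℂ) ∉ C₄.image := fun i hi => by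
    have := winding_inv_eq_zero hC₃.2.1.2 (hne _ hi) fun z hz => hC₃₄ z hz _ hi
    rw [(hC₃.2.2 i).2] at this
    exact one_ne_zero this
  have hinner : ContinuousOn (innerFactor x y (t l)) C₄.image :=
    continuousOn_innerFactor _ hC₄.1.1 (fun i => (hx i).1) (fun i => (hy i).1)
      (fun i => (hC₄.2 i).1.1) fun i => (hC₄.2 i).2.1
  have houter : ContinuousOn (outerFactor x y (t k)) C₃.image :=
    continuousOn_outerFactor _ hC₃.1 (fun i => (hx i).1) fun i => (hC₃.2.2 i).1
  rw [kernel12]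
  simp only [kernel12_integrand]
  rw [doubleIntegral_swap, doubleIntegral]
  swap
  · refine (continuousOn_ratio fun z hz w hw h => ?_).neg.mul
      ((houter.comp continuousOn_fst fun p hp => hp.1).mul
        (hinner.comp continuousOn_snd fun p hp => hp.2))
    have := hC₃₄ z hz w hw
    rw [h, norm_one] at this
    exact lt_irrefl _ this
  have e1 : C₄.integral (fun w => C₃.integral fun z =>
      -ratio z w * (outerFactor x y (t k) z * innerFactor x y (t l) w)) =
      C₄.integral fun w => ∑ i, (2 * Real.pi * Complex.I * outerResidue x y (t k) i) *
        (-ratio (x i : ℂ)⁻¹ w * innerFactor x y (t l) w) := by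
    refine C₄.integral_congr fun w hw => ?_
    have h := integral_ratio_outerFactor (y := y) (t k) hn hinj hx hC₃.1 hC₃.2.1.2 hC₃.2.2
      (hne w hw) fun z hz => hC₃₄ z hz w hw
    have e : ∀ z, -ratio z w * (outerFactor x y (t k) z * innerFactor x y (t l) w) =
        innerFactor x y (t l) w * (-ratio z w * outerFactor x y (t k) z) := fun z => by ring
    simp only [e, C₃.integral_const_mul, h, Finset.mul_sum]
    refine Finset.sum_congr rfl fun j _ => ?_
    ring
  rw [e1, C₄.integral_finsetSum]
  · have hm : ∀ i, Measurable fun w => -ratio (x i : ℂ)⁻¹ w * innerFactor x y (t l) w := fun i =>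
      ((measurable_ratio.comp measurable_prodMk_left).neg).mul (measurable_innerFactor _)
    have h2 : ∀ i, C₄.integral (fun w => -ratio (x i : ℂ)⁻¹ w * innerFactor x y (t l) w) =
        -(2 * Real.pi * Complex.I * ∫ w, -ratio (x i : ℂ)⁻¹ w * innerFactor x y (t l) w * w
          ∂circleMeasure r) := fun i => by
      rw [integral_ratio_innerFactor_exterior (t l) hx hy (ht l) hC₄.1 (fun i => (hC₄.2 i).1)
        (fun i => (hC₄.2 i).2) hr (hrx i) (hxC i), circleContour_integral_eq (hm i)]
    simp only [C₄.integral_const_mul, h2]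
    rw [nodeIntegral, integral_nodeMeasure_zero, nodeMeasure_one, Finset.mul_sum]
    refine Finset.sum_congr rfl fun i _ => ?_
    simp only [nodeWeight_zero hinj, nodeWeight_one]
    have e2 : ∀ w, -ratio (x i : ℂ)⁻¹ w * (outerResidue x y (t k) i *
        -(w * innerFactor x y (t l) w)) = -outerResidue x y (t k) i *
        (-ratio (x i : ℂ)⁻¹ w * innerFactor x y (t l) w * w) := fun w => by ring
    simp only [e2, integral_const_mul]
    have := Complex.two_pi_I_ne_zero
    field_simp
  · intro i _
    refine continuousOn_const.mul (ContinuousOn.mul (ContinuousOn.neg ?_) hinner)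
    refine ContinuousOn.div (by fun_prop) (by fun_prop) fun w hw => ?_
    refine sub_ne_zero.2 fun h => hxC i ?_
    have : (x i : ℂ) = w := by
      have hx0 : (x i : ℂ) ≠ 0 := by exact_mod_cast (hx i).1.ne'
      field_simp at h
      exact h
    rwa [this]

/-- Both contours are deformed to the small circle, one after the other. -/
lemma kernel22_eq (hx : ∀ i, 0 < x i ∧ x i < 1) (hy : ∀ i, 0 < y i ∧ y i < 1) (hr : 0 < r)
    (hr1 : r < 1) {C₅ C₆ : ClosedContour}
    (hC₅ : (∀ z ∈ C₅.image, ‖z‖ < 1) ∧ C₅.Encloses 0)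
    (hC₆ : (∀ w ∈ C₆.image, ‖w‖ < 1) ∧ C₆.Encloses 0) (k l : Fin d) :
    kernel22 x y t C₅ C₆ k l = nodeIntegral y t r x (k, 1) (l, 1) := by
  set Γ := circleContour r with hΓ
  have hΓ1 : ∀ z ∈ Γ.image, ‖z‖ < 1 := fun z hz => (norm_of_mem_circleContour hr.le hz).trans_lt hr1
  have hΓ0 : (0 : ℂ) ∉ Γ.image := notMem_circleContour hr.le (by simpa using hr.ne)
  have hcont : ∀ (C D : ClosedContour) (a b : ℤ), (∀ z ∈ C.image, ‖z‖ < 1) →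
      (∀ z ∈ D.image, ‖z‖ < 1) → (0 : ℂ) ∉ C.image → (0 : ℂ) ∉ D.image → ContinuousOn
      (fun p : ℂ × ℂ => -ratio p.1 p.2 * (innerFactor x y a p.1 * innerFactor x y b p.2))
      (C.image ×ˢ D.image) := by
    intro C D a b hC hD hC0 hD0
    have hf : ∀ (E : ClosedContour) (a : ℤ), (∀ z ∈ E.image, ‖z‖ < 1) → (0 : ℂ) ∉ E.image →
        ContinuousOn (innerFactor x y a) E.image := by
      intro E a hE hE0
      refine continuousOn_innerFactor _ hE0 (fun i => (hx i).1) (fun i => (hy i).1)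
        (fun i hi => ?_) fun i hi => ?_
      · have := hE _ hi
        rw [norm_inv_ofReal (hx i).1] at this
        exact this.not_gt ((one_lt_inv₀ (hx i).1).2 (hx i).2)
      · have := hE _ hi
        rw [norm_inv_ofReal (hy i).1] at this
        exact this.not_gt ((one_lt_inv₀ (hy i).1).2 (hy i).2)
    refine (continuousOn_ratio fun z hz w hw h => ?_).neg.mul
      (((hf C a hC hC0).comp continuousOn_fst fun p hp => hp.1).mul
        ((hf D b hD hD0).comp continuousOn_snd fun p hp => hp.2))
    have := mul_lt_one_of_nonneg_of_lt_one_left (norm_nonneg z) (hC z hz) (hD w hw).le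
    rw [← norm_mul, h, norm_one] at this
    exact lt_irrefl _ this
  have hinner : ∀ (C : ClosedContour) (a b : ℤ) (z : ℂ), (∀ z ∈ C.image, ‖z‖ < 1) →
      C.Encloses 0 → ‖z‖ < 1 → z ≠ 0 →
      C.integral (fun w => -ratio z w * (innerFactor x y a z * innerFactor x y b w)) =
      Γ.integral fun w => -ratio z w * (innerFactor x y a z * innerFactor x y b w) := by
    intro C a b z hC hC0 hz hz0
    have e : ∀ w, -ratio z w * (innerFactor x y a z * innerFactor x y b w) =
        innerFactor x y a z * (-ratio z w * innerFactor x y b w) := fun w => by ring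
    simp only [e, ClosedContour.integral_const_mul]
    rw [integral_ratio_innerFactor b hx hy hC hC0 hr hr1 hz hz0]
  have e1 : kernel22 x y t C₅ C₆ k l = doubleIntegral C₅ Γ fun z w =>
      -ratio z w * (innerFactor x y (t k) z * innerFactor x y (t l) w) := by
    rw [kernel22]
    simp only [kernel22_integrand, doubleIntegral]
    congr 1
    exact C₅.integral_congr fun z hz => hinner C₆ _ _ z hC₆.1 hC₆.2 (hC₅.1 z hz)
      fun h => hC₅.2.1 (h ▸ hz)
  have e2 : (doubleIntegral C₅ Γ fun z w =>
      -ratio z w * (innerFactor x y (t k) z * innerFactor x y (t l) w)) =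
      doubleIntegral Γ Γ fun z w =>
        -ratio z w * (innerFactor x y (t k) z * innerFactor x y (t l) w) := by
    rw [doubleIntegral_swap (hcont _ _ _ _ hC₅.1 hΓ1 hC₅.2.1 hΓ0),
      doubleIntegral_swap (C := Γ) (D := Γ) (F := fun z w =>
        -ratio z w * (innerFactor x y (t k) z * innerFactor x y (t l) w))
        (hcont Γ Γ (t k) (t l) hΓ1 hΓ1 hΓ0 hΓ0), doubleIntegral, doubleIntegral]
    congr 1
    refine Γ.integral_congr fun w hw => ?_
    have e : ∀ z, -ratio z w * (innerFactor x y (t k) z * innerFactor x y (t l) w) =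
        -(1 : ℂ) * (-ratio w z * (innerFactor x y (t l) w * innerFactor x y (t k) z)) := fun z => by
      rw [ratio_antisymm z w]
      ring
    simp only [e, ClosedContour.integral_const_mul]
    rw [hinner C₅ _ _ w hC₅.1 hC₅.2 (hΓ1 w hw) fun h => hΓ0 (h ▸ hw)]
  have hm : ∀ z, Measurable fun w =>
      -ratio z w * (innerFactor x y (t k) z * innerFactor x y (t l) w) := fun z =>
    ((measurable_ratio.comp measurable_prodMk_left).neg).mul
      (measurable_const.mul (measurable_innerFactor _))
  have hm2 : Measurable fun z => ∫ w,
      -ratio z w * (innerFactor x y (t k) z * innerFactor x y (t l) w) * w ∂circleMeasure r := by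
    refine (StronglyMeasurable.integral_prod_right (f := fun z w =>
      -ratio z w * (innerFactor x y (t k) z * innerFactor x y (t l) w) * w)
      (Measurable.stronglyMeasurable ?_)).measurable
    exact (measurable_ratio.neg.mul (((measurable_innerFactor _).comp measurable_fst).mul
      ((measurable_innerFactor _).comp measurable_snd))).mul measurable_snd
  rw [e1, e2, doubleIntegral]
  have e3 : ∀ z, Γ.integral (fun w =>
      -ratio z w * (innerFactor x y (t k) z * innerFactor x y (t l) w)) =
      2 * Real.pi * Complex.I * ∫ w, -ratio z w * (innerFactor x y (t k) z *
        innerFactor x y (t l) w) * w ∂circleMeasure r := fun z => circleContour_integral_eq (hm z)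
  simp only [e3]
  rw [Γ.integral_const_mul, hΓ, circleContour_integral_eq hm2, nodeIntegral, nodeMeasure_one,
    nodeMeasure_one]
  have e4 : ∀ z, (∫ w, -ratio z w * (innerFactor x y (t k) z * innerFactor x y (t l) w) * w
      ∂circleMeasure r) * z = ∫ w, -ratio z w * (nodeWeight x y t (k, 1) z *
        nodeWeight x y t (l, 1) w) ∂circleMeasure r := fun z => by
    rw [← integral_mul_const]
    congr 1
    funext w
    rw [nodeWeight_one, nodeWeight_one]
    ring
  simp only [e4]
  have := Complex.two_pi_I_ne_zero
  field_simp

lemma kernel_eq_nodeIntegral (hn : 0 < n) (hinj : Function.Injective x)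
    (hx : ∀ i, 0 < x i ∧ x i < 1) (hy : ∀ i, 0 < y i ∧ y i < 1) (hr : 0 < r) (hrx : ∀ i, r < x i)
    (hr1 : r < 1) (ht : ∀ k, 1 ≤ t k + 2 * n) {C₁ C₂ C₃ C₄ C₅ C₆ : ClosedContour}
    (hC₁ : (∀ z ∈ C₁.image, 1 < ‖z‖) ∧ C₁.Excludes 0 ∧ ∀ i, C₁.Encloses ((x i : ℂ)⁻¹))
    (hC₂ : (∀ w ∈ C₂.image, 1 < ‖w‖) ∧ C₂.Excludes 0 ∧ ∀ i, C₂.Encloses ((x i : ℂ)⁻¹))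
    (hC₃ : (∀ z ∈ C₃.image, 1 < ‖z‖) ∧ C₃.Excludes 0 ∧ ∀ i, C₃.Encloses ((x i : ℂ)⁻¹))
    (hC₃₄ : ∀ z ∈ C₃.image, ∀ w ∈ C₄.image, 1 < ‖z * w‖)
    (hC₄ : C₄.Excludes 0 ∧ ∀ i, C₄.Encloses ((x i : ℂ)⁻¹) ∧ C₄.Encloses ((y i : ℂ)⁻¹))
    (hC₅ : (∀ z ∈ C₅.image, ‖z‖ < 1) ∧ C₅.Encloses 0)
    (hC₆ : (∀ w ∈ C₆.image, ‖w‖ < 1) ∧ C₆.Encloses 0) (a b : Fin d × Fin 2) :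
    kernel x y t C₁ C₂ C₃ C₄ C₅ C₆ a b = nodeIntegral y t r x a b := by
  obtain ⟨k, i⟩ := a
  obtain ⟨l, j⟩ := b
  fin_cases i <;> fin_cases j <;> simp only [kernel, Matrix.of_apply]
  · exact kernel11_eq hn hinj hx hC₁ hC₂ k l
  · exact kernel12_eq hn hinj hx hy hr hrx ht hC₃ hC₃₄ hC₄ k l
  · refine (congrArg Neg.neg
      (kernel12_eq hn hinj hx hy hr hrx ht hC₃ hC₃₄ hC₄ l k)).trans ?_
    exact (nodeIntegral_antisymm hx hy hr hrx hr1 (l, 0) (k, 1)).symm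
  · exact kernel22_eq hx hy hr hr1 hC₅ hC₆ k l

lemma pfaffian_nodeIntegral (hx : ∀ i, 0 < x i ∧ x i < 1) (hy : ∀ i, 0 < y i ∧ y i < 1)
    (hr : 0 < r) (hrx : ∀ i, r < x i) (hr1 : r < 1) :
    pfaffian (Matrix.of (nodeIntegral y t r x)) = (-1) ^ d * ∫ P : Fin d × Fin 2 → ℂ,
      blockRatioProd P * ∏ b, nodeWeight x y t b (P b) ∂Measure.pi (nodeMeasure x r) := by
  refine pfaffian_integral_ratio measurable_nodeWeight (fun a b _ => rfl)
    (fun a b _ => integrable_node hx hy hr hrx hr1 a b) fun a b _ => ?_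
  filter_upwards [(Measure.quasiMeasurePreserving_eval (nodeMeasure x r) a).ae (ae_nodeSet hr.le a),
    (Measure.quasiMeasurePreserving_eval (nodeMeasure x r) b).ae (ae_nodeSet hr.le b)]
    with P ha hb
  exact sub_ne_zero.2 (mul_ne_one_of_mem_nodeSet hx hr hrx hr1 ha hb).symm

end


/-! ### Substituting variables in Schur's product -/

/-- The effect on `ratioProd` of replacing one variable, in a form without divisions. -/
lemma ratioProd_update {N : ℕ} (q : Fin N → ℂ) (i : Fin N) (u : ℂ) :
    ratioProd (Function.update q i u) * ∏ j ∈ Finset.univ.erase i, ratio (q i) (q j) =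
      ratioProd q * ∏ j ∈ Finset.univ.erase i, ratio u (q j) := by
  obtain _ | m := N
  · exact i.elim0
  set σ := Equiv.swap 0 i with hσ
  have hσ0 : σ 0 = i := Equiv.swap_apply_left 0 i
  have hne : ∀ c : Fin m, σ c.succ ≠ i := fun c h => by
    rw [← hσ0] at h
    exact Fin.succ_ne_zero c (σ.injective h)
  have hprod : ∀ g : Fin (m + 1) → ℂ, ∏ j ∈ Finset.univ.erase i, g j = ∏ c : Fin m, g (σ c.succ) := by
    intro g
    have h1 : ∏ j ∈ Finset.univ.erase i, g j = ∏ j, if j = i then 1 else g j := by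
      rw [← Finset.mul_prod_erase _ _ (Finset.mem_univ i), if_pos rfl, one_mul]
      exact Finset.prod_congr rfl fun j hj => (if_neg (Finset.ne_of_mem_erase hj)).symm
    rw [h1, ← Equiv.prod_comp σ, Fin.prod_univ_succ, hσ0, if_pos rfl, one_mul]
    exact Finset.prod_congr rfl fun c _ => if_neg (hne c)
  have h1 := ratioProd_perm (Function.update q i u) σ
  have h2 := ratioProd_perm q σ
  rw [ratioProd_succ] at h1 h2
  simp only [hσ0, Function.update_self, Function.update_of_ne (hne _)] at h1 h2
  rw [hprod, hprod]
  have hs : ((Equiv.Perm.sign σ : ℤ) : ℂ) ≠ 0 := by exact_mod_cast (Equiv.Perm.sign σ).ne_zero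
  refine mul_left_cancel₀ hs ?_
  rw [← mul_assoc, ← h1, ← mul_assoc, ← h2]
  ring

lemma extend_succ {α : Type*} {n d : ℕ} {I : Fin (d + 1) → Fin n} (hI : Function.Injective I)
    (u : Fin (d + 1) → α) (x : Fin n → α) :
    Function.extend I u x = Function.update
      (Function.extend (fun k : Fin d => I k.succ) (fun k => u k.succ) x) (I 0) (u 0) := by
  have hI' : Function.Injective fun k : Fin d => I k.succ := hI.comp (Fin.succ_injective d)
  funext j
  by_cases hj : ∃ k, I k = j
  · obtain ⟨k, rfl⟩ := hj
    rw [hI.extend_apply]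
    refine Fin.cases ?_ (fun k => ?_) k
    · rw [Function.update_self]
    · rw [Function.update_of_ne (hI.ne (Fin.succ_ne_zero k)),
        hI'.extend_apply (fun k => u k.succ) x k]
  · rw [Function.extend_apply' _ _ _ hj, Function.update_of_ne fun h => hj ⟨0, h.symm⟩,
      Function.extend_apply' _ _ _ fun ⟨k, hk⟩ => hj ⟨k.succ, hk⟩]

lemma prod_extend {α M : Type*} [CommMonoid M] {n d : ℕ} {I : Fin d → Fin n}
    (hI : Function.Injective I) (u : Fin d → α) (x : Fin n → α) (g : α → M) {s : Finset (Fin n)}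
    (hs : ∀ k, I k ∈ s) :
    (∏ j ∈ s, g (Function.extend I u x j)) * ∏ l, g (x (I l)) = (∏ j ∈ s, g (x j)) * ∏ l, g (u l) := by
  classical
  have hsub : Finset.univ.map ⟨I, hI⟩ ⊆ s := fun j hj => by
    obtain ⟨k, -, rfl⟩ := Finset.mem_map.1 hj
    exact hs k
  rw [← Finset.prod_sdiff hsub, ← Finset.prod_sdiff (s₁ := Finset.univ.map ⟨I, hI⟩) (s₂ := s) hsub]
  simp only [Finset.prod_map, Function.Embedding.coeFn_mk, hI.extend_apply]
  have : ∏ j ∈ s \ Finset.univ.map ⟨I, hI⟩, g (Function.extend I u x j) =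
      ∏ j ∈ s \ Finset.univ.map ⟨I, hI⟩, g (x j) := by
    refine Finset.prod_congr rfl fun j hj => ?_
    rw [Function.extend_apply']
    rintro ⟨k, rfl⟩
    simp at hj
  rw [this, mul_right_comm]

/-- The effect on `ratioProd` of replacing the variables `x (I k)` by `u k`, by induction on the
number of replacements. -/
lemma ratioProd_extend {n : ℕ} (x : Fin n → ℂ) : ∀ {d : ℕ} {I : Fin d → Fin n}
    (_ : Function.Injective I) (u : Fin d → ℂ),
    ratioProd (Function.extend I u x) *
      ((∏ k, ∏ j ∈ Finset.univ.erase (I k), ratio (x (I k)) (x j)) *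
        ∏ k, ∏ l, ratio (u k) (x (I l))) =
    ratioProd x * ((∏ k, ∏ j, ratio (u k) (x j)) *
      ∏ k, ∏ l ∈ Finset.Ioi k, -(ratio (x (I k)) (x (I l)) * ratio (u k) (u l)))
  | 0, I, _, u => by
    have : Function.extend I u x = x := funext fun j =>
      Function.extend_apply' _ _ _ fun ⟨k, _⟩ => k.elim0
    simp [this]
  | d + 1, I, hI, u => by
    have hI' : Function.Injective fun k : Fin d => I k.succ := hI.comp (Fin.succ_injective d)
    have ih := ratioProd_extend x hI' fun k => u k.succ
    have h1 := ratioProd_update (Function.extend (fun k : Fin d => I k.succ) (fun k => u k.succ) x)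
      (I 0) (u 0)
    rw [← extend_succ hI] at h1
    have hq : Function.extend (fun k : Fin d => I k.succ) (fun k => u k.succ) x (I 0) = x (I 0) :=
      Function.extend_apply' _ _ _ fun ⟨k, hk⟩ => Fin.succ_ne_zero k (hI hk)
    rw [hq] at h1
    have hmem : ∀ k : Fin d, I k.succ ∈ Finset.univ.erase (I 0) := fun k => by
      simpa using hI.ne (Fin.succ_ne_zero k)
    have hA := prod_extend hI' (fun k => u k.succ) x (ratio (x (I 0))) hmem
    have hB := prod_extend hI' (fun k => u k.succ) x (ratio (u 0)) hmem
    simp only [Fin.prod_univ_succ, Fin.prod_Ioi_zero, Fin.prod_Ioi_succ, Finset.prod_mul_distrib]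
    rw [← Finset.mul_prod_erase _ _ (Finset.mem_univ (I 0))]
    have hflip : ∏ k : Fin d, ratio (u k.succ) (x (I 0)) =
        (∏ _k : Fin d, (-1 : ℂ)) * ∏ k : Fin d, ratio (x (I 0)) (u k.succ) := by
      rw [← Finset.prod_mul_distrib]
      refine Finset.prod_congr rfl fun k _ => ?_
      rw [ratio_antisymm]
      ring
    have hneg : ∏ k : Fin d, -(ratio (x (I 0)) (x (I k.succ)) * ratio (u 0) (u k.succ)) =
        (∏ _k : Fin d, (-1 : ℂ)) * ((∏ k : Fin d, ratio (x (I 0)) (x (I k.succ))) *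
          ∏ k : Fin d, ratio (u 0) (u k.succ)) := by
      rw [← Finset.prod_mul_distrib, ← Finset.prod_mul_distrib]
      exact Finset.prod_congr rfl fun k _ => by ring
    rw [hflip, hneg]
    generalize ∏ _k : Fin d, (-1 : ℂ) = ε at *
    generalize ratioProd (Function.extend I u x) = E1 at *
    generalize ratioProd (Function.extend (fun k : Fin d => I k.succ) (fun k => u k.succ) x) = E0 at *
    generalize (∏ j ∈ Finset.univ.erase (I 0), ratio (x (I 0))
      (Function.extend (fun k : Fin d => I k.succ) (fun k => u k.succ) x j)) = A at *
    generalize (∏ j ∈ Finset.univ.erase (I 0), ratio (u 0)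
      (Function.extend (fun k : Fin d => I k.succ) (fun k => u k.succ) x j)) = B at *
    generalize (∏ j ∈ Finset.univ.erase (I 0), ratio (x (I 0)) (x j)) = A1 at *
    generalize (∏ j ∈ Finset.univ.erase (I 0), ratio (u 0) (x j)) = B1 at *
    generalize (∏ k : Fin d, ratio (x (I 0)) (x (I k.succ))) = A2 at *
    generalize (∏ k : Fin d, ratio (x (I 0)) (u k.succ)) = A3 at *
    generalize (∏ k : Fin d, ratio (u 0) (x (I k.succ))) = B2 at *
    generalize (∏ k : Fin d, ratio (u 0) (u k.succ)) = B3 at *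
    generalize ratio (u 0) (x (I 0)) = c at *
    generalize (∏ k : Fin d, ∏ j ∈ Finset.univ.erase (I k.succ), ratio (x (I k.succ)) (x j)) = P1 at *
    generalize (∏ k : Fin d, ∏ l : Fin d, ratio (u k.succ) (x (I l.succ))) = P2 at *
    generalize (∏ k : Fin d, ∏ j, ratio (u k.succ) (x j)) = P3 at *
    generalize (∏ k : Fin d, ∏ l ∈ Finset.Ioi k, -(ratio (x (I k.succ)) (x (I l.succ)) *
      ratio (u k.succ) (u l.succ))) = P4 at *
    linear_combination (-(E1 * P1 * c * B2 * ε * P2)) * hA + (P1 * c * B2 * ε * P2 * A2) * h1 +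
      (E0 * P1 * c * ε * P2 * A2) * hB + (B1 * B3 * c * ε * A2) * ih

lemma ratio_inv_inv {a b : ℂ} (ha : a ≠ 0) (hb : b ≠ 0) : ratio a⁻¹ b⁻¹ = ratio a b := by
  have h1 : a⁻¹ - b⁻¹ = (-(a⁻¹ * b⁻¹)) * (a - b) := by field_simp; ring
  have h2 : 1 - a⁻¹ * b⁻¹ = (-(a⁻¹ * b⁻¹)) * (1 - a * b) := by field_simp; ring
  rw [ratio, h1, h2, mul_div_mul_left _ _ (neg_ne_zero.2 (by positivity)), ratio]

lemma ratio_inv_left {a u : ℂ} (ha : a ≠ 0) : ratio a⁻¹ u = -(ratio u a)⁻¹ := by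
  have h1 : a⁻¹ - u = a⁻¹ * (1 - u * a) := by field_simp
  have h2 : 1 - a⁻¹ * u = -a⁻¹ * (u - a) := by field_simp; ring
  rw [ratio, h1, h2, ratio, inv_div, neg_mul, div_neg, mul_div_mul_left _ _ (inv_ne_zero ha)]

lemma ratio_inv_right {a u : ℂ} (ha : a ≠ 0) : ratio u a⁻¹ = (ratio u a)⁻¹ := by
  rw [ratio_antisymm, ratio_inv_left ha, neg_neg]

lemma prod_prod_eq_diag {d : ℕ} (F : Fin d → Fin d → ℂ) :
    ∏ k, ∏ l, F k l = (∏ k, F k k) * ∏ k, ∏ l ∈ Finset.Ioi k, F l k * F k l := by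
  rw [Finset.prod_prod_Ioi_mul_eq_prod_prod_off_diag (fun i j => F i j), Finset.prod_comm,
    ← Finset.prod_mul_distrib]
  refine Finset.prod_congr rfl fun k _ => ?_
  rw [← Finset.prod_mul_prod_compl {k}, Finset.prod_singleton]

/-- The same product of cross ratios as in `ratioProd_extend` arises from the points
`1 / a_k, u_k`. -/
lemma blockRatioProd_of_inv {d : ℕ} {a : Fin d → ℂ} (ha : ∀ k, a k ≠ 0) (u : Fin d → ℂ)
    {p : Fin d × Fin 2 → ℂ} (hp0 : ∀ k, p (k, 0) = (a k)⁻¹) (hp1 : ∀ k, p (k, 1) = u k) :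
    blockRatioProd p = (-1) ^ d * (∏ k, ∏ l, ratio (u k) (a l))⁻¹ *
      ∏ k, ∏ l ∈ Finset.Ioi k, -(ratio (a k) (a l) * ratio (u k) (u l)) := by
  have e : (-1 : ℂ) ^ d = ∏ _k : Fin d, (-1 : ℂ) := by simp
  rw [blockRatioProd_eq, prod_prod_eq_diag, e]
  simp only [hp0, hp1, ratio_inv_inv (ha _) (ha _), ratio_inv_left (ha _), ratio_inv_right (ha _)]
  simp only [mul_inv, ← Finset.prod_inv_distrib, ← Finset.prod_mul_distrib]
  refine Finset.prod_congr rfl fun k _ => ?_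
  have h : ∏ l ∈ Finset.Ioi k, ratio (a k) (a l) * -(ratio (u l) (a k))⁻¹ *
      ((ratio (u k) (a l))⁻¹ * ratio (u k) (u l)) =
      (∏ l ∈ Finset.Ioi k, (ratio (u l) (a k))⁻¹ * (ratio (u k) (a l))⁻¹) *
        ∏ l ∈ Finset.Ioi k, -(ratio (a k) (a l) * ratio (u k) (u l)) := by
    rw [← Finset.prod_mul_distrib]
    exact Finset.prod_congr rfl fun l _ => by ring
  rw [h]
  ring

/-- Configurations using the same outer point twice do not contribute to the Pfaffian. -/
lemma blockRatioProd_eq_zero {d : ℕ} {p : Fin d × Fin 2 → ℂ} {k l : Fin d} (hkl : k ≠ l)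
    (h : p (k, 0) = p (l, 0)) : blockRatioProd p = 0 := by
  wlog hlt : k < l generalizing k l
  · exact this hkl.symm h.symm (lt_of_le_of_ne (not_lt.1 hlt) hkl.symm)
  rw [blockRatioProd_eq]
  refine mul_eq_zero_of_right _ (Finset.prod_eq_zero (Finset.mem_univ k)
    (Finset.prod_eq_zero (Finset.mem_Ioi.2 hlt) ?_))
  simp [h, ratio]


/-! ### The Pfaffian as a sum over substitutions -/

section

variable {n d : ℕ} {x y : Fin n → ℝ} {t : Fin d → ℤ} {r : ℝ}

/-- The generating function of a weight. -/
noncomputable def weightGF (y : Fin n → ℝ) {N : ℕ} (v : Fin N → ℂ) : ℂ :=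
  ratioProd v * ∏ i, ∏ j, (1 - v i * y j)⁻¹

lemma mul_inv_sub_eq {a b : ℂ} (ha : a ≠ 0) (hb : b ≠ 0) :
    (1 - a * b) * (-b⁻¹) * (a⁻¹ - b⁻¹)⁻¹ = a * (ratio a b)⁻¹ := by
  have h : a⁻¹ - b⁻¹ = (-(a⁻¹ * b⁻¹)) * (a - b) := by field_simp; ring
  rw [h, ratio, mul_inv, inv_neg, mul_inv, inv_inv, inv_inv, inv_div]
  field_simp

/-- The residues are, up to elementary factors, what the generating function loses when the variable
`x_i` is removed. -/
lemma outerResidue_eq (hx : ∀ i, 0 < x i ∧ x i < 1) (t : ℤ) (i : Fin n) :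
    outerResidue x y t i = -((x i : ℂ) ^ (t + n) * (∏ j, (1 - (x i : ℂ) * y j)⁻¹)⁻¹ *
      (∏ j ∈ Finset.univ.erase i, ratio (x i) (x j))⁻¹) := by
  have hx0 : ∀ j, (x j : ℂ) ≠ 0 := fun j => by exact_mod_cast (hx j).1.ne'
  have hi : (1 : ℂ) - x i * x i ≠ 0 := by
    have : x i * x i < 1 := by nlinarith [(hx i).1, (hx i).2]
    exact_mod_cast (sub_pos.2 this).ne'
  have hcard : (Finset.univ.erase i).card + 1 = n := by
    rw [Finset.card_erase_add_one (Finset.mem_univ i), Finset.card_univ, Fintype.card_fin]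
  have e1 : ∏ j, (1 - (x i : ℂ)⁻¹⁻¹ * x j) * (1 - (x i : ℂ)⁻¹⁻¹ * y j) * (-(x j : ℂ)⁻¹) =
      (∏ j, (1 - (x i : ℂ) * y j)) * ((1 - x i * x i) * (-(x i : ℂ)⁻¹) *
        ∏ j ∈ Finset.univ.erase i, (1 - (x i : ℂ) * x j) * (-(x j : ℂ)⁻¹)) := by
    rw [Finset.mul_prod_erase Finset.univ (fun j => (1 - (x i : ℂ) * x j) * (-(x j : ℂ)⁻¹))
      (Finset.mem_univ i), ← Finset.prod_mul_distrib]
    refine Finset.prod_congr rfl fun j _ => ?_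
    rw [inv_inv]
    ring
  have e2 : (∏ j ∈ Finset.univ.erase i, (1 - (x i : ℂ) * x j) * (-(x j : ℂ)⁻¹)) *
      ∏ j ∈ Finset.univ.erase i, ((x i : ℂ)⁻¹ - (x j : ℂ)⁻¹)⁻¹ =
      (x i : ℂ) ^ (Finset.univ.erase i).card *
        (∏ j ∈ Finset.univ.erase i, ratio (x i) (x j))⁻¹ := by
    rw [← Finset.prod_const, ← Finset.prod_inv_distrib, ← Finset.prod_mul_distrib,
      ← Finset.prod_mul_distrib]
    exact Finset.prod_congr rfl fun j _ => mul_inv_sub_eq (hx0 i) (hx0 j)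
  have e3 : ((x i : ℂ)⁻¹ ^ 2 - 1)⁻¹ = (x i : ℂ) ^ 2 * (1 - (x i : ℂ) * x i)⁻¹ := by
    rw [← inv_inj, inv_inv, mul_inv, inv_inv]
    field_simp [hx0 i]
  have e4 : (x i : ℂ)⁻¹ ^ (-t) = (x i : ℂ) ^ t := by rw [inv_zpow, zpow_neg, inv_inv]
  have e5 : (x i : ℂ) ^ (t + n) =
      (x i : ℂ) ^ t * (x i : ℂ) ^ (Finset.univ.erase i).card * x i := by
    have hn : (n : ℤ) = (Finset.univ.erase i).card + 1 := by exact_mod_cast hcard.symm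
    rw [hn, ← add_assoc, zpow_add_one₀ (hx0 i), zpow_add₀ (hx0 i), zpow_natCast]
  unfold outerResidue outerNumerator
  have e6 : (∏ j, (1 - (x i : ℂ) * y j)⁻¹)⁻¹ = ∏ j, (1 - (x i : ℂ) * y j) := by
    rw [Finset.prod_inv_distrib, inv_inv]
  rw [e1, e3, e4, e5, e6]
  have := hx0 i
  generalize (∏ j, (1 - (x i : ℂ) * y j)) = Y
  generalize (∏ j ∈ Finset.univ.erase i, (1 - (x i : ℂ) * x j) * (-(x j : ℂ)⁻¹)) = U at *
  generalize (∏ j ∈ Finset.univ.erase i, ((x i : ℂ)⁻¹ - (x j : ℂ)⁻¹)⁻¹) = V at *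
  have hs := mul_inv_cancel₀ hi
  have hx1 := mul_inv_cancel₀ this
  generalize (1 - (x i : ℂ) * x i)⁻¹ = s at *
  generalize (x i : ℂ)⁻¹ = b at *
  linear_combination (-(Y * x i * x i ^ t)) * e2 - (Y * x i * x i ^ t * U * V) * hs -
    (Y * x i * x i ^ t * U * V * (1 - x i * x i) * s) * hx1

/-- The weights of the inner variables are, up to powers, what the generating function gains when
the variable `w` is added. -/
lemma nodeWeight_one_eq {w : ℂ} (hw : w ≠ 0) (k : Fin d) :
    nodeWeight x y t (k, 1) w = -(w ^ (-(t k + n)) * (∏ j, (1 - w * y j)⁻¹) *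
      ∏ j, ratio w (x j)) := by
  have e1 : ∏ j, (1 - w⁻¹ * x j) / ((1 - w * x j) * (1 - w * y j)) =
      w⁻¹ ^ n * ((∏ j, (1 - w * y j)⁻¹) * ∏ j, ratio w (x j)) := by
    rw [← Fin.prod_const, ← Finset.prod_mul_distrib, ← Finset.prod_mul_distrib]
    refine Finset.prod_congr rfl fun j _ => ?_
    have : 1 - w⁻¹ * x j = w⁻¹ * (w - x j) := by field_simp
    rw [this, ratio, div_eq_mul_inv, mul_inv, div_eq_mul_inv]
    ring
  rw [nodeWeight_one, innerFactor, e1, neg_add, zpow_add₀ hw, zpow_neg _ (n : ℤ), zpow_natCast,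
    ← inv_pow]
  have := mul_inv_cancel₀ hw
  generalize (∏ j, (1 - w * (y j : ℂ))⁻¹) = A at *
  generalize (∏ j, ratio w (x j)) = B at *
  linear_combination (-(w⁻¹ ^ n * A * B * w ^ (-t k))) * this

/-- The configuration with the outer variables `1 / x_{I k}` and the inner variables `u k`. -/
noncomputable def assemble (x : Fin n → ℝ) (I : Fin d → Fin n) (u : Fin d → ℂ)
    (b : Fin d × Fin 2) : ℂ :=
  if b.2 = 0 then (x (I b.1) : ℂ)⁻¹ else u b.1

lemma assemble_zero (I : Fin d → Fin n) (u : Fin d → ℂ) (k : Fin d) :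
    assemble x I u (k, 0) = (x (I k) : ℂ)⁻¹ := by simp [assemble]

lemma assemble_one (I : Fin d → Fin n) (u : Fin d → ℂ) (k : Fin d) :
    assemble x I u (k, 1) = u k := by simp [assemble]

lemma ratio_ofReal_ne_zero (hinj : Function.Injective x) (hx : ∀ i, 0 < x i ∧ x i < 1)
    {i j : Fin n} (hij : i ≠ j) : ratio (x i) (x j) ≠ 0 := by
  refine div_ne_zero (sub_ne_zero.2 fun h => hij (hinj (by exact_mod_cast h))) ?_
  have : x i * x j < 1 := by nlinarith [(hx i).1, (hx i).2, (hx j).1, (hx j).2]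
  exact_mod_cast (sub_pos.2 this).ne'

lemma one_sub_ofReal_mul_ne_zero {a b : ℝ} (ha : 0 < a ∧ a < 1) (hb : 0 < b ∧ b < 1) :
    (1 : ℂ) - a * b ≠ 0 := by
  have : a * b < 1 := by nlinarith [ha.1, ha.2, hb.1, hb.2]
  exact_mod_cast (sub_pos.2 this).ne'

/-- For distinct nodes, the integrand of the Pfaffian is the effect on the generating function of
substituting `u k` for the variable `x_{I k}`. -/
lemma weightGF_mul_integrand (hinj : Function.Injective x) (hx : ∀ i, 0 < x i ∧ x i < 1)
    (hy : ∀ i, 0 < y i ∧ y i < 1)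
    (hrx : ∀ i, r < x i) {I : Fin d → Fin n} (hI : Function.Injective I) {u : Fin d → ℂ}
    (hu0 : ∀ k, u k ≠ 0) (hur : ∀ k, ‖u k‖ = r) :
    weightGF y (fun i => (x i : ℂ)) * ((-1) ^ d * (blockRatioProd (assemble x I u) *
      ∏ b, nodeWeight x y t b (assemble x I u b))) =
    weightGF y (Function.extend I u fun i => (x i : ℂ)) *
      ∏ k, ((x (I k) : ℂ) ^ (t k + n) * u k ^ (-(t k + n))) := by
  have hx0 : ∀ j, (x j : ℂ) ≠ 0 := fun j => by exact_mod_cast (hx j).1.ne'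
  have hux : ∀ k j, ratio (u k) (x j) ≠ 0 := fun k j => by
    refine div_ne_zero (sub_ne_zero.2 fun h => ?_) (sub_ne_zero.2 fun h => ?_)
    · have := hur k
      rw [h, Complex.norm_real, Real.norm_of_nonneg (hx j).1.le] at this
      exact (hrx j).ne' this
    · have h1 := congrArg norm h
      rw [norm_one, norm_mul, hur, Complex.norm_real, Real.norm_of_nonneg (hx j).1.le] at h1
      nlinarith [hrx j, (hx j).1, (hx j).2]
  have h1 := ratioProd_extend (fun i => (x i : ℂ)) hI u
  have h2 := blockRatioProd_of_inv (fun k => hx0 (I k)) u (assemble_zero (x := x) I u)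
    (assemble_one I u)
  have h3 := prod_extend hI u (fun i => (x i : ℂ)) (fun v => ∏ j, (1 - v * y j)⁻¹)
    (s := Finset.univ) fun k => Finset.mem_univ _
  have hε : ((-1 : ℂ) ^ d) * (-1) ^ d = 1 := by rw [← mul_pow]; simp
  have e : (-1 : ℂ) ^ d = ∏ _k : Fin d, (-1 : ℂ) := by simp
  have h4 : ∏ b, nodeWeight x y t b (assemble x I u b) =
      (∏ k, (x (I k) : ℂ) ^ (t k + n)) * (∏ k, ∏ j, (1 - (x (I k) : ℂ) * y j)⁻¹)⁻¹ *
        (∏ k, ∏ j ∈ Finset.univ.erase (I k), ratio (x (I k)) (x j))⁻¹ *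
      ((∏ k, u k ^ (-(t k + n))) * (∏ k, ∏ j, (1 - u k * y j)⁻¹) * ∏ k, ∏ j, ratio (u k) (x j)) := by
    rw [Fintype.prod_prod_type]
    simp only [Fin.prod_univ_two, assemble_zero, assemble_one, nodeWeight_zero hinj,
      outerResidue_eq hx, nodeWeight_one_eq (hu0 _)]
    rw [← Finset.prod_inv_distrib, ← Finset.prod_inv_distrib, ← Finset.prod_mul_distrib,
      ← Finset.prod_mul_distrib, ← Finset.prod_mul_distrib, ← Finset.prod_mul_distrib,
      ← Finset.prod_mul_distrib]
    exact Finset.prod_congr rfl fun k _ => by ring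
  have hA : (∏ k, ∏ j ∈ Finset.univ.erase (I k), ratio (x (I k)) (x j)) ≠ 0 :=
    Finset.prod_ne_zero_iff.2 fun k _ => Finset.prod_ne_zero_iff.2 fun j hj =>
      ratio_ofReal_ne_zero hinj hx (Finset.ne_of_mem_erase hj).symm
  have hB : (∏ k, ∏ l, ratio (u k) (x (I l))) ≠ 0 :=
    Finset.prod_ne_zero_iff.2 fun k _ => Finset.prod_ne_zero_iff.2 fun j _ => hux _ _
  have hH : (∏ k, ∏ j, (1 - (x (I k) : ℂ) * y j)⁻¹) ≠ 0 :=
    Finset.prod_ne_zero_iff.2 fun k _ => Finset.prod_ne_zero_iff.2 fun j _ =>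
      inv_ne_zero (one_sub_ofReal_mul_ne_zero (hx _) (hy j))
  rw [h4, h2, weightGF, weightGF, Finset.prod_mul_distrib]
  generalize (∏ k, ∏ j ∈ Finset.univ.erase (I k), ratio (x (I k)) (x j)) = A at *
  generalize (∏ k, ∏ l, ratio (u k) (x (I l))) = B at *
  generalize (∏ k, ∏ j, (1 - (x (I k) : ℂ) * y j)⁻¹) = H at *
  generalize (∏ k, ∏ l ∈ Finset.Ioi k, -(ratio (x (I k)) (x (I l)) * ratio (u k) (u l))) = M at *
  generalize (∏ k, ∏ j, ratio (u k) (x j)) = D at *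
  generalize (∏ k, (x (I k) : ℂ) ^ (t k + n)) = a at *
  generalize (∏ k, u k ^ (-(t k + n))) = c at *
  generalize (∏ k, ∏ j, (1 - u k * y j)⁻¹) = Hu at *
  generalize ratioProd (Function.extend I u fun i => (x i : ℂ)) = E at *
  generalize ratioProd (fun i => (x i : ℂ)) = X at *
  generalize (∏ i, ∏ j, (1 - (x i : ℂ) * y j)⁻¹) = Hx at *
  generalize (∏ i, ∏ j, (1 - Function.extend I u (fun i => (x i : ℂ)) i * y j)⁻¹) = He at *
  field_simp
  linear_combination (X * Hx * M * a * c * Hu * D) * hε - (a * c * He * H) * h1 -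
    (a * c * X * D * M) * h3

end


section

variable {n d : ℕ} {x y : Fin n → ℝ} {t : Fin d → ℤ} {r : ℝ}

lemma measurable_assemble (I : Fin d → Fin n) : Measurable (assemble x I) := by
  refine measurable_pi_iff.2 fun b => ?_
  unfold assemble
  split_ifs
  · exact measurable_const
  · exact measurable_pi_apply _

/-- Choosing the outer variables among the points `1 / x_i` splits the product measure. -/
lemma pi_nodeMeasure : Measure.pi (nodeMeasure x r : Fin d × Fin 2 → Measure ℂ) =
    ∑ I : Fin d → Fin n, Measure.map (assemble x I) (Measure.pi fun _ : Fin d => circleMeasure r) := by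
  classical
  refine (Measure.pi_eq fun s hs => ?_)
  have h1 : ∀ I : Fin d → Fin n, Measure.map (assemble x I)
      (Measure.pi fun _ : Fin d => circleMeasure r) (Set.univ.pi s) =
      (∏ k, (s (k, 0)).indicator 1 (x (I k) : ℂ)⁻¹) * ∏ k, circleMeasure r (s (k, 1)) := by
    intro I
    rw [Measure.map_apply (measurable_assemble I) (MeasurableSet.univ_pi hs)]
    by_cases h : ∀ k, (x (I k) : ℂ)⁻¹ ∈ s (k, 0)
    · have e : assemble x I ⁻¹' Set.univ.pi s = Set.univ.pi fun k => s (k, 1) := by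
        ext u
        simp only [Set.mem_preimage, Set.mem_pi, Set.mem_univ, true_implies, Prod.forall,
          Fin.forall_fin_two, assemble_zero, assemble_one]
        exact ⟨fun h' k => (h' k).2, fun h' k => ⟨h k, h' k⟩⟩
      rw [e, Measure.pi_pi, Finset.prod_congr rfl fun k _ => Set.indicator_of_mem (h k) 1]
      simp
    · obtain ⟨k, hk⟩ := not_forall.1 h
      have e : assemble x I ⁻¹' Set.univ.pi s = ∅ := by
        ext u
        simp only [Set.mem_preimage, Set.mem_pi, Set.mem_univ, true_implies, Set.mem_empty_iff_false,
          iff_false]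
        intro h'
        have := h' (k, 0)
        rw [assemble_zero] at this
        exact hk this
      rw [e, measure_empty, Finset.prod_eq_zero (Finset.mem_univ k) (Set.indicator_of_notMem hk 1),
        zero_mul]
  rw [Measure.finsetSum_apply]
  simp only [h1, ← Finset.sum_mul, Fintype.prod_prod_type, Fin.prod_univ_two,
    Finset.prod_mul_distrib, nodeMeasure_one]
  congr 1
  have h2 : ∀ k : Fin d, nodeMeasure x r (k, 0) (s (k, 0)) =
      ∑ i, (s (k, 0)).indicator 1 (x i : ℂ)⁻¹ := fun k => by
    rw [nodeMeasure, if_pos rfl, Measure.finsetSum_apply]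
    simp only [Measure.dirac_apply' _ (hs (k, 0))]
  simp only [h2]
  rw [Finset.prod_univ_sum, Fintype.piFinset_univ]

lemma measurable_blockRatioProd : Measurable (blockRatioProd : (Fin d × Fin 2 → ℂ) → ℂ) := by
  unfold blockRatioProd ratioProd
  refine Finset.measurable_prod _ fun i _ => Finset.measurable_prod _ fun j _ => ?_
  exact measurable_ratio.comp (f := fun p : Fin d × Fin 2 → ℂ =>
    (p ((blockEquiv d).symm i), p ((blockEquiv d).symm j))) (by fun_prop)

lemma integrable_integrand (hx : ∀ i, 0 < x i ∧ x i < 1) (hy : ∀ i, 0 < y i ∧ y i < 1)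
    (hr : 0 < r) (hrx : ∀ i, r < x i) (hr1 : r < 1) :
    Integrable (fun P : Fin d × Fin 2 → ℂ => blockRatioProd P * ∏ b, nodeWeight x y t b (P b))
      (Measure.pi (nodeMeasure x r)) := by
  choose M hM using fun b => exists_nodeWeight_le (t := t) hx hy hr hr1 b
  have hK : IsCompact (Set.univ.pi fun b : Fin d × Fin 2 => nodeSet x r b) :=
    isCompact_univ_pi isCompact_nodeSet
  have hc : ContinuousOn (blockRatioProd : (Fin d × Fin 2 → ℂ) → ℂ)
      (Set.univ.pi fun b => nodeSet x r b) := by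
    unfold blockRatioProd ratioProd
    refine continuousOn_finsetProd _ fun i _ => continuousOn_finsetProd _ fun j _ => ?_
    refine ContinuousOn.div (by fun_prop) (by fun_prop) fun P hP => ?_
    exact sub_ne_zero.2 (mul_ne_one_of_mem_nodeSet hx hr hrx hr1 (hP _ trivial) (hP _ trivial)).symm
  obtain ⟨R, hR⟩ := hK.exists_bound_of_continuousOn hc
  refine Integrable.of_bound (C := R * ∏ b, M b) ?_ ?_
  · exact (measurable_blockRatioProd.mul (Finset.measurable_prod _ fun b _ =>
      (measurable_nodeWeight b).comp (measurable_pi_apply b))).aestronglyMeasurable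
  · have h : ∀ᵐ P ∂Measure.pi (nodeMeasure x r), ∀ b : Fin d × Fin 2, P b ∈ nodeSet x r b :=
      ae_all_iff.2 fun b => (Measure.quasiMeasurePreserving_eval _ b).ae (ae_nodeSet hr.le b)
    filter_upwards [h] with P hP
    have h1 := hR P fun b _ => hP b
    rw [norm_mul, norm_prod]
    refine mul_le_mul h1 (Finset.prod_le_prod (fun b _ => norm_nonneg _) fun b _ => hM b _ (hP b))
      (Finset.prod_nonneg fun b _ => norm_nonneg _) ((norm_nonneg _).trans h1)

/-- The integral of the generating function after a substitution, which extracts the terms with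
`l (I k) = t_k + n`. -/
noncomputable def extraction (x y : Fin n → ℝ) (t : Fin d → ℤ) (r : ℝ) (I : Fin d → Fin n) : ℂ :=
  ∫ u : Fin d → ℂ, weightGF y (Function.extend I u fun i => (x i : ℂ)) *
    ∏ k, ((x (I k) : ℂ) ^ (t k + n) * u k ^ (-(t k + n))) ∂Measure.pi fun _ => circleMeasure r

lemma ae_pi_circleMeasure (hr : 0 ≤ r) :
    ∀ᵐ u ∂(Measure.pi fun _ : Fin d => circleMeasure r), ∀ k, ‖u k‖ = r :=
  ae_all_iff.2 fun k => (Measure.quasiMeasurePreserving_eval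
    (fun _ : Fin d => circleMeasure r) k).ae (ae_circleMeasure hr)

lemma ne_zero_of_norm_eq {z : ℂ} (hr : 0 < r) (hz : ‖z‖ = r) : z ≠ 0 := by
  rintro rfl
  simp at hz
  linarith

open scoped Classical in
/-- Only the injective choices of outer points survive in the Pfaffian. -/
lemma weightGF_mul_pfaffian (hinj : Function.Injective x) (hx : ∀ i, 0 < x i ∧ x i < 1)
    (hy : ∀ i, 0 < y i ∧ y i < 1) (hr : 0 < r) (hrx : ∀ i, r < x i) (hr1 : r < 1) :
    weightGF y (fun i => (x i : ℂ)) * pfaffian (Matrix.of (nodeIntegral y t r x)) =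
      ∑ I : Fin d → Fin n, if Function.Injective I then extraction x y t r I else 0 := by
  have hm : Measurable fun P : Fin d × Fin 2 → ℂ =>
      blockRatioProd P * ∏ b, nodeWeight x y t b (P b) :=
    measurable_blockRatioProd.mul (Finset.measurable_prod Finset.univ fun b _ =>
      (measurable_nodeWeight b).comp (measurable_pi_apply b))
  have hint := integrable_integrand (t := t) hx hy hr hrx hr1
  rw [pi_nodeMeasure] at hint
  rw [pfaffian_nodeIntegral hx hy hr hrx hr1, pi_nodeMeasure,
    integral_finsetSum_measure (fun I hI => (integrable_finsetSum_measure.1 hint) I hI),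
    Finset.mul_sum, Finset.mul_sum]
  refine Finset.sum_congr rfl fun I _ => ?_
  rw [integral_map (measurable_assemble I).aemeasurable hm.aestronglyMeasurable,
    ← integral_const_mul, ← integral_const_mul]
  split_ifs with hI
  · refine integral_congr_ae ?_
    filter_upwards [ae_pi_circleMeasure hr.le] with u hu
    exact weightGF_mul_integrand hinj hx hy hrx hI (fun k => ne_zero_of_norm_eq hr (hu k)) hu
  · obtain ⟨k, l, hkl, hne⟩ : ∃ k l, I k = I l ∧ k ≠ l := by
      simpa [Function.Injective] using hI
    refine integral_eq_zero_of_ae (Eventually.of_forall fun u => ?_)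
    have : blockRatioProd (assemble x I u) = 0 :=
      blockRatioProd_eq_zero hne (by rw [assemble_zero, assemble_zero, hkl])
    simp [this]

/-- Integration over the circles keeps the monomials with `l (I k) = s k`, and turns them back into
monomials in the `x_i`. -/
lemma integral_prod_pow (hr : 0 < r) {I : Fin d → Fin n} (hI : Function.Injective I) (s : Fin d → ℤ)
    (l : Fin n → ℕ) :
    ∫ u : Fin d → ℂ, (∏ i, Function.extend I u (fun i => (x i : ℂ)) i ^ l i) *
      ∏ k, ((x (I k) : ℂ) ^ s k * u k ^ (-s k)) ∂Measure.pi (fun _ => circleMeasure r) =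
      if ∀ k, (l (I k) : ℤ) = s k then ∏ i, (x i : ℂ) ^ l i else 0 := by
  classical
  set T : Finset (Fin n) := Finset.univ.map ⟨I, hI⟩ with hT
  set c : ℂ := ∏ i ∈ Finset.univ \ T, (x i : ℂ) ^ l i with hc
  have hprod : ∀ f : Fin n → ℂ, ∏ i, f i = (∏ i ∈ Finset.univ \ T, f i) * ∏ k, f (I k) := fun f => by
    rw [← Finset.prod_sdiff (Finset.subset_univ T), hT, Finset.prod_map]
    rfl
  have h1 : ∀ᵐ u ∂(Measure.pi fun _ : Fin d => circleMeasure r),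
      (∏ i, Function.extend I u (fun i => (x i : ℂ)) i ^ l i) *
      ∏ k, ((x (I k) : ℂ) ^ s k * u k ^ (-s k)) =
      c * ∏ k, ((x (I k) : ℂ) ^ s k * u k ^ ((l (I k) : ℤ) - s k)) := by
    filter_upwards [ae_pi_circleMeasure hr.le] with u hu
    rw [hprod, mul_assoc, ← Finset.prod_mul_distrib]
    congr 1
    · refine Finset.prod_congr rfl fun i hi => ?_
      rw [Function.extend_apply']
      rintro ⟨k, rfl⟩
      simp [hT] at hi
    · refine Finset.prod_congr rfl fun k _ => ?_
      rw [hI.extend_apply, sub_eq_add_neg, zpow_add₀ (ne_zero_of_norm_eq hr (hu k)), zpow_natCast]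
      ring
  rw [integral_congr_ae h1, integral_const_mul,
    integral_fintype_prod_eq_prod (f := fun k z => (x (I k) : ℂ) ^ s k * z ^ ((l (I k) : ℤ) - s k))]
  simp only [integral_const_mul, integral_zpow_circleMeasure hr, sub_eq_zero]
  split_ifs with h
  · rw [hprod, hc]
    congr 1
    refine Finset.prod_congr rfl fun k _ => ?_
    rw [if_pos (h k), mul_one, ← h k, zpow_natCast]
  · obtain ⟨k, hk⟩ := not_forall.1 h
    rw [Finset.prod_eq_zero (Finset.mem_univ k), mul_zero]
    rw [if_neg hk, mul_zero]

lemma norm_extend {I : Fin d → Fin n} (hI : Function.Injective I) (hx : ∀ i, 0 < x i)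
    {u : Fin d → ℂ} (hu : ∀ k, ‖u k‖ = r) (i : Fin n) :
    ‖Function.extend I u (fun i => (x i : ℂ)) i‖ = Function.extend I (fun _ => r) x i := by
  by_cases h : ∃ k, I k = i
  · obtain ⟨k, rfl⟩ := h
    rw [hI.extend_apply, hI.extend_apply, hu]
  · rw [Function.extend_apply' _ _ _ h, Function.extend_apply' _ _ _ h, Complex.norm_real,
      Real.norm_of_nonneg (hx i).le]

lemma extend_pos_lt_one {I : Fin d → Fin n} (hI : Function.Injective I)
    (hx : ∀ i, 0 < x i ∧ x i < 1) (hr : 0 < r) (hr1 : r < 1) (i : Fin n) :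
    0 < Function.extend I (fun _ => r) x i ∧ Function.extend I (fun _ => r) x i < 1 := by
  by_cases h : ∃ k, I k = i
  · obtain ⟨k, rfl⟩ := h
    rw [hI.extend_apply]
    exact ⟨hr, hr1⟩
  · rw [Function.extend_apply' _ _ _ h]
    exact hx i

/-- The generating function series converges absolutely for the moduli `r` and `x_i`, so that it may
be integrated term by term. -/
lemma hasSum_extraction {W : (Fin n → ℕ) → ℝ} (hW : IsWeight y W)
    (hx : ∀ i, 0 < x i ∧ x i < 1) (hr : 0 < r) (hr1 : r < 1)
    {I : Fin d → Fin n} (hI : Function.Injective I) :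
    HasSum (fun l : Fin n → ℕ => if ∀ k, (l (I k) : ℤ) = t k + n then
      (W l : ℂ) * ∏ i, (x i : ℂ) ^ l i else 0) (extraction x y t r I) := by
  set v : Fin n → ℝ := Function.extend I (fun _ => r) x with hv
  have hv01 := extend_pos_lt_one (r := r) hI hx hr hr1
  set F : (Fin n → ℕ) → (Fin d → ℂ) → ℂ := fun l u => (W l : ℂ) *
    ((∏ i, Function.extend I u (fun i => (x i : ℂ)) i ^ l i) *
      ∏ k, ((x (I k) : ℂ) ^ (t k + n) * u k ^ (-(t k + n)))) with hF
  have hFint : ∀ l, ∫ u, F l u ∂Measure.pi (fun _ => circleMeasure r) =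
      if ∀ k, (l (I k) : ℤ) = t k + n then (W l : ℂ) * ∏ i, (x i : ℂ) ^ l i else 0 := fun l => by
    simp only [hF]
    rw [integral_const_mul, integral_prod_pow hr hI fun k => t k + n]
    split_ifs <;> simp
  have hnorm : ∀ u : Fin d → ℂ, (∀ k, ‖u k‖ = r) → ∀ l, ‖F l u‖ =
      ‖(W l : ℂ) * ∏ i, (v i : ℂ) ^ l i‖ * ∏ k, (x (I k) ^ (t k + n) * r ^ (-(t k + n))) := by
    intro u hu l
    simp only [hF, norm_mul, norm_prod, norm_pow, norm_zpow, norm_extend hI (fun i => (hx i).1) hu,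
      hu, Complex.norm_real, Real.norm_of_nonneg (hx _).1.le, Real.norm_of_nonneg (hv01 _).1.le, hv]
    ring
  have hsum := hW.hasSum (fun i => (v i : ℂ)) (fun i => by exact_mod_cast (hv01 i).1.ne')
    fun i => by
      rw [Complex.norm_real, Real.norm_of_nonneg (hv01 i).1.le]
      exact (hv01 i).2
  have hmeasext : ∀ i, Measurable fun u : Fin d → ℂ => Function.extend I u (fun i => (x i : ℂ)) i := by
    intro i
    by_cases h : ∃ k, I k = i
    · obtain ⟨k, rfl⟩ := h
      simp only [hI.extend_apply]
      exact measurable_pi_apply k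
    · simp only [Function.extend_apply' _ _ _ h]
      exact measurable_const
  have hmeas : ∀ l, Measurable (F l) := fun l => by
    refine measurable_const.mul ((Finset.measurable_prod _ fun i _ => (hmeasext i).pow_const _).mul
      (Finset.measurable_prod _ fun k _ => measurable_const.mul ?_))
    exact (measurable_pi_apply k).pow_const _
  have hint : ∀ l, Integrable (F l) (Measure.pi fun _ => circleMeasure r) := fun l => by
    refine Integrable.of_bound (hmeas l).aestronglyMeasurable (‖(W l : ℂ) * ∏ i, (v i : ℂ) ^ l i‖ *
      ∏ k, (x (I k) ^ (t k + n) * r ^ (-(t k + n)))) ?_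
    filter_upwards [ae_pi_circleMeasure hr.le] with u hu
    exact (hnorm u hu l).le
  have hnint : ∀ l, ∫ u, ‖F l u‖ ∂Measure.pi (fun _ => circleMeasure r) =
      ‖(W l : ℂ) * ∏ i, (v i : ℂ) ^ l i‖ * ∏ k, (x (I k) ^ (t k + n) * r ^ (-(t k + n))) := fun l => by
    rw [integral_congr_ae ((ae_pi_circleMeasure hr.le).mono fun u hu => hnorm u hu l)]
    simp
  have h := hasSum_integral_of_summable_integral_norm hint (by
    simp only [hnint]
    exact hsum.summable.norm.mul_right _)
  simp only [hFint] at h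
  have e : ∫ u, ∑' l, F l u ∂Measure.pi (fun _ => circleMeasure r) = extraction x y t r I := by
    refine integral_congr_ae ?_
    filter_upwards [ae_pi_circleMeasure hr.le] with u hu
    have h2 := hW.hasSum (Function.extend I u fun i => (x i : ℂ)) (fun i h0 => by
        have := norm_extend hI (fun i => (hx i).1) hu i
        rw [h0, norm_zero] at this
        exact (hv01 i).1.ne this) fun i => by
      rw [norm_extend hI (fun i => (hx i).1) hu i]
      exact (hv01 i).2
    have h3 := h2.mul_right (∏ k, ((x (I k) : ℂ) ^ (t k + n) * u k ^ (-(t k + n))))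
    simp only [mul_assoc] at h3
    simp only [hF, h3.tsum_eq, weightGF, mul_assoc]
  rwa [e] at h

end


/-! ### The correlation function for distinct variables -/

section

variable {n d : ℕ} {x y : Fin n → ℝ} {t : Fin d → ℤ} {r : ℝ}

/-- The partitions in the event of the correlation function. -/
def containsSet (n : ℕ) {d : ℕ} (t : Fin d → ℤ) : Set YoungDiagram :=
  {lam | ∀ k : Fin d, ∃ i : Fin n, (lam.rowLen i : ℤ) - ((i : ℤ) + 1) = t k}

/-- The closed form of the partition function. -/
noncomputable def productFormula (x y : Fin n → ℝ) : ℝ :=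
  (∏ i, ∏ j ∈ Finset.Ioi i, (1 - x i * x j)⁻¹) * ∏ i, ∏ j, (1 - x i * y j)⁻¹

/-- At the variables `x_i` the generating function is the Vandermonde determinant times the product
formula. -/
lemma weightGF_ofReal : weightGF y (fun i => (x i : ℂ)) =
    alternant (fun i => (x i : ℂ)) (shiftedParts n ⊥) * (productFormula x y : ℂ) := by
  have h : ratioProd (fun i => (x i : ℂ)) = (∏ i, ∏ j ∈ Finset.Ioi i, ((x i : ℂ) - x j)) *
      ∏ i, ∏ j ∈ Finset.Ioi i, (1 - (x i : ℂ) * x j)⁻¹ := by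
    rw [ratioProd, ← Finset.prod_mul_distrib]
    refine Finset.prod_congr rfl fun i _ => ?_
    rw [← Finset.prod_mul_distrib]
    exact Finset.prod_congr rfl fun j _ => by rw [ratio, div_eq_mul_inv]
  rw [alternant_bot, weightGF, h, productFormula, mul_assoc]
  simp only [Complex.ofReal_mul, Complex.ofReal_prod, Complex.ofReal_inv, Complex.ofReal_sub,
    Complex.ofReal_one]

lemma alternant_ofReal (x : Fin n → ℝ) (l : Fin n → ℕ) :
    alternant (fun i => (x i : ℂ)) l = ((alternant x l : ℝ) : ℂ) := by
  rw [alternant, alternant, Matrix.det_apply', Matrix.det_apply']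
  push_cast
  simp

open scoped Classical in
/-- A sequence without repetitions which takes the values `t_k + n` does so for exactly one choice
`I` of positions. -/
lemma sum_injective_ite (ht : Function.Injective t) {W : (Fin n → ℕ) → ℝ} (hW : IsWeight y W)
    (l : Fin n → ℕ) :
    (∑ I : Fin d → Fin n, if Function.Injective I then
      (if ∀ k, (l (I k) : ℤ) = t k + n then (W l : ℂ) * ∏ i, (x i : ℂ) ^ l i else 0) else 0) =
    if ∀ k, ∃ i, (l i : ℤ) = t k + n then (W l : ℂ) * ∏ i, (x i : ℂ) ^ l i else 0 := by
  by_cases hl : Function.Injective l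
  · split_ifs with h
    · choose I hI using h
      rw [Finset.sum_eq_single I]
      · rw [if_pos, if_pos hI]
        intro k k' hkk
        have h1 := hI k
        rw [hkk, hI k'] at h1
        exact ht (by linarith)
      · intro J _ hJ
        split_ifs with h1 h2
        · refine absurd (funext fun k => hl ?_) hJ
          have := (h2 k).trans (hI k).symm
          exact_mod_cast this
        · rfl
        · rfl
      · simp
    · refine Finset.sum_eq_zero fun I _ => ?_
      rw [if_neg (c := ∀ k, (l (I k) : ℤ) = t k + n) fun h' => h fun k => ⟨I k, h' k⟩, ite_self]
  · simp [eq_zero_of_not_injective hW.perm hl]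

open scoped Classical in
lemma hasSum_weight (ht : Function.Injective t) {W : (Fin n → ℕ) → ℝ} (hW : IsWeight y W)
    (hinj : Function.Injective x) (hx : ∀ i, 0 < x i ∧ x i < 1)
    (hy : ∀ i, 0 < y i ∧ y i < 1) (hr : 0 < r) (hrx : ∀ i, r < x i) (hr1 : r < 1) :
    HasSum (fun l : Fin n → ℕ => if ∀ k, ∃ i, (l i : ℤ) = t k + n then
      (W l : ℂ) * ∏ i, (x i : ℂ) ^ l i else 0)
      (weightGF y (fun i => (x i : ℂ)) * pfaffian (Matrix.of (nodeIntegral y t r x))) := by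
  rw [weightGF_mul_pfaffian hinj hx hy hr hrx hr1]
  have h := hasSum_sum (s := Finset.univ) (f := fun (I : Fin d → Fin n) (l : Fin n → ℕ) =>
    if Function.Injective I then (if ∀ k, (l (I k) : ℤ) = t k + n then
      (W l : ℂ) * ∏ i, (x i : ℂ) ^ l i else 0) else 0)
    (a := fun I => if Function.Injective I then extraction x y t r I else 0) fun I _ => by
      split_ifs with hI
      · simpa only [if_pos hI] using hasSum_extraction (t := t) hW hx hr hr1 hI
      · simpa only [if_neg hI] using hasSum_zero
  simpa only [sum_injective_ite ht hW] using h

lemma tsum_subtype_colLen (A : Set YoungDiagram) :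
    ∑' lam : {lam : YoungDiagram // lam.colLen 0 ≤ n}, A.indicator (psmWeight x y) lam.1 =
      ∑' lam, A.indicator (psmWeight x y) lam := by
  refine tsum_subtype_eq_of_support_subset (s := {lam : YoungDiagram | lam.colLen 0 ≤ n})
    fun lam hlam => ?_
  by_contra hcon
  refine hlam ?_
  by_cases hA : lam ∈ A
  · rw [Set.indicator_of_mem hA, psmWeight, schur_eq_zero x (not_le.1 hcon), zero_mul]
  · rw [Set.indicator_of_notMem hA]

open scoped Classical in
/-- Grouping the sequences into permutations of `lam_i - i + n` produces the alternants, and hence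
the Schur functions by the bialternant formula. -/
lemma tsum_weight {W : (Fin n → ℕ) → ℝ} (hW : IsWeight y W)
    (hs : Summable (fun l : Fin n → ℕ => if ∀ k, ∃ i, (l i : ℤ) = t k + n then
      (W l : ℂ) * ∏ i, (x i : ℂ) ^ l i else 0)) :
    (∑' l : Fin n → ℕ, if ∀ k, ∃ i, (l i : ℤ) = t k + n then
      (W l : ℂ) * ∏ i, (x i : ℂ) ^ l i else 0) =
    alternant (fun i => (x i : ℂ)) (shiftedParts n ⊥) *
      ((∑' lam, (containsSet n t).indicator (psmWeight x y) lam : ℝ) : ℂ) := by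
  rw [tsum_eq_tsum_strictAnti hs fun l hl => by simp [eq_zero_of_not_injective hW.perm hl],
    ← (partsEquiv n).tsum_eq, ← tsum_subtype_colLen, Complex.ofReal_tsum, ← tsum_mul_left]
  congr 1
  funext lam
  have h1 : ((partsEquiv n lam).1 : Fin n → ℕ) = shiftedParts n lam.1 := rfl
  have h2 : ∀ σ : Equiv.Perm (Fin n),
      (∀ k, ∃ i, (shiftedParts n lam.1 (σ i) : ℤ) = t k + n) ↔ lam.1 ∈ containsSet n t := by
    intro σ
    refine forall_congr' fun k => ?_
    rw [← σ.surjective.exists (p := fun i => (shiftedParts n lam.1 i : ℤ) = t k + n)]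
    refine exists_congr fun i => ?_
    rw [shiftedParts_cast]
    constructor <;> intro h <;> linarith
  simp only [h1, h2, hW.perm, hW.shiftedParts lam.1 lam.2]
  by_cases hA : lam.1 ∈ containsSet n t
  · simp only [if_pos hA, Set.indicator_of_mem hA, psmWeight]
    push_cast
    rw [← mul_assoc, alternant_ofReal, ← Complex.ofReal_mul, ← alternant_shiftedParts x lam.2,
      ← alternant_ofReal, alternant, ← Matrix.det_transpose, Matrix.det_apply', Finset.sum_mul]
    refine Finset.sum_congr rfl fun σ _ => ?_
    simp only [Matrix.transpose_apply, Matrix.of_apply]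
    ring
  · simp [if_neg hA, Set.indicator_of_notMem hA]

lemma exists_pos_lt (hx : ∀ i, 0 < x i) : ∃ r : ℝ, 0 < r ∧ r < 1 ∧ ∀ i, r < x i := by
  have h : ∀ᶠ r in 𝓝[>] (0 : ℝ), 0 < r ∧ r < 1 ∧ ∀ i, r < x i := by
    refine Eventually.and self_mem_nhdsWithin (Filter.Eventually.filter_mono nhdsWithin_le_nhds ?_)
    exact (eventually_lt_nhds one_pos).and (eventually_all.2 fun i => eventually_lt_nhds (hx i))
  exact h.exists

/-- The Vandermonde determinant, which is nonzero for distinct variables, is cancelled from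
`hasSum_weight`. -/
lemma tsum_eq_productFormula_mul (ht : Function.Injective t)
    (hinj : Function.Injective x) (hx : ∀ i, 0 < x i ∧ x i < 1)
    (hy : ∀ i, 0 < y i ∧ y i < 1) (hr : 0 < r) (hrx : ∀ i, r < x i) (hr1 : r < 1) :
    ((∑' lam, (containsSet n t).indicator (psmWeight x y) lam : ℝ) : ℂ) =
      productFormula x y * pfaffian (Matrix.of (nodeIntegral y t r x)) := by
  obtain ⟨W, hW⟩ := exists_isWeight n hy
  have h := hasSum_weight ht hW hinj hx hy hr hrx hr1
  have h2 := tsum_weight hW h.summable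
  rw [h.tsum_eq, weightGF_ofReal, mul_assoc] at h2
  have hne : alternant (fun i => (x i : ℂ)) (shiftedParts n ⊥) ≠ 0 := by
    rw [alternant_bot]
    refine Finset.prod_ne_zero_iff.2 fun i _ => Finset.prod_ne_zero_iff.2 fun j hj => ?_
    refine sub_ne_zero.2 fun h => (Finset.mem_Ioi.1 hj).ne (hinj (by exact_mod_cast h))
  exact (mul_left_cancel₀ hne h2).symm

end


/-! ### Passage to arbitrary variables -/

section

variable {n d : ℕ} {x y : Fin n → ℝ} {t : Fin d → ℤ}

lemma continuous_schur (lam : YoungDiagram) : Continuous fun x : Fin n → ℝ => schur lam x := by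
  unfold schur skewSchur
  refine Continuous.matrix_det (continuous_pi fun i => continuous_pi fun j => ?_)
  exact continuous_hComplete _

lemma abs_jtDet_le {C ρ : ℝ} (hρ : 0 < ρ) (hx : ∀ i, 0 ≤ x i)
    (hC : ∀ k : ℤ, hComplete x k ≤ C * ρ ^ k) {N : ℕ} (l m : Fin N → ℕ) :
    |jtDet x l m| ≤ N.factorial * (C ^ N * (∏ j, ρ ^ (-(m j : ℤ))) * ∏ i, ρ ^ l i) := by
  rw [jtDet, Matrix.det_apply']
  refine (Finset.abs_sum_le_sum_abs _ _).trans ?_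
  have h : ∀ σ ∈ (Finset.univ : Finset (Equiv.Perm (Fin N))),
      |((Equiv.Perm.sign σ : ℤ) : ℝ) * ∏ i, Matrix.of (fun i j => hComplete x ((l i : ℤ) - m j))
        (σ i) i| ≤ C ^ N * (∏ j, ρ ^ (-(m j : ℤ))) * ∏ i, ρ ^ l i := by
    intro σ _
    rw [abs_mul, ← Int.cast_abs, Int.isUnit_iff_abs_eq.1 (Equiv.Perm.sign σ).isUnit, Int.cast_one,
      one_mul, Finset.abs_prod, ← Equiv.prod_comp σ fun i => ρ ^ l i, ← Fin.prod_const,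
      ← Finset.prod_mul_distrib, ← Finset.prod_mul_distrib]
    refine Finset.prod_le_prod (fun i _ => abs_nonneg _) fun i _ => ?_
    rw [Matrix.of_apply, abs_of_nonneg (hComplete_nonneg hx _)]
    refine (hC _).trans_eq ?_
    rw [sub_eq_neg_add, zpow_add₀ hρ.ne', zpow_natCast]
    ring
  refine (Finset.sum_le_sum h).trans_eq ?_
  rw [Finset.sum_const, Finset.card_univ, Fintype.card_perm, Fintype.card_fin, nsmul_eq_mul]

/-- A summable bound for the weights, uniform in the variables below `R < 1`. -/
lemma exists_summable_bound (hy : ∀ i, 0 < y i ∧ y i < 1) {R : ℝ} (hR0 : 0 ≤ R) (hR : R < 1) :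
    ∃ b : YoungDiagram → ℝ, Summable b ∧ ∀ x : Fin n → ℝ, (∀ i, 0 ≤ x i ∧ x i ≤ R) →
      ∀ lam, |psmWeight x y lam| ≤ b lam := by
  obtain ⟨ρ, hRρ, hρ1⟩ := exists_between hR
  have hρ : 0 < ρ := hR0.trans_lt hRρ
  obtain ⟨C, hC⟩ := exists_hComplete_le (n := n) hR0 hRρ
  obtain ⟨W, hW⟩ := exists_isWeight n hy
  have hs := (hW.hasSum (fun _ => (ρ : ℂ)) (fun _ => by exact_mod_cast hρ.ne') fun _ => by
    rwa [Complex.norm_real, Real.norm_of_nonneg hρ.le]).summable.norm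
  set K : ℝ := n.factorial * (C ^ n * ∏ j, ρ ^ (-(shiftedParts n ⊥ j : ℤ))) with hK
  set g : (Fin n → ℕ) → ℝ := fun l => ‖(W l : ℂ) * ∏ i, (ρ : ℂ) ^ l i‖ with hg
  set S : Set YoungDiagram := {lam | lam.colLen 0 ≤ n} with hS
  have hinj : Function.Injective fun lam : S => shiftedParts n lam.1 := fun a b hab =>
    Subtype.ext (shiftedParts_inj a.2 b.2 hab)
  refine ⟨S.indicator fun lam => K * g (shiftedParts n lam), ?_, fun x hx lam => ?_⟩
  · rw [← summable_subtype_iff_indicator]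
    exact (hs.comp_injective hinj).mul_left K
  · by_cases hlam : lam ∈ S
    · rw [Set.indicator_of_mem hlam, psmWeight, schur, ← jtDet_shiftedParts x bot_le hlam, abs_mul]
      have h1 := abs_jtDet_le hρ (fun i => (hx i).1) (hC x hx) (shiftedParts n lam)
        (shiftedParts n ⊥)
      refine (mul_le_mul_of_nonneg_right h1 (abs_nonneg _)).trans_eq ?_
      simp only [hK, hg, norm_mul, norm_prod, norm_pow, Complex.norm_real, Real.norm_of_nonneg hρ.le,
        hW.shiftedParts lam hlam, Real.norm_eq_abs]
      ring
    · rw [Set.indicator_of_notMem hlam, psmWeight, schur_eq_zero x (not_le.1 hlam), zero_mul,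
        abs_zero]

/-- Dominated convergence, with the bound of `exists_summable_bound`. -/
lemma continuousAt_tsum_psmWeight (hy : ∀ i, 0 < y i ∧ y i < 1) (hx : ∀ i, 0 < x i ∧ x i < 1)
    (A : Set YoungDiagram) :
    ContinuousAt (fun x' : Fin n → ℝ => ∑' lam, A.indicator (psmWeight x' y) lam) x := by
  obtain ⟨R, hR0, hR, hxR⟩ : ∃ R : ℝ, 0 ≤ R ∧ R < 1 ∧ ∀ i, x i < R := by
    have h : ∀ᶠ R in 𝓝[<] (1 : ℝ), R < 1 ∧ 0 < R ∧ ∀ i, x i < R := by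
      refine Eventually.and self_mem_nhdsWithin (Filter.Eventually.filter_mono nhdsWithin_le_nhds ?_)
      exact (eventually_gt_nhds one_pos).and (eventually_all.2 fun i => eventually_gt_nhds (hx i).2)
    obtain ⟨R, h1, h2, h3⟩ := h.exists
    exact ⟨R, h2.le, h1, h3⟩
  obtain ⟨b, hb, hbound⟩ := exists_summable_bound (n := n) hy hR0 hR
  refine tendsto_tsum_of_dominated_convergence hb (fun lam => ?_) ?_
  · by_cases hA : lam ∈ A
    · simp only [Set.indicator_of_mem hA, psmWeight]
      exact ((continuous_schur lam).tendsto x).mul_const _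
    · simp only [Set.indicator_of_notMem hA]
      exact tendsto_const_nhds
  · have h1 : ∀ᶠ x' : Fin n → ℝ in 𝓝 x, ∀ i, 0 < x' i ∧ x' i < R := eventually_all.2 fun i =>
      (((continuous_apply i).tendsto x).eventually_const_lt (hx i).1).and
        (((continuous_apply i).tendsto x).eventually_lt_const (hxR i))
    filter_upwards [h1] with x' hx' lam
    have h2 := hbound x' (fun i => ⟨(hx' i).1.le, (hx' i).2.le⟩) lam
    rw [Real.norm_eq_abs]
    by_cases hA : lam ∈ A
    · rwa [Set.indicator_of_mem hA]
    · rw [Set.indicator_of_notMem hA, abs_zero]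
      exact (abs_nonneg _).trans h2

lemma productFormula_pos (hx : ∀ i, 0 < x i ∧ x i < 1) (hy : ∀ i, 0 < y i ∧ y i < 1) :
    0 < productFormula x y := by
  have h : ∀ a b : ℝ, 0 < a ∧ a < 1 → 0 < b ∧ b < 1 → 0 < (1 - a * b)⁻¹ := fun a b ha hb =>
    inv_pos.2 (sub_pos.2 (by nlinarith [ha.1, ha.2, hb.1, hb.2]))
  exact mul_pos (Finset.prod_pos fun i _ => Finset.prod_pos fun j _ => h _ _ (hx i) (hx j))
    (Finset.prod_pos fun i _ => Finset.prod_pos fun j _ => h _ _ (hx i) (hy j))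

lemma continuousAt_productFormula (hx : ∀ i, 0 < x i ∧ x i < 1) (hy : ∀ i, 0 < y i ∧ y i < 1) :
    ContinuousAt (fun x' => productFormula x' y) x := by
  have h : ∀ a b : ℝ, 0 < a ∧ a < 1 → 0 < b ∧ b < 1 → 1 - a * b ≠ 0 := fun a b ha hb =>
    (sub_pos.2 (by nlinarith [ha.1, ha.2, hb.1, hb.2])).ne'
  have hc : ∀ i, ContinuousAt (fun x' : Fin n → ℝ => x' i) x := fun i =>
    (continuous_apply i).continuousAt
  refine ContinuousAt.mul (tendsto_finsetProd _ fun i _ => tendsto_finsetProd _ fun j _ => ?_)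
    (tendsto_finsetProd _ fun i _ => tendsto_finsetProd _ fun j _ => ?_)
  · exact (continuousAt_const.sub ((hc i).mul (hc j))).inv₀ (h _ _ (hx i) (hx j))
  · exact (continuousAt_const.sub ((hc i).mul continuousAt_const)).inv₀ (h _ _ (hx i) (hy j))

lemma continuousOn_doubleIntegral {X : Type*} [TopologicalSpace X] {C D : ClosedContour}
    {F : X → ℂ → ℂ → ℂ} {s : Set X}
    (hF : ContinuousOn (fun q : (X × ℂ) × ℂ => F q.1.1 q.1.2 q.2) ((s ×ˢ C.image) ×ˢ D.image)) :
    ContinuousOn (fun x => doubleIntegral C D (F x)) s := by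
  have h1 : ContinuousOn (fun p : X × ℂ => D.integral (F p.1 p.2)) (s ×ˢ C.image) := by
    intro p hp
    refine D.continuousWithinAt_integral (f := fun p : X × ℂ => F p.1 p.2) hp (fun q hq => ?_)
      fun w hw => hF (p, w) ⟨hp, hw⟩
    exact hF.comp (f := fun w => (q, w)) (by fun_prop) fun w hw => ⟨hq, hw⟩
  intro x hx
  refine continuousWithinAt_const.mul ?_
  refine C.continuousWithinAt_integral (f := fun x z => D.integral (F x z)) hx (fun x' hx' => ?_)
    fun z hz => h1 (x, z) ⟨hx, hz⟩
  exact h1.comp (f := fun z => (x', z)) (by fun_prop) fun z hz => ⟨hx', hz⟩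

lemma continuousOn_outerFactor_prod (t : ℤ) {s : Set (Fin n → ℝ)} {U : Set ℂ}
    (hU : ∀ z ∈ U, 1 < ‖z‖) (hxU : ∀ x ∈ s, ∀ i, (x i : ℂ)⁻¹ ∉ U) :
    ContinuousOn (fun p : (Fin n → ℝ) × ℂ => outerFactor p.1 y t p.2) (s ×ˢ U) := by
  have h0 : ∀ p ∈ s ×ˢ U, p.2 ≠ 0 := fun p hp h => by
    have := hU _ hp.2
    rw [h, norm_zero] at this
    linarith
  have hinv : ContinuousOn (fun p : (Fin n → ℝ) × ℂ => p.2⁻¹) (s ×ˢ U) :=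
    continuousOn_snd.inv₀ h0
  have hxi : ∀ i, ContinuousOn (fun p : (Fin n → ℝ) × ℂ => (p.1 i : ℂ)) (s ×ˢ U) := fun i => by
    fun_prop
  refine ContinuousOn.mul (ContinuousOn.mul (continuousOn_finsetProd _ fun i _ => ?_) ?_) ?_
  · refine ContinuousOn.div ?_ ?_ fun p hp h => ?_
    · exact (continuousOn_const.sub (hinv.mul (hxi i))).mul
        (continuousOn_const.sub (hinv.mul continuousOn_const))
    · exact continuousOn_const.sub (continuousOn_snd.mul (hxi i))
    · refine hxU _ hp.1 i ?_
      rw [← eq_inv_of_mul_eq_one_left (sub_eq_zero.1 h).symm]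
      exact hp.2
  · refine ContinuousOn.inv₀ (by fun_prop) fun p hp h => ?_
    have h1 := congrArg norm (sub_eq_zero.1 h)
    rw [norm_pow, norm_one] at h1
    nlinarith [hU _ hp.2]
  · exact continuousOn_snd.zpow₀ _ fun p hp => .inl (h0 p hp)

lemma continuousOn_innerFactor_prod (t : ℤ) {s : Set (Fin n → ℝ)} {U : Set ℂ} (h0 : (0 : ℂ) ∉ U)
    (hxU : ∀ x ∈ s, ∀ i, (x i : ℂ)⁻¹ ∉ U) (hyU : ∀ i, (y i : ℂ)⁻¹ ∉ U) :
    ContinuousOn (fun p : (Fin n → ℝ) × ℂ => innerFactor p.1 y t p.2) (s ×ˢ U) := by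
  have h0 : ∀ p ∈ s ×ˢ U, p.2 ≠ 0 := fun p hp h => h0 (h ▸ hp.2)
  have hinv : ContinuousOn (fun p : (Fin n → ℝ) × ℂ => p.2⁻¹) (s ×ˢ U) :=
    continuousOn_snd.inv₀ h0
  have hxi : ∀ i, ContinuousOn (fun p : (Fin n → ℝ) × ℂ => (p.1 i : ℂ)) (s ×ˢ U) := fun i => by
    fun_prop
  refine ContinuousOn.mul (ContinuousOn.mul hinv (continuousOn_finsetProd _ fun i _ => ?_)) ?_
  · refine ContinuousOn.div ?_ ?_ fun p hp => mul_ne_zero (fun h => ?_) fun h => ?_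
    · exact continuousOn_const.sub (hinv.mul (hxi i))
    · exact (continuousOn_const.sub (continuousOn_snd.mul (hxi i))).mul
        (continuousOn_const.sub (continuousOn_snd.mul continuousOn_const))
    · refine hxU _ hp.1 i ?_
      rw [← eq_inv_of_mul_eq_one_left (sub_eq_zero.1 h).symm]
      exact hp.2
    · refine hyU i ?_
      rw [← eq_inv_of_mul_eq_one_left (sub_eq_zero.1 h).symm]
      exact hp.2
  · exact continuousOn_snd.zpow₀ _ fun p hp => .inl (h0 p hp)

lemma continuousOn_doubleIntegral_ratio {s : Set (Fin n → ℝ)} {C D : ClosedContour}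
    {f g : (Fin n → ℝ) → ℂ → ℂ}
    (hf : ContinuousOn (fun p : (Fin n → ℝ) × ℂ => f p.1 p.2) (s ×ˢ C.image))
    (hg : ContinuousOn (fun p : (Fin n → ℝ) × ℂ => g p.1 p.2) (s ×ˢ D.image))
    (h : ∀ z ∈ C.image, ∀ w ∈ D.image, z * w ≠ 1) :
    ContinuousOn (fun x => doubleIntegral C D fun z w => -ratio z w * (f x z * g x w)) s := by
  refine continuousOn_doubleIntegral (ContinuousOn.mul (ContinuousOn.neg ?_) (ContinuousOn.mul ?_ ?_))
  · exact (continuousOn_ratio h).comp (f := fun q : ((Fin n → ℝ) × ℂ) × ℂ => (q.1.2, q.2))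
      (by fun_prop) fun q hq => ⟨hq.1.2, hq.2⟩
  · exact hf.comp (f := fun q : ((Fin n → ℝ) × ℂ) × ℂ => q.1) (by fun_prop) fun q hq => hq.1
  · exact hg.comp (f := fun q : ((Fin n → ℝ) × ℂ) × ℂ => (q.1.1, q.2)) (by fun_prop)
      fun q hq => ⟨hq.1.1, hq.2⟩

/-- The assumptions on the variables `x_i`, relative to the contours outside the unit circle. -/
def admissible (n : ℕ) (C₁ C₂ C₃ C₄ : ClosedContour) : Set (Fin n → ℝ) :=
  {x | ∀ i, (0 < x i ∧ x i < 1) ∧ C₁.Encloses (x i : ℂ)⁻¹ ∧ C₂.Encloses (x i : ℂ)⁻¹ ∧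
    C₃.Encloses (x i : ℂ)⁻¹ ∧ C₄.Encloses (x i : ℂ)⁻¹}

variable {C₁ C₂ C₃ C₄ C₅ C₆ : ClosedContour}

lemma admissible_mem_nhds (hx : x ∈ admissible n C₁ C₂ C₃ C₄) :
    admissible n C₁ C₂ C₃ C₄ ∈ 𝓝 x := by
  refine eventually_all.2 fun i => ?_
  have hi : Tendsto (fun x' : Fin n → ℝ => x' i) (𝓝 x) (𝓝 (x i)) := (continuous_apply i).tendsto x
  have hc : Tendsto (fun x' : Fin n → ℝ => (x' i : ℂ)⁻¹) (𝓝 x) (𝓝 (x i : ℂ)⁻¹) :=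
    ((Complex.continuous_ofReal.tendsto _).comp hi).inv₀ (by exact_mod_cast (hx i).1.1.ne')
  exact ((hi.eventually_const_lt (hx i).1.1).and (hi.eventually_lt_const (hx i).1.2)).and
    ((hc.eventually (hx i).2.1.eventually).and ((hc.eventually (hx i).2.2.1.eventually).and
      ((hc.eventually (hx i).2.2.2.1.eventually).and (hc.eventually (hx i).2.2.2.2.eventually))))

lemma continuousAt_kernel (hy : ∀ i, 0 < y i ∧ y i < 1)
    (hx : x ∈ admissible n C₁ C₂ C₃ C₄)
    (hC₁ : ∀ z ∈ C₁.image, 1 < ‖z‖) (hC₂ : ∀ w ∈ C₂.image, 1 < ‖w‖)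
    (hC₃ : ∀ z ∈ C₃.image, 1 < ‖z‖)
    (hC₃₄ : ∀ z ∈ C₃.image, ∀ w ∈ C₄.image, 1 < ‖z * w‖)
    (hC₄ : C₄.Excludes 0 ∧ ∀ i, C₄.Encloses ((y i : ℂ)⁻¹))
    (hC₅ : (∀ z ∈ C₅.image, ‖z‖ < 1) ∧ C₅.Encloses 0)
    (hC₆ : (∀ w ∈ C₆.image, ‖w‖ < 1) ∧ C₆.Encloses 0) (a b : Fin d × Fin 2) :
    ContinuousAt (fun x' => kernel x' y t C₁ C₂ C₃ C₄ C₅ C₆ a b) x := by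
  set s := admissible n C₁ C₂ C₃ C₄ with hs
  have hinv : ∀ c : ℝ, 0 < c → c < 1 → ∀ U : Set ℂ, (∀ z ∈ U, ‖z‖ < 1) → (c : ℂ)⁻¹ ∉ U :=
    fun c h0 h1 U hU h => by
      have := hU _ h
      rw [norm_inv_ofReal h0] at this
      exact this.not_gt ((one_lt_inv₀ h0).2 h1)
  have hgt : ∀ z : ℂ, 1 < ‖z‖ → z ≠ 1 := fun z h h' => by
    rw [h', norm_one] at h
    exact lt_irrefl _ h
  have h11 : ∀ k l, ContinuousOn (fun x' => kernel11 x' y t C₁ C₂ k l) s := fun k l => by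
    simp only [kernel11, kernel11_integrand]
    refine continuousOn_doubleIntegral_ratio
      (continuousOn_outerFactor_prod _ hC₁ fun x hx i => (hx i).2.1.1)
      (continuousOn_outerFactor_prod _ hC₂ fun x hx i => (hx i).2.2.1.1)
      fun z hz w hw => hgt _ ?_
    rw [norm_mul]
    nlinarith [hC₁ z hz, hC₂ w hw]
  have h12 : ∀ k l, ContinuousOn (fun x' => kernel12 x' y t C₃ C₄ k l) s := fun k l => by
    simp only [kernel12, kernel12_integrand]
    exact continuousOn_doubleIntegral_ratio
      (continuousOn_outerFactor_prod _ hC₃ fun x hx i => (hx i).2.2.2.1.1)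
      (continuousOn_innerFactor_prod _ hC₄.1.1 (fun x hx i => (hx i).2.2.2.2.1)
        fun i => (hC₄.2 i).1) fun z hz w hw => hgt _ (hC₃₄ z hz w hw)
  have h22 : ∀ k l, ContinuousOn (fun x' => kernel22 x' y t C₅ C₆ k l) s := fun k l => by
    simp only [kernel22, kernel22_integrand]
    refine continuousOn_doubleIntegral_ratio
      (continuousOn_innerFactor_prod _ hC₅.2.1 (fun x hx i => hinv _ (hx i).1.1 (hx i).1.2 _ hC₅.1)
        fun i => hinv _ (hy i).1 (hy i).2 _ hC₅.1)
      (continuousOn_innerFactor_prod _ hC₆.2.1 (fun x hx i => hinv _ (hx i).1.1 (hx i).1.2 _ hC₆.1)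
        fun i => hinv _ (hy i).1 (hy i).2 _ hC₆.1) fun z hz w hw h => ?_
    have := mul_lt_one_of_nonneg_of_lt_one_left (norm_nonneg z) (hC₅.1 z hz) (hC₆.1 w hw).le
    rw [← norm_mul, h, norm_one] at this
    exact lt_irrefl _ this
  have hmem := admissible_mem_nhds hx
  obtain ⟨k, i⟩ := a
  obtain ⟨l, j⟩ := b
  fin_cases i <;> fin_cases j
  · exact (h11 k l).continuousAt hmem
  · exact (h12 k l).continuousAt hmem
  · exact ((h12 l k).continuousAt hmem).neg
  · exact (h22 k l).continuousAt hmem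

/-- The unnormalised correlation function and the skew-symmetry of the kernel, for distinct
variables. -/
lemma kernel_of_injective (ht : Function.Injective t) (hn : 0 < n) (htn : ∀ k, 1 ≤ t k + 2 * n)
    (hinj : Function.Injective x)
    (hy : ∀ i, 0 < y i ∧ y i < 1) (hx : x ∈ admissible n C₁ C₂ C₃ C₄)
    (hC₁ : (∀ z ∈ C₁.image, 1 < ‖z‖) ∧ C₁.Excludes 0)
    (hC₂ : (∀ w ∈ C₂.image, 1 < ‖w‖) ∧ C₂.Excludes 0)
    (hC₃ : (∀ z ∈ C₃.image, 1 < ‖z‖) ∧ C₃.Excludes 0)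
    (hC₃₄ : ∀ z ∈ C₃.image, ∀ w ∈ C₄.image, 1 < ‖z * w‖)
    (hC₄ : C₄.Excludes 0 ∧ ∀ i, C₄.Encloses ((y i : ℂ)⁻¹))
    (hC₅ : (∀ z ∈ C₅.image, ‖z‖ < 1) ∧ C₅.Encloses 0)
    (hC₆ : (∀ w ∈ C₆.image, ‖w‖ < 1) ∧ C₆.Encloses 0) :
    (∀ a b, kernel x y t C₁ C₂ C₃ C₄ C₅ C₆ b a = -kernel x y t C₁ C₂ C₃ C₄ C₅ C₆ a b) ∧
    ((∑' lam, (containsSet n t).indicator (psmWeight x y) lam : ℝ) : ℂ) =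
      productFormula x y * pfaffian (kernel x y t C₁ C₂ C₃ C₄ C₅ C₆) := by
  have hx01 : ∀ i, 0 < x i ∧ x i < 1 := fun i => (hx i).1
  obtain ⟨r, hr, hr1, hrx⟩ := exists_pos_lt fun i => (hx01 i).1
  have hK := kernel_eq_nodeIntegral (t := t) hn hinj hx01 hy hr hrx hr1 htn
    ⟨hC₁.1, hC₁.2, fun i => (hx i).2.1⟩ ⟨hC₂.1, hC₂.2, fun i => (hx i).2.2.1⟩
    ⟨hC₃.1, hC₃.2, fun i => (hx i).2.2.2.1⟩ hC₃₄
    ⟨hC₄.1, fun i => ⟨(hx i).2.2.2.2, hC₄.2 i⟩⟩ hC₅ hC₆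
  refine ⟨fun a b => ?_, ?_⟩
  · rw [hK, hK]
    exact nodeIntegral_antisymm hx01 hy hr hrx hr1 a b
  · have : kernel x y t C₁ C₂ C₃ C₄ C₅ C₆ = Matrix.of (nodeIntegral y t r x) :=
      Matrix.ext fun a b => hK a b
    rw [this]
    exact tsum_eq_productFormula_mul ht hinj hx01 hy hr hrx hr1

lemma tendsto_perturb (x : Fin n → ℝ) :
    Tendsto (fun ε : ℝ => fun i : Fin n => x i + ε * ((i : ℕ) + 1 : ℝ)) (𝓝[≠] 0) (𝓝 x) := by
  have h : Continuous fun ε : ℝ => fun i : Fin n => x i + ε * ((i : ℕ) + 1 : ℝ) := by fun_prop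
  have h' := (h.tendsto 0).mono_left (nhdsWithin_le_nhds (s := {0}ᶜ))
  simpa using h'

/-- The unnormalised correlation function and the skew-symmetry of the kernel.  Coincidences between
the variables are removed by the perturbation `x_i + ε (i + 1)`, `ε → 0`. -/
lemma kernel_of_admissible (ht : Function.Injective t) (hn : 0 < n) (htn : ∀ k, 1 ≤ t k + 2 * n)
    (hy : ∀ i, 0 < y i ∧ y i < 1) (hx : x ∈ admissible n C₁ C₂ C₃ C₄)
    (hC₁ : (∀ z ∈ C₁.image, 1 < ‖z‖) ∧ C₁.Excludes 0)
    (hC₂ : (∀ w ∈ C₂.image, 1 < ‖w‖) ∧ C₂.Excludes 0)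
    (hC₃ : (∀ z ∈ C₃.image, 1 < ‖z‖) ∧ C₃.Excludes 0)
    (hC₃₄ : ∀ z ∈ C₃.image, ∀ w ∈ C₄.image, 1 < ‖z * w‖)
    (hC₄ : C₄.Excludes 0 ∧ ∀ i, C₄.Encloses ((y i : ℂ)⁻¹))
    (hC₅ : (∀ z ∈ C₅.image, ‖z‖ < 1) ∧ C₅.Encloses 0)
    (hC₆ : (∀ w ∈ C₆.image, ‖w‖ < 1) ∧ C₆.Encloses 0) :
    (∀ a b, kernel x y t C₁ C₂ C₃ C₄ C₅ C₆ b a = -kernel x y t C₁ C₂ C₃ C₄ C₅ C₆ a b) ∧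
    ((∑' lam, (containsSet n t).indicator (psmWeight x y) lam : ℝ) : ℂ) =
      productFormula x y * pfaffian (kernel x y t C₁ C₂ C₃ C₄ C₅ C₆) := by
  have hx01 : ∀ i, 0 < x i ∧ x i < 1 := fun i => (hx i).1
  have hev : ∀ᶠ ε : ℝ in 𝓝[≠] 0, (∀ a b, kernel (fun i => x i + ε * ((i : ℕ) + 1 : ℝ)) y t
      C₁ C₂ C₃ C₄ C₅ C₆ b a = -kernel (fun i => x i + ε * ((i : ℕ) + 1 : ℝ)) y t
      C₁ C₂ C₃ C₄ C₅ C₆ a b) ∧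
    ((∑' lam, (containsSet n t).indicator (psmWeight (fun i => x i + ε * ((i : ℕ) + 1 : ℝ)) y) lam
      : ℝ) : ℂ) = productFormula (fun i => x i + ε * ((i : ℕ) + 1 : ℝ)) y *
      pfaffian (kernel (fun i => x i + ε * ((i : ℕ) + 1 : ℝ)) y t C₁ C₂ C₃ C₄ C₅ C₆) := by
    filter_upwards [eventually_injective_add_mul x,
      (tendsto_perturb x).eventually (admissible_mem_nhds hx)] with ε h1 h2
    exact kernel_of_injective ht hn htn h1 hy h2 hC₁ hC₂ hC₃ hC₃₄ hC₄ hC₅ hC₆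
  have hK : ∀ a b, Tendsto (fun ε : ℝ => kernel (fun i => x i + ε * ((i : ℕ) + 1 : ℝ)) y t
      C₁ C₂ C₃ C₄ C₅ C₆ a b) (𝓝[≠] 0) (𝓝 (kernel x y t C₁ C₂ C₃ C₄ C₅ C₆ a b)) := fun a b =>
    (continuousAt_kernel hy hx hC₁.1 hC₂.1 hC₃.1 hC₃₄ hC₄ hC₅ hC₆ a b).tendsto.comp
      (tendsto_perturb x)
  refine ⟨fun a b => ?_, ?_⟩
  · refine tendsto_nhds_unique (hK b a) ((hK a b).neg.congr' ?_)
    filter_upwards [hev] with ε hε using (hε.1 a b).symm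
  · have h1 := (Complex.continuous_ofReal.tendsto _).comp
      ((continuousAt_tsum_psmWeight hy hx01 (containsSet n t)).tendsto.comp (tendsto_perturb x))
    have h2 := (Complex.continuous_ofReal.tendsto _).comp
      ((continuousAt_productFormula hx01 hy).tendsto.comp (tendsto_perturb x))
    have h3 : Tendsto (fun ε : ℝ => pfaffian (kernel (fun i => x i + ε * ((i : ℕ) + 1 : ℝ)) y t
        C₁ C₂ C₃ C₄ C₅ C₆)) (𝓝[≠] 0) (𝓝 (pfaffian (kernel x y t C₁ C₂ C₃ C₄ C₅ C₆))) := by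
      unfold pfaffian
      exact (tendsto_finsetSum _ fun σ _ => (tendsto_finsetProd _ fun i _ => hK _ _).const_mul
        _).const_mul _
    refine tendsto_nhds_unique h1 ((h2.mul h3).congr' ?_)
    filter_upwards [hev] with ε hε using hε.2.symm

end

end PfaffianSchur

theorem theorem5p2 {n d : ℕ} (t : Fin d → ℤ) (ht : Function.Injective t)
    (hnd : d < n) (hnt : ∀ k : Fin d, (d : ℤ) - t k < (n : ℤ))
    (x y : Fin n → ℝ)
    (hx : ∀ i, 0 < x i ∧ x i < 1) (hy : ∀ i, 0 < y i ∧ y i < 1)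
    (hsum : Summable fun lam : YoungDiagram => |PfaffianSchur.psmWeight x y lam|)
    (C₁ C₂ C₃ C₄ C₅ C₆ : PfaffianSchur.ClosedContour)
    (hC₁ : (∀ z ∈ C₁.image, 1 < ‖z‖) ∧ C₁.Excludes 0 ∧
      ∀ i, C₁.Encloses ((x i : ℂ)⁻¹))
    (hC₂ : (∀ w ∈ C₂.image, 1 < ‖w‖) ∧ C₂.Excludes 0 ∧
      ∀ i, C₂.Encloses ((x i : ℂ)⁻¹))
    (hC₃ : (∀ z ∈ C₃.image, 1 < ‖z‖) ∧ C₃.Excludes 0 ∧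
      ∀ i, C₃.Encloses ((x i : ℂ)⁻¹))
    (hC₃₄ : ∀ z ∈ C₃.image, ∀ w ∈ C₄.image, 1 < ‖z * w‖)
    (hC₄ : C₄.Excludes 0 ∧ ∀ i, C₄.Encloses ((x i : ℂ)⁻¹) ∧ C₄.Encloses ((y i : ℂ)⁻¹))
    (hC₅ : (∀ z ∈ C₅.image, ‖z‖ < 1) ∧ C₅.Encloses 0)
    (hC₆ : (∀ w ∈ C₆.image, ‖w‖ < 1) ∧ C₆.Encloses 0) :
    (PfaffianSchur.kernel x y t C₁ C₂ C₃ C₄ C₅ C₆).transpose =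
        -PfaffianSchur.kernel x y t C₁ C₂ C₃ C₄ C₅ C₆ ∧
      ((PfaffianSchur.correlation x y t : ℝ) : ℂ) =
        PfaffianSchur.pfaffian (PfaffianSchur.kernel x y t C₁ C₂ C₃ C₄ C₅ C₆) := by
  have hadm : x ∈ PfaffianSchur.admissible n C₁ C₂ C₃ C₄ := fun i =>
    ⟨hx i, hC₁.2.2 i, hC₂.2.2 i, hC₃.2.2 i, (hC₄.2 i).1⟩
  have hn : 0 < n := by omega
  have key : ∀ {e : ℕ} (s : Fin e → ℤ), Function.Injective s → (∀ k, 1 ≤ s k + 2 * (n : ℤ)) →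
      (∀ a b, PfaffianSchur.kernel x y s C₁ C₂ C₃ C₄ C₅ C₆ b a =
        -PfaffianSchur.kernel x y s C₁ C₂ C₃ C₄ C₅ C₆ a b) ∧
      ((∑' lam, (PfaffianSchur.containsSet n s).indicator (PfaffianSchur.psmWeight x y) lam : ℝ) : ℂ)
        = PfaffianSchur.productFormula x y *
          PfaffianSchur.pfaffian (PfaffianSchur.kernel x y s C₁ C₂ C₃ C₄ C₅ C₆) := fun s hs hsn =>
    PfaffianSchur.kernel_of_admissible hs hn hsn hy hadm ⟨hC₁.1, hC₁.2.1⟩ ⟨hC₂.1, hC₂.2.1⟩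
      ⟨hC₃.1, hC₃.2.1⟩ hC₃₄ ⟨hC₄.1, fun i => (hC₄.2 i).2⟩ hC₅ hC₆
  -- `t k > d - n` and `n > d` give `t k + 2 n > 0`.
  obtain ⟨h1, h2⟩ := key t ht fun k => by have := hnt k; omega
  -- The empty set of positions gives the partition function.
  have h3 := (key (Fin.elim0 : Fin 0 → ℤ) (fun k => k.elim0) fun k => k.elim0).2
  have hZ : PfaffianSchur.partitionFunction x y = PfaffianSchur.productFormula x y := by
    have e : PfaffianSchur.containsSet n (Fin.elim0 : Fin 0 → ℤ) = Set.univ :=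
      Set.eq_univ_of_forall fun lam k => k.elim0
    rw [e, Set.indicator_univ] at h3
    rw [PfaffianSchur.partitionFunction]
    simpa [PfaffianSchur.pfaffian] using h3
  refine ⟨Matrix.ext fun a b => h1 a b, ?_⟩
  have h4 : PfaffianSchur.correlation x y t = (∑' lam, (PfaffianSchur.containsSet n t).indicator
      (PfaffianSchur.psmWeight x y) lam) / PfaffianSchur.partitionFunction x y := by
    rw [← tsum_div_const]
    refine tsum_congr fun lam => ?_
    change (PfaffianSchur.containsSet n t).indicator (PfaffianSchur.psm x y) lam = _
    by_cases hA : lam ∈ PfaffianSchur.containsSet n t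
    · rw [Set.indicator_of_mem hA, Set.indicator_of_mem hA]
      rfl
    · rw [Set.indicator_of_notMem hA, Set.indicator_of_notMem hA, zero_div]
  have hne : (PfaffianSchur.productFormula x y : ℂ) ≠ 0 := by
    exact_mod_cast (PfaffianSchur.productFormula_pos hx hy).ne'
  rw [h4, Complex.ofReal_div, h2, hZ, mul_div_cancel_left₀ _ hne]
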